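/- **Setting.** Let $d\ge 1$, $n_1,\dots,n_d$ be positive integers, $n=n_1\cdots n_d$, and let $1\le k<\min_i n_i$. Let $Y=f^0+\epsilon$, where $Y,f^0,\epsilon\in\mathbb R^{n_1\times\dots\times n_d}$ and $\epsilon$ has i.i.d. $\mathcal N(0,\sigma^2)$ entries, $\sigma>0$. Let $D^k=\prod_{i=1}^d D_i^k$, where, for $k+1\le j_i\le n_i$, $$(D_i^kf)(j_1,\dots,j_d)=n_i^{k-1}\sum_{l=0}^k(-1)^l\binom kl f(j_1,\dots,j_i-l,\dots,j_d),$$ so that $D^kf$ is indexed by $\times_i[k+1:n_i]$, where $[a:b]=\{a,\dots,b\}$. Let $\mathcal N_k$ be the nullspace of $D^k$ and let $f_{\mathcal N_k^\perp}$ denote the orthogonal projection of $f$ onto $\mathcal N_k^\perp$. For a tuning parameter $\lambda$ let $\hat f$ be a minimizer over $\mathrm f\in\mathbb R^{n_1\times\dots\times n_d}$ of $$\|(Y-\mathrm f)_{\mathcal N_k^\perp}\|_2^2/n+2\lambda\|D^k\mathrm f\|_1 ,$$ where $\|\cdot\|_2$ is the Frobenius norm and $\|\cdot\|_1$ the sum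 of absolute values of the entries. For $t>0$ put $\lambda_0(t)=\sigma\sqrt{(2\log(2n)+2t)/n}$. Let $S=\{t_1,\dots,t_s\}$, with $s=|S|$ and $t_m=(t_{1,m},\dots,t_{d,m})$, be a subset of $\times_i[k+1+(k+2)k\,:\,n_i-k+1-(k+2)k]$. A hyperrectangular tessellation for $S$ is a family of hyperrectangles $R_m=\times_i[t_{i,m}^-:t_{i,m}^+]$, $m=1,\dots,s$, contained in $\times_i[k+1:n_i]$ and with union $\times_i[k+1:n_i]$, such that for $m\ne m'$ no interior point of $R_m$ (a point with $t_{i,m}^-<j_i<t_{i,m}^+$ for all $i$) lies in $R_{m'}$, and such that all points of $\times_i[t_{i,m}:t_{i,m}+k-1]$ are interior points of $R_m$. Put $d_{i,m}^-=t_{i,m}-t_{i,m}^-$, $d_{i,m}^+=t_{i,m}^+-t_{i,m}-k+1$, $d_m^z=\prod_{i=1}^d d_{i,m}^{z_i}$ for $z\in\{-,+\}^d$, and $d_{i,\max}(S)=\max_m\max\{d_{i,m}^-,d_{i,m}^+\}$. **Theorem 3.1 (Adaptivity of trend filtering).** Fix $k\in\{1,2,3,4\}$. There are a constant $C_0>0$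 and an integer $N$, depending only on $k$, and for every $d\ge1$ a constant $K>0$, depending only on $k$ and $d$, such that the following holds for all $n_1,\dots,n_d>k$, all $\sigma>0$, all $f^0$, all $x,t>0$, all $g\in\mathbb R^{n_1\times\dots\times n_d}$, all $S$ as above and every hyperrectangular tessellation for $S$. Suppose that $$\lambda\ \ge\ C\,d\,\sqrt{\sum_{i=1}^d\Big(\frac{d_{i,\max}(S)}{n_i}\Big)^{2k-1}}\ \lambda_0(t),$$ where either $C\ge C_0$, or $$C\ge \frac{k^{(2k-1)/2}}{a_0}\quad\text{and}\quad \min_{i}\min_m\min\{d_{i,m}^-,d_{i,m}^+\}\ge N ,\qquad a_0=\begin{cases}1,&k=1,\\ 8\sqrt2/7,&k=2,\\ 144\sqrt3/76,&k=3,\\ 10.10,&k=4.\end{cases}$$ Then, with probability at least $1-e^{-x}-e^{-t}$, it holds that $$\begin{aligned}\|(\hat f-f^0)_{\mathcal N_k^\perp}\|_2^2/n\ \le\ &\|g-f^0_{\mathcal N_k^\perp}\|_2^2/n+4\lambda\|(D^kg)_{-S}\|_1+\frac{2\sigma^2}{n}\big(\sqrt x+\sqrt{ks}\big)^2\\ &+K\lambda^2\Big(\sum_{i=1}^d\log\big(e\,d_{i,\max}(S)\big)\Big)\sum_{m=1}^s\sum_{z\in\{-,+\}^d}\Big(\frac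 n{d_m^z}\Big)^{2k-1},\end{aligned}$$ where $(D^kg)_{-S}$ denotes the entries of $D^kg$ with index outside $S$. -/

import Mathlib

open MeasureTheory ProbabilityTheory

noncomputable section

namespace VitaliTF

variable {d : ℕ}

/-- The index box `[a : n₁] × ⋯ × [a : n_d]` (indices are 1-based, as usual for tensors). -/
def box (a : ℕ) (n : Fin d → ℕ) : Finset (Fin d → ℕ) :=
  Fintype.piFinset fun i => Finset.Icc a (n i)

/-- Tensors in `ℝ^{n₁ × ⋯ × n_d}`, with the Frobenius norm and inner product. -/
abbrev Tensor (n : Fin d → ℕ) : Type := EuclideanSpace ℝ (box 1 n)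

/-- The total number of entries `n = n₁ ⋯ n_d`, as a real number. -/
def size (n : Fin d → ℕ) : ℝ := ∏ i, (n i : ℝ)

/-- The entry `f(j₁, …, j_d)`; the value `0` outside the index box is never used. -/
def entry {n : Fin d → ℕ} (f : Tensor n) (j : Fin d → ℕ) : ℝ :=
  if h : j ∈ box 1 n then f ⟨j, h⟩ else 0

/-- The `k`-th order difference operator `D_i^k` along coordinate `i`, normalised by `n_i^{k-1}`,
on arrays indexed by `ℕ^d` (only indices with `j i ≥ k + 1` are meaningful). -/
def coordDiff (k : ℕ) (n : Fin d → ℕ) (i : Fin d) (F : (Fin d → ℕ) → ℝ) (j : Fin d → ℕ) : ℝ :=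
  (n i : ℝ) ^ (k - 1) * ∑ l ∈ Finset.range (k + 1),
    (-1 : ℝ) ^ l * (k.choose l : ℝ) * F (Function.update j i (j i - l))

/-- The product `D_1^k ⋯ D_d^k`, written out. -/
def totalDiff (k : ℕ) (n : Fin d → ℕ) (F : (Fin d → ℕ) → ℝ) (j : Fin d → ℕ) : ℝ :=
  (∏ i, (n i : ℝ) ^ (k - 1)) * ∑ l ∈ Fintype.piFinset fun _ : Fin d => Finset.range (k + 1),
    (∏ i, (-1 : ℝ) ^ l i * (k.choose (l i) : ℝ)) * F (fun i => j i - l i)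

/-- Auxiliary: composing the coordinate differences over a list of distinct coordinates. -/
theorem foldr_aux (k : ℕ) (n : Fin d → ℕ) (L : List (Fin d)) (hL : L.Nodup)
    (F : (Fin d → ℕ) → ℝ) (j : Fin d → ℕ) :
    L.foldr (fun i G => coordDiff k n i G) F j =
      (∏ i ∈ L.toFinset, (n i : ℝ) ^ (k - 1)) *
        ∑ l ∈ Fintype.piFinset fun i => if i ∈ L then Finset.range (k + 1) else {0},
          (∏ i, (-1 : ℝ) ^ l i * (k.choose (l i) : ℝ)) * F (fun i => j i - l i) := by
  induction L generalizing j with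
  | nil =>
    have : (Fintype.piFinset fun _ : Fin d => ({0} : Finset ℕ)) = {fun _ => 0} := by
      ext l; simp [funext_iff]
    simp [this]
  | cons i L ih =>
    have hi : i ∉ L := (List.nodup_cons.1 hL).1
    have ih' := ih (List.nodup_cons.1 hL).2
    rw [List.foldr_cons, List.toFinset_cons, Finset.prod_insert (by simpa using hi)]
    generalize L.foldr (fun i G => coordDiff k n i G) F = G at ih' ⊢
    unfold coordDiff
    simp only [ih']
    rw [mul_assoc]
    congr 1
    simp only [Finset.mul_sum]
    rw [← Finset.sum_product']
    refine Finset.sum_bij' (fun p _ => Function.update p.2 i p.1)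
      (fun l _ => (l i, Function.update l i 0)) ?_ ?_ ?_ ?_ ?_
    · rintro ⟨a, l⟩ h
      simp only [Finset.mem_product, Fintype.mem_piFinset] at h ⊢
      intro b
      by_cases hb : b = i
      · subst hb; simpa using h.1
      · simpa [hb] using h.2 b
    · intro l h
      rw [Fintype.mem_piFinset] at h
      simp only [Finset.mem_product, Fintype.mem_piFinset]
      refine ⟨by simpa using h i, fun b => ?_⟩
      by_cases hb : b = i
      · subst hb; simp [hi]
      · simpa [hb] using h b
    · rintro ⟨a, l⟩ h
      simp only [Finset.mem_product, Fintype.mem_piFinset] at h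
      have h0 : l i = 0 := by simpa [hi] using h.2 i
      simp [← h0]
    · intro l h
      simp
    · rintro ⟨a, l⟩ h
      simp only [Finset.mem_product, Fintype.mem_piFinset] at h
      have h0 : l i = 0 := by simpa [hi] using h.2 i
      have e1 : (fun b => Function.update j i (j i - a) b - l b)
          = fun b => j b - Function.update l i a b := by
        funext b
        by_cases hb : b = i
        · subst hb; simp [h0]
        · simp [hb]
      have e2 : (∏ b, (-1 : ℝ) ^ Function.update l i a b * (k.choose (Function.update l i a b) : ℝ))
          = ((-1 : ℝ) ^ a * (k.choose a : ℝ)) * ∏ b, (-1 : ℝ) ^ l b * (k.choose (l b) : ℝ) := by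
        rw [← Finset.mul_prod_erase _ _ (Finset.mem_univ i),
          ← Finset.mul_prod_erase (a := i) _ (fun b => (-1 : ℝ) ^ l b * (k.choose (l b) : ℝ)) (Finset.mem_univ i)]
        rw [Finset.prod_congr rfl (g := fun b => (-1 : ℝ) ^ l b * (k.choose (l b) : ℝ))]
        · simp [h0]
        · intro b hb
          simp [Finset.ne_of_mem_erase hb]
      dsimp only
      rw [e1, e2]
      ring

/-- `totalDiff` is the product (composition) of the operators `D_i^k`. -/
theorem totalDiff_eq_comp (k : ℕ) (n : Fin d → ℕ) (F : (Fin d → ℕ) → ℝ) :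
    totalDiff k n F = (List.finRange d).foldr (fun i G => coordDiff k n i G) F := by
  funext j
  rw [foldr_aux k n _ (List.nodup_finRange d)]
  simp [totalDiff]

/-- The total `k`-th order difference operator `D^k`, from tensors on `[1 : n₁] × ⋯ × [1 : n_d]`
to arrays on `[k+1 : n₁] × ⋯ × [k+1 : n_d]`. -/
def vitaliDiff (k : ℕ) (n : Fin d → ℕ) : Tensor n →ₗ[ℝ] (box (k + 1) n → ℝ) where
  toFun f j := totalDiff k n (entry f) j
  map_add' f g := by
    have h : ∀ j, entry (f + g) j = entry f j + entry g j := by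
      intro j; unfold entry; split_ifs <;> simp
    funext j
    simp [totalDiff, h, mul_add, Finset.sum_add_distrib]
  map_smul' c f := by
    have h : ∀ j, entry (c • f) j = c * entry f j := by
      intro j; unfold entry; split_ifs <;> simp
    funext j
    simp only [totalDiff, h, RingHom.id_apply, Pi.smul_apply, smul_eq_mul, Finset.mul_sum]
    exact Finset.sum_congr rfl fun l _ => by ring

/-- The `k`-th order Vitali total variation `‖D^k f‖₁`. -/
def vitaliTV (k : ℕ) (n : Fin d → ℕ) (f : Tensor n) : ℝ :=
  ∑ j, |vitaliDiff k n f j|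

/-- `‖(D^k g)_{-S}‖₁`, the sum over the indices of `D^k g` that are not in `S`. -/
def vitaliTVOff (k : ℕ) (n : Fin d → ℕ) (S : Finset (Fin d → ℕ)) (g : Tensor n) : ℝ :=
  ∑ j : box (k + 1) n, if (j : Fin d → ℕ) ∈ S then 0 else |vitaliDiff k n g j|

/-- The `d`-dimensional margin `f_{𝒩_k^⊥}`: the orthogonal projection of `f` onto the orthogonal
complement of the nullspace of `D^k`. -/
def margin (k : ℕ) (n : Fin d → ℕ) (f : Tensor n) : Tensor n :=
  (LinearMap.ker (vitaliDiff k n))ᗮ.starProjection f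

/-- The trend filtering objective. -/
def objective (k : ℕ) (n : Fin d → ℕ) (lam : ℝ) (Y f : Tensor n) : ℝ :=
  ‖margin k n (Y - f)‖ ^ 2 / size n + 2 * lam * vitaliTV k n f

/-- `fhat` is a minimiser of the trend filtering objective. Its margin `margin k n fhat` is the
`k`-th order Vitali trend filtering estimator of the margin of the signal. -/
def IsTrendFilter (k : ℕ) (n : Fin d → ℕ) (lam : ℝ) (Y fhat : Tensor n) : Prop :=
  ∀ f : Tensor n, objective k n lam Y fhat ≤ objective k n lam Y f

/-- The trend filtering objective has a minimiser. -/
theorem exists_isTrendFilter (k : ℕ) (n : Fin d → ℕ) (hn : ∀ i, 0 < n i) (lam : ℝ)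
    (hlam : 0 ≤ lam) (Y : Tensor n) : ∃ fhat, IsTrendFilter k n lam Y fhat := by
  have hs : 0 < size n := Finset.prod_pos fun i _ => by exact_mod_cast hn i
  set W := LinearMap.ker (vitaliDiff k n) with hW
  have hD : ∀ f, vitaliDiff k n (margin k n f) = vitaliDiff k n f := by
    intro f
    have : f - margin k n f ∈ W := by
      have := Submodule.sub_starProjection_mem_orthogonal (K := Wᗮ) f
      rwa [Submodule.orthogonal_orthogonal] at this
    have := LinearMap.mem_ker.1 this
    rw [map_sub, sub_eq_zero] at this
    exact this.symm
  have hP : ∀ f, margin k n (margin k n f) = margin k n f := by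
    intro f
    exact Submodule.starProjection_eq_self_iff.2 (Submodule.starProjection_apply_mem _ f)
  have hsub : ∀ f, margin k n (Y - f) = margin k n Y - margin k n f := fun f => by
    simp only [margin, map_sub]
  have hobj : ∀ f, objective k n lam Y (margin k n f) = objective k n lam Y f := by
    intro f
    simp only [objective, vitaliTV, hD, hsub, hP]
  have hcont : Continuous (objective k n lam Y) := by
    have : Continuous (vitaliDiff k n) := LinearMap.continuous_of_finiteDimensional _
    unfold objective vitaliTV margin
    fun_prop
  have htv : ∀ f, 0 ≤ vitaliTV k n f := fun f => Finset.sum_nonneg fun _ _ => abs_nonneg _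
  obtain ⟨m, hm, hmin⟩ := (isCompact_closedBall (margin k n Y) ‖margin k n Y‖).exists_isMinOn
    ⟨0, by simp⟩ hcont.continuousOn
  refine ⟨m, fun f => ?_⟩
  by_cases hf : margin k n f ∈ Metric.closedBall (margin k n Y) ‖margin k n Y‖
  · rw [← hobj f]; exact hmin hf
  · refine le_trans (hmin (a := 0) (by simp)) ?_
    rw [Metric.mem_closedBall, not_le, dist_comm, dist_eq_norm] at hf
    have h0 : vitaliTV k n (0 : Tensor n) = 0 := by simp [vitaliTV]
    simp only [objective, h0, hsub]
    have := htv f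
    have h1 : margin k n (0 : Tensor n) = 0 := by simp [margin]
    rw [h1, sub_zero, mul_zero, add_zero]
    have : ‖margin k n Y‖ ^ 2 / size n ≤ ‖margin k n Y - margin k n f‖ ^ 2 / size n := by
      gcongr
    have := mul_nonneg (mul_nonneg two_pos.le hlam) (htv f)
    linarith

/-- The `k^d` indices `×ᵢ [tᵢ : tᵢ + k - 1]` of the enlarged active set that belong to `t`. -/
def block (k : ℕ) (t : Fin d → ℕ) : Finset (Fin d → ℕ) :=
  Fintype.piFinset fun i => Finset.Icc (t i) (t i + k - 1)

/-- The hyperrectangle `×ᵢ [aᵢ : bᵢ]`. -/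
def rect (a b : Fin d → ℕ) : Finset (Fin d → ℕ) :=
  Fintype.piFinset fun i => Finset.Icc (a i) (b i)

/-- The interior points of the hyperrectangle `×ᵢ [aᵢ : bᵢ]`. -/
def rectInterior (a b : Fin d → ℕ) : Finset (Fin d → ℕ) :=
  Fintype.piFinset fun i => Finset.Ioo (a i) (b i)

/-- The hyperrectangles `R_t = ×ᵢ [lo t i : hi t i]`, one for each `t ∈ S`, form a hyperrectangular
tessellation of `[k+1 : n₁] × ⋯ × [k+1 : n_d]`. -/
structure IsTessellation (k : ℕ) (n : Fin d → ℕ) (S : Finset (Fin d → ℕ))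
    (lo hi : (Fin d → ℕ) → Fin d → ℕ) : Prop where
  subset : ∀ t ∈ S, rect (lo t) (hi t) ⊆ box (k + 1) n
  cover : ∀ j ∈ box (k + 1) n, ∃ t ∈ S, j ∈ rect (lo t) (hi t)
  /-- Distinct hyperrectangles share at most boundary points: no interior point of one lies in
  another one. -/
  separated : ∀ t ∈ S, ∀ t' ∈ S, t ≠ t' →
    Disjoint (rectInterior (lo t) (hi t)) (rect (lo t') (hi t'))
  interior : ∀ t ∈ S, block k t ⊆ rectInterior (lo t) (hi t)

/-- `d_{i,m}^- = t_i - t_i^-`. -/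
def dMinus (lo : (Fin d → ℕ) → Fin d → ℕ) (t : Fin d → ℕ) (i : Fin d) : ℕ := t i - lo t i

/-- `d_{i,m}^+ = t_i^+ - t_i - k + 1`. -/
def dPlus (k : ℕ) (hi : (Fin d → ℕ) → Fin d → ℕ) (t : Fin d → ℕ) (i : Fin d) : ℕ :=
  hi t i + 1 - (t i + k)

/-- `d_m^z`, the product of the `d_{i,m}^{z_i}`; `true` stands for `+` and `false` for `-`. -/
def dProd (k : ℕ) (lo hi : (Fin d → ℕ) → Fin d → ℕ) (t : Fin d → ℕ) (z : Fin d → Bool) : ℝ :=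
  ∏ i, ((if z i then dPlus k hi t i else dMinus lo t i : ℕ) : ℝ)

/-- `d_{i,max}(S)`. -/
def dMax (k : ℕ) (S : Finset (Fin d → ℕ)) (lo hi : (Fin d → ℕ) → Fin d → ℕ) (i : Fin d) : ℕ :=
  S.sup fun t => max (dMinus lo t i) (dPlus k hi t i)

/-- The universal choice `λ₀(t) = σ √((2 log (2n) + 2t) / n)`. -/
def lambda0 (n : Fin d → ℕ) (σ t : ℝ) : ℝ :=
  σ * √((2 * Real.log (2 * size n) + 2 * t) / size n)

/-- The constants `a₀` for `k = 1, 2, 3, 4`. -/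
def aZero : ℕ → ℝ
  | 1 => 1
  | 2 => 8 * √2 / 7
  | 3 => 144 * √3 / 76
  | _ => 10.10

end VitaliTF

end

/-! Let h be the projection of f̂ − g onto 𝒩_k^⊥. Strong convexity of the squared norm gives a basic
inequality with an extra ‖h‖²/n on the left. What remains is the noise term 2⟨ε,h⟩/n and the penalty
difference, which is at most 4λ‖(D^k g)_{-S}‖₁ + 2λ(‖(D^k h)_S‖₁ − ‖(D^k h)_{-S}‖₁).

Noise: h = Σ_j (D^k h)_j ψ_j, where ψ_j is the projection of a product of truncated powers with knot
j (`exists_dictionary`). Moving the truncation point from j to τ changes the atom by at most a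
constant times √n Σ_i (|j_i − τ_i|/n_i)^{k−1/2}, and the moved atoms lie in a space of dimension at
most k^d that depends on τ only. With boundedly many knots τ around each point of S these spaces
span, after projection, a space V of dimension at most M·s. Put G² = Σ_i (d_{i,max}/n_i)^{2k−1}. The
residuals of the ψ_j off V have norm at most c√n G(1 − Q_j) for an interpolating vector Q ≤ 1 with Q
= 1 on S. A union bound over Gaussian functionals (`measure_noise_bad_le`) makes the residual noise
at most nλ(1 − Q_j) in each coordinate, and controls ‖P_V ε‖².

Sparsity: noise and penalty then combine to Σ_S |D^k h| − Σ_{-S} Q|D^k h|. Summation by parts bounds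
this by ‖h‖ times the ℓ²-norm of the adjoint difference of a signed version of Q. In each cell Q is
a product bump times 1 − (mean of V_i), where V_i grows like |x|^{k−1/2} (`exists_profile`,
`exists_interpolant`). Its k-th differences are of order |x|^{−1/2}, and the squares of these sum to
a logarithm: this is the logarithmic factor of the theorem.

Young's inequality spends ‖h‖²/n on both parts (`oracle_inequality_of_noise_bound`). The price of V,
of order sσ² log(2n)/n plus its analogue in t, is absorbed because s ≤ G² Σ_m Σ_z (n/d_m^z)^{2k−1}
and cGλ₀(t) ≤ λ. The mesh of the knots and the steepness of Q can be tuned to any c > 0 at the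
expense of K, so any positive lower bound on C suffices. -/

/-! ### Alternating differences on the integers -/

/-- The alternating difference `∑ l, (-1)^l (k choose l) f (y + l)`, defined by iteration. -/
def altDiff : ℕ → (ℤ → ℝ) → ℤ → ℝ
  | 0, f => f
  | k + 1, f => altDiff k fun y => f y - f (y + 1)

theorem altDiff_sub (k : ℕ) (f g : ℤ → ℝ) (y : ℤ) :
    altDiff k (fun y => f y - g y) y = altDiff k f y - altDiff k g y := by
  induction k generalizing f g with
  | zero => rfl
  | succ k ih =>
    simp only [altDiff]
    rw [← ih]
    congr 1
    funext z
    ring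

theorem altDiff_add (k : ℕ) (f g : ℤ → ℝ) (y : ℤ) :
    altDiff k (fun y => f y + g y) y = altDiff k f y + altDiff k g y := by
  induction k generalizing f g with
  | zero => rfl
  | succ k ih =>
    simp only [altDiff]
    rw [← ih]
    congr 1
    funext z
    ring

theorem altDiff_const_mul (k : ℕ) (c : ℝ) (f : ℤ → ℝ) (y : ℤ) :
    altDiff k (fun y => c * f y) y = c * altDiff k f y := by
  induction k generalizing f with
  | zero => rfl
  | succ k ih =>
    simp only [altDiff]
    rw [← ih]
    congr 1
    funext z
    ring

theorem altDiff_shift (k : ℕ) (c : ℤ) (f : ℤ → ℝ) (y : ℤ) :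
    altDiff k (fun y => f (y + c)) y = altDiff k f (y + c) := by
  induction k generalizing f with
  | zero => rfl
  | succ k ih =>
    simp only [altDiff]
    rw [← ih]
    congr 1
    funext z
    rw [add_right_comm]

theorem altDiff_succ_apply (k : ℕ) (f : ℤ → ℝ) (y : ℤ) :
    altDiff (k + 1) f y = altDiff k f y - altDiff k f (y + 1) := by
  rw [altDiff, altDiff_sub k f (fun y => f (y + 1)), altDiff_shift]

theorem altDiff_eq_sum (k : ℕ) (f : ℤ → ℝ) (y : ℤ) :
    altDiff k f y = ∑ l ∈ Finset.range (k + 1), (-1 : ℝ) ^ l * (k.choose l : ℝ) * f (y + l) := by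
  induction k generalizing y with
  | zero => simp [altDiff]
  | succ k ih =>
    rw [altDiff_succ_apply, ih, ih, Finset.sum_range_succ' _ (k + 1), Finset.sum_range_succ']
    simp only [Nat.choose_succ_succ, Nat.cast_add, pow_succ]
    rw [Finset.sum_range_succ (fun l => (-1 : ℝ) ^ l * (k.choose l : ℝ) * f (y + 1 + l)),
      Finset.sum_range_succ (fun l => (-1 : ℝ) ^ l * -1 * ((k.choose l : ℝ) + (k.choose (l + 1) : ℝ))
        * f (y + ((l : ℤ) + (1 : ℕ))))]
    simp only [Nat.choose_succ_self, Nat.choose_self, Nat.choose_zero_right]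
    have : ∀ l ∈ Finset.range k, (-1 : ℝ) ^ l * -1 * ((k.choose l : ℝ) + (k.choose (l + 1) : ℝ))
        * f (y + ((l : ℤ) + (1 : ℕ))) = (-1 : ℝ) ^ l * -1 * (k.choose (l + 1) : ℝ)
        * f (y + ((l : ℤ) + (1 : ℕ))) - (-1 : ℝ) ^ l * (k.choose l : ℝ) * f (y + 1 + l) := by
      intro l _
      have : y + ((l : ℤ) + (1 : ℕ)) = y + 1 + l := by push_cast; ring
      rw [this]; ring
    rw [Finset.sum_congr rfl this, Finset.sum_sub_distrib]
    have e : y + ((k : ℤ) + (1 : ℕ)) = y + 1 + k := by push_cast; ring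
    rw [e]
    simp only [Nat.cast_zero, Nat.cast_one]
    ring

/-- Lets an even function be treated through one of its halves: reflection only costs a sign and a
shift by k, neither of which affects a sum of squares over the integers. -/
theorem altDiff_neg (k : ℕ) (f : ℤ → ℝ) (y : ℤ) :
    altDiff k (fun y => f (-y)) y = (-1) ^ k * altDiff k f (-y - k) := by
  induction k generalizing f y with
  | zero => simp [altDiff]
  | succ k ih =>
    rw [altDiff_succ_apply, ih, ih, altDiff_succ_apply]
    have e1 : -y - ((k + 1 : ℕ) : ℤ) + 1 = -y - k := by push_cast; ring
    have e2 : -(y + 1) - (k : ℤ) = -y - ((k + 1 : ℕ) : ℤ) := by push_cast; ring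
    rw [e1, e2]; ring

theorem altDiff_eq_zero (k : ℕ) (f : ℤ → ℝ) (y : ℤ) (h : ∀ z, y ≤ z → z ≤ y + k → f z = 0) :
    altDiff k f y = 0 := by
  rw [altDiff_eq_sum]
  refine Finset.sum_eq_zero fun l hl => ?_
  rw [h _ (by omega) (by have := Finset.mem_range.1 hl; omega), mul_zero]

/-- Product bound for alternating differences. -/
theorem abs_altDiff_mul_le (k : ℕ) (G X : ℤ → ℝ) (y : ℤ) (α β θ : ℝ)
    (hG : ∀ a ≤ k, |altDiff a G y| ≤ α * θ ^ a) (hX : ∀ b ≤ k, ∀ z, |altDiff b X z| ≤ β * θ ^ b) :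
    |altDiff k (fun z => G z * X z) y| ≤ 2 ^ k * α * β * θ ^ k := by
  induction k generalizing G X α β with
  | zero =>
    have h1 := hG 0 le_rfl
    have h2 := hX 0 le_rfl y
    simp only [altDiff, pow_zero, mul_one, one_mul] at *
    rw [abs_mul]
    exact mul_le_mul h1 h2 (abs_nonneg _) ((abs_nonneg _).trans h1)
  | succ k ih =>
    -- Leibniz rule. It shifts `X` but not `G`, which is why `X` needs bounds everywhere and `G`
    -- only at `y`. Two terms per difference give the factor 2 ^ k.
    have e : (fun y => G y * X y - G (y + 1) * X (y + 1)) =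
        fun y => (fun y => G y - G (y + 1)) y * (fun y => X (y + 1)) y +
          G y * (fun y => X y - X (y + 1)) y := by
      funext y; ring
    rw [altDiff, e, altDiff_add]
    have h1 := ih (fun y => G y - G (y + 1)) (fun y => X (y + 1)) (α * θ) β
      (fun a ha => by
        have := hG (a + 1) (by omega)
        rw [altDiff] at this
        rwa [mul_assoc, ← pow_succ'])
      (fun b hb z => by
        rw [altDiff_shift]
        exact hX b (by omega) _)
    have h2 := ih G (fun y => X y - X (y + 1)) α (β * θ) (fun a ha => hG a (by omega))
      (fun b hb z => by
        have := hX (b + 1) (by omega) z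
        rw [altDiff] at this
        rwa [mul_assoc, ← pow_succ'])
    calc _ ≤ _ := abs_add_le _ _
      _ ≤ _ := add_le_add h1 h2
      _ = _ := by ring

/-- Differences of a smooth compactly supported function on a fine grid. -/
theorem exists_altDiff_bound (b : ℕ) (χ : ℝ → ℝ) (hχ : ContDiff ℝ ((⊤ : ℕ∞) : WithTop ℕ∞) χ)
    (hs : HasCompactSupport χ) :
    ∃ K, 0 ≤ K ∧ ∀ h : ℝ, 0 ≤ h → ∀ (u : ℝ) (z : ℤ),
      |altDiff b (fun x : ℤ => χ (u + x * h)) z| ≤ K * h ^ b := by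
  induction b generalizing χ with
  | zero =>
    obtain ⟨K, hK⟩ := hs.exists_bound_of_continuous hχ.continuous
    refine ⟨K, (norm_nonneg _).trans (hK 0), fun h _ u z => ?_⟩
    simpa [altDiff] using hK (u + z * h)
  | succ b ih =>
    have hd : ContDiff ℝ ((⊤ : ℕ∞) : WithTop ℕ∞) (deriv χ) := by
      rw [contDiff_infty_iff_deriv] at hχ
      exact hχ.2
    obtain ⟨K, hK0, hK⟩ := ih (deriv χ) hd hs.deriv
    refine ⟨K, hK0, fun h hh u z => ?_⟩
    have hdiff : Differentiable ℝ χ := hχ.differentiable (by simp)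
    -- The offset is the variable: the next difference is the increment of the b-th difference as
    -- the offset moves from u to u + h, so the mean value inequality and the bound for `deriv χ`
    -- apply.
    have hder : ∀ v : ℝ, HasDerivAt (fun v => altDiff b (fun x : ℤ => χ (v + x * h)) z)
        (altDiff b (fun x : ℤ => deriv χ (v + x * h)) z) v := by
      intro v
      simp only [altDiff_eq_sum]
      refine HasDerivAt.fun_sum fun l _ => HasDerivAt.const_mul _ ?_
      have := (hdiff (v + ((z + l : ℤ) : ℝ) * h)).hasDerivAt.comp_add_const v (((z + l : ℤ) : ℝ) * h)
      exact this
    have := Convex.norm_image_sub_le_of_norm_hasDerivWithin_le (C := K * h ^ b)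
      (fun v _ => (hder v).hasDerivWithinAt) (fun v _ => by simpa using hK h hh v z) convex_univ
      (Set.mem_univ (u + h)) (Set.mem_univ u)
    rw [altDiff_succ_apply]
    have e : altDiff b (fun x : ℤ => χ (u + x * h)) (z + 1) =
        altDiff b (fun x : ℤ => χ (u + h + x * h)) z := by
      rw [← altDiff_shift]
      congr 1
      funext x
      push_cast
      ring_nf
    rw [e]
    calc _ ≤ _ := by simpa using this
      _ = _ := by rw [abs_of_nonneg hh]; ring

/-! ### Iterated partial sums of 1 / √y: a discrete y ^ (k - 1 / 2) -/

/-- Partial sums of a sequence over the positive integers up to `y`. -/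
noncomputable def psum (f : ℤ → ℝ) (y : ℤ) : ℝ := ∑ z ∈ Finset.Icc 1 y, f z

theorem psum_of_nonpos (f : ℤ → ℝ) {y : ℤ} (hy : y ≤ 0) : psum f y = 0 := by
  rw [psum, Finset.Icc_eq_empty (by omega), Finset.sum_empty]

theorem psum_succ (f : ℤ → ℝ) {y : ℤ} (hy : 0 ≤ y) : psum f (y + 1) = psum f y + f (y + 1) := by
  have : Finset.Icc 1 (y + 1) = insert (y + 1) (Finset.Icc 1 y) := by
    ext z; simp only [Finset.mem_Icc, Finset.mem_insert]; omega
  rw [psum, this, Finset.sum_insert (by simp), add_comm, psum]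

theorem psum_sub (f : ℤ → ℝ) (hf : ∀ y ≤ 0, f y = 0) (y : ℤ) :
    psum f y - psum f (y - 1) = f y := by
  rcases le_or_gt y 0 with h | h
  · rw [psum_of_nonpos f h, psum_of_nonpos f (by omega), hf y h, sub_zero]
  · have := psum_succ f (y := y - 1) (by omega)
    rw [sub_add_cancel] at this
    rw [this]; ring

/-- The sequence `1 / √y` on the positive integers. -/
noncomputable def rsqrt (y : ℤ) : ℝ := if 1 ≤ y then 1 / √(y : ℝ) else 0

theorem iterate_psum_of_nonpos (r : ℕ) {y : ℤ} (hy : y ≤ 0) : psum^[r] rsqrt y = 0 := by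
  cases r with
  | zero => simp [rsqrt, show ¬ 1 ≤ y by omega]
  | succ r => rw [Function.iterate_succ_apply']; exact psum_of_nonpos _ hy

theorem iterate_psum_nonneg (r : ℕ) (y : ℤ) : 0 ≤ psum^[r] rsqrt y := by
  induction r generalizing y with
  | zero => simp only [Function.iterate_zero, id, rsqrt]; split_ifs <;> positivity
  | succ r ih =>
    rw [Function.iterate_succ_apply']
    exact Finset.sum_nonneg fun z _ => ih z

theorem iterate_psum_mono (r : ℕ) {y z : ℤ} (h : y ≤ z) :
    psum^[r + 1] rsqrt y ≤ psum^[r + 1] rsqrt z := by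
  rw [Function.iterate_succ_apply']
  exact Finset.sum_le_sum_of_subset_of_nonneg (Finset.Icc_subset_Icc_right h)
    fun w _ _ => iterate_psum_nonneg r w

/-- The first summation telescopes through 1/√(y+1) ≤ 2(√(y+1) − √y). Each later one is at most y
times its last term, by monotonicity, so the constant stays 2. -/
theorem iterate_psum_le (r : ℕ) {y : ℤ} (hy : 1 ≤ y) :
    psum^[r] rsqrt y ≤ 2 * ((y : ℝ) ^ r / √(y : ℝ)) := by
  induction r generalizing y with
  | zero =>
    simp only [Function.iterate_zero, id, rsqrt, if_pos hy, pow_zero]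
    have : 0 ≤ 1 / √(y : ℝ) := by positivity
    linarith
  | succ r ih =>
    have hy' : (1 : ℝ) ≤ y := by exact_mod_cast hy
    rcases r.eq_zero_or_pos with rfl | hr
    · clear ih
      have e : ∀ y : ℤ, 0 ≤ y → psum rsqrt y ≤ 2 * √(y : ℝ) := by
        intro y hy
        induction y, hy using Int.leInduction with
        | base => simp [psum]
        | succ y hy ih =>
          rw [psum_succ _ hy]
          have h0 : (0 : ℝ) ≤ y := by exact_mod_cast hy
          simp only [rsqrt, if_pos (show 1 ≤ y + 1 by omega)]
          push_cast
          set a := √(y : ℝ)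
          set b := √((y : ℝ) + 1)
          have ha : a ^ 2 = y := Real.sq_sqrt h0
          have hb : b ^ 2 = y + 1 := Real.sq_sqrt (by linarith)
          have ha0 : 0 ≤ a := Real.sqrt_nonneg _
          have hb0 : 0 < b := Real.sqrt_pos.2 (by linarith)
          have : 1 / b ≤ 2 * (b - a) := by
            rw [div_le_iff₀ hb0]
            nlinarith [sq_nonneg (b - a)]
          linarith
      have := e y (by omega)
      simpa using this
    · rw [Function.iterate_succ_apply', psum]
      have hb : ∀ z ∈ Finset.Icc 1 y, psum^[r] rsqrt z ≤ 2 * ((y : ℝ) ^ r / √(y : ℝ)) := by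
        intro z hz
        obtain ⟨s, rfl⟩ := Nat.exists_eq_succ_of_ne_zero hr.ne'
        exact (iterate_psum_mono s (Finset.mem_Icc.1 hz).2).trans (ih hy)
      refine (Finset.sum_le_card_nsmul _ _ _ hb).trans (le_of_eq ?_)
      have hc : ((Finset.Icc 1 y).card : ℝ) = y := by
        rw [Int.card_Icc]
        have : (((y + 1 - 1).toNat : ℤ) : ℝ) = (y : ℝ) := by
          rw [Int.toNat_of_nonneg (by omega)]; push_cast; ring
        exact_mod_cast this
      rw [nsmul_eq_mul, hc]
      ring

/-- Up to y the summands 1/√z are at least the constant 1/√y, whose r-fold sums at z are at least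
z^r / (r! √y). The induction needs y frozen under the root while z varies; Bernoulli's inequality
bounds the increments of z ^ (r + 2). -/
theorem le_iterate_psum (r : ℕ) {y : ℤ} (hy : 1 ≤ y) :
    (y : ℝ) ^ r / √(y : ℝ) ≤ r.factorial * psum^[r] rsqrt y := by
  have key : ∀ r : ℕ, ∀ z : ℤ, 0 ≤ z → z ≤ y →
      (z : ℝ) ^ (r + 1) / √(y : ℝ) ≤ (r + 1).factorial * psum^[r + 1] rsqrt z := by
    intro r
    have hy' : (0 : ℝ) < √(y : ℝ) := Real.sqrt_pos.2 (by exact_mod_cast hy)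
    induction r with
    | zero =>
      intro z hz
      induction z, hz using Int.leInduction with
      | base => intro; simp [psum]
      | succ z hz ih =>
        intro hzy
        have := ih (by omega)
        simp only [zero_add, Function.iterate_one] at this ⊢
        rw [psum_succ _ hz]
        simp only [rsqrt, if_pos (show 1 ≤ z + 1 by omega)]
        have h1 : 1 / √(y : ℝ) ≤ 1 / √((z + 1 : ℤ) : ℝ) := by
          apply one_div_le_one_div_of_le
          · exact Real.sqrt_pos.2 (by exact_mod_cast (by omega : 0 < z + 1))
          · exact Real.sqrt_le_sqrt (by exact_mod_cast hzy)
        simp only [Nat.factorial, pow_one] at *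
        push_cast at *
        rw [add_div]
        linarith
    | succ r ihr =>
      intro z hz
      induction z, hz using Int.leInduction with
      | base =>
        intro
        have := iterate_psum_of_nonpos (r + 1 + 1) (le_refl 0)
        rw [this]
        simp
      | succ z hz ih =>
        intro hzy
        have h1 := ih (by omega)
        have h2 := ihr (z + 1) (by omega) hzy
        rw [Function.iterate_succ_apply'] at h1 ⊢
        rw [psum_succ _ hz]
        have hz' : (0 : ℝ) ≤ z := by exact_mod_cast hz
        have h3 : ((z : ℝ) + 1) ^ (r + 2) - (z : ℝ) ^ (r + 2) ≤ (r + 2) * ((z : ℝ) + 1) ^ (r + 1) := by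
          have := one_add_mul_le_pow (a := (-1 : ℝ) / (z + 1)) (by
            rw [le_div_iff₀ (by positivity)]; linarith) (r + 2)
          have e : 1 + (-1 : ℝ) / (z + 1) = z / (z + 1) := by field_simp; ring
          rw [e, div_pow, le_div_iff₀ (by positivity)] at this
          have e2 : (1 + ((r + 2 : ℕ) : ℝ) * (-1 / ((z : ℝ) + 1))) * (z + 1) ^ (r + 2) =
              (z + 1) ^ (r + 2) - (r + 2) * (z + 1) ^ (r + 1) := by
            push_cast; field_simp; ring
          rw [e2] at this
          linarith
        rw [Nat.factorial_succ (r + 1)] at *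
        push_cast at *
        have h4 : (((z : ℝ) + 1) ^ (r + 2) - (z : ℝ) ^ (r + 2)) / √(y : ℝ) ≤
            (r + 2) * (((z : ℝ) + 1) ^ (r + 1) / √(y : ℝ)) := by
          rw [← mul_div_assoc]
          exact div_le_div_of_nonneg_right h3 hy'.le
        have h5 : (r + 2) * (((z : ℝ) + 1) ^ (r + 1) / √(y : ℝ)) ≤
            (r + 2) * ((r + 1).factorial * psum^[r + 1] rsqrt (z + 1)) := by
          gcongr
        rw [sub_div] at h4
        have e3 : r + 1 + 1 = r + 2 := rfl
        rw [e3] at *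
        nlinarith
  cases r with
  | zero => simp [rsqrt, hy]
  | succ r => exact key r y (by omega) le_rfl

theorem pow_div_sqrt {y : ℝ} (hy : 0 < y) {k : ℕ} (hk : 1 ≤ k) :
    y ^ k / √y = √(y ^ (2 * k - 1)) := by
  have h1 : y ^ (2 * k - 1) = (y ^ k) ^ 2 / y := by
    rw [eq_div_iff hy.ne', ← pow_succ, ← pow_mul]
    congr 1; omega
  rw [h1, Real.sqrt_div (by positivity), Real.sqrt_sq (by positivity)]

/-- The squares of `rsqrt` form this harmonic sum; it is the source of the logarithm in the final
bound. -/
theorem sum_inv_le (y : ℤ) (hy : 1 ≤ y) :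
    ∑ z ∈ Finset.Icc 1 y, 1 / (z : ℝ) ≤ 1 + Real.log y := by
  change psum (fun z => 1 / (z : ℝ)) y ≤ _
  induction y, hy using Int.leInduction with
  | base => simp [psum]
  | succ y hy ih =>
    rw [psum_succ _ (by omega)]
    have h0 : (0 : ℝ) < y := by exact_mod_cast (by omega : 0 < y)
    have := Real.one_sub_inv_le_log_of_pos (x := ((y : ℝ) + 1) / y) (by positivity)
    rw [Real.log_div (by positivity) h0.ne'] at this
    have e : 1 - (((y : ℝ) + 1) / y)⁻¹ = 1 / ((y + 1 : ℤ) : ℝ) := by push_cast; field_simp; ring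
    rw [e] at this
    push_cast at *
    linarith

theorem sum_comp_le_sum {α β : Type*} (s : Finset α) (t : Finset β) (φ : α → β)
    (hφ : Function.Injective φ) (g : β → ℝ) (hg : ∀ b, 0 ≤ g b) (ht : ∀ b, b ∉ t → g b = 0) :
    ∑ a ∈ s, g (φ a) ≤ ∑ b ∈ t, g b := by
  have := Finset.sum_map s ⟨φ, hφ⟩ g
  simp only [Function.Embedding.coeFn_mk] at this
  rw [← this, ← Finset.sum_filter_ne_zero]
  refine Finset.sum_le_sum_of_subset_of_nonneg (fun b hb => ?_) fun b _ _ => hg b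
  by_contra h
  exact (Finset.mem_filter.1 hb).2 (ht b h)

/-- Each difference undoes one summation. The reflection is needed because `altDiff` subtracts the
value at y + 1, while `psum` accumulates from the left. -/
theorem altDiff_iterate_psum_neg (k a : ℕ) (ha : a ≤ k) (y : ℤ) :
    altDiff a (fun z => psum^[k] rsqrt (-z)) y = psum^[k - a] rsqrt (-y) := by
  induction a generalizing k with
  | zero => rfl
  | succ a ih =>
    obtain ⟨m, rfl⟩ : ∃ m, k = m + 1 := ⟨k - 1, by omega⟩
    rw [altDiff]
    have e : (fun z => psum^[m + 1] rsqrt (-z) - psum^[m + 1] rsqrt (-(z + 1))) =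
        fun z => psum^[m] rsqrt (-z) := by
      funext z
      rw [Function.iterate_succ_apply', neg_add']
      exact psum_sub _ (fun y hy => iterate_psum_of_nonpos m hy) (-z)
    rw [e, ih m (by omega), Nat.add_sub_add_right]

/-! ### One-dimensional profiles -/

/-- A symmetric discrete bump supported on `|x| < e`. -/
theorem exists_discrete_bump (k : ℕ) : ∃ β : ℝ, 0 ≤ β ∧ ∀ e : ℕ, 1 ≤ e → ∃ X : ℤ → ℝ,
    X 0 = 1 ∧ (∀ x, 0 ≤ X x ∧ X x ≤ 1) ∧ (∀ x, (e : ℤ) ≤ |x| → X x = 0) ∧ (∀ x, X (-x) = X x) ∧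
    ∀ b ≤ k, ∀ z, |altDiff b X z| ≤ β * (1 / (e : ℝ)) ^ b := by
  let χ : ContDiffBump (0 : ℝ) := ⟨1 / 2, 1, by norm_num, by norm_num⟩
  have hsm : ContDiff ℝ ((⊤ : ℕ∞) : WithTop ℕ∞) χ := χ.contDiff
  choose K hK0 hK using fun b => exists_altDiff_bound b χ hsm χ.hasCompactSupport
  refine ⟨∑ b ∈ Finset.range (k + 1), K b, Finset.sum_nonneg fun b _ => hK0 b, fun e he => ?_⟩
  have he' : (0 : ℝ) < e := by exact_mod_cast he
  refine ⟨fun x => χ (x * (1 / (e : ℝ))), ?_, fun x => ⟨χ.nonneg, χ.le_one⟩, ?_, ?_, ?_⟩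
  · apply χ.one_of_mem_closedBall
    simp [χ]
  · intro x hx
    apply χ.zero_of_le_dist
    have : (e : ℝ) ≤ |(x : ℝ)| := by exact_mod_cast hx
    simp only [χ, dist_zero_right, Real.norm_eq_abs, abs_mul]
    rw [abs_of_pos (by positivity : 0 < 1 / (e : ℝ)), mul_one_div, le_div_iff₀ he', one_mul]
    exact this
  · intro x
    simp only [Int.cast_neg, neg_mul]
    exact χ.neg _
  · intro b hb z
    have := hK b (1 / (e : ℝ)) (by positivity) 0 z
    simp only [zero_add] at this
    refine this.trans ?_
    gcongr
    exact Finset.single_le_sum (f := K) (fun b _ => hK0 b) (Finset.mem_range.2 (by omega))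

/-- The one-dimensional building blocks of the interpolating vector: a bump `X` supported on
`|x| < e` and a function `V` that dominates `(|x| / e) ^ (k - 1 / 2)`, with small energies. -/
theorem exists_profile (k : ℕ) (hk : 1 ≤ k) : ∃ c K : ℝ, 0 < c ∧ 0 ≤ K ∧
    ∀ e : ℕ, 1 ≤ e → ∃ X V : ℤ → ℝ,
      X 0 = 1 ∧ V 0 = 0 ∧ (∀ x, 0 ≤ X x ∧ X x ≤ 1) ∧ (∀ x, (e : ℤ) ≤ |x| → X x = 0) ∧
      (∀ x : ℤ, |x| < e → 0 ≤ V x ∧ V x ≤ 1 ∧ c * √((|(x : ℝ)| / e) ^ (2 * k - 1)) ≤ V x) ∧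
      (∀ s : Finset ℤ, ∑ x ∈ s, altDiff k X x ^ 2 ≤ K * (1 / (e : ℝ)) ^ (2 * k - 1)) ∧
      (∀ s : Finset ℤ, ∑ x ∈ s, altDiff k (fun x => X x * V x) x ^ 2 ≤
        K * Real.log (Real.exp 1 * e) * (1 / (e : ℝ)) ^ (2 * k - 1)) := by
  obtain ⟨β, hβ0, hβ⟩ := exists_discrete_bump k
  set κ : ℝ := 2 ^ k * (k + 1) ^ k * β with hκ
  refine ⟨1 / (2 * k.factorial), max ((k + 3) * β ^ 2) (4 * κ ^ 2 * (1 + Real.log (k + 1))),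
    by positivity, le_max_of_le_left (by positivity), fun e he => ?_⟩
  obtain ⟨X, hX0, hX1, hXs, hXn, hXd⟩ := hβ e he
  have he' : (1 : ℝ) ≤ e := by exact_mod_cast he
  have he0 : (0 : ℝ) < e := by linarith
  have hse : (0 : ℝ) < √(e : ℝ) := Real.sqrt_pos.2 he0
  -- Normalised by the upper bound 2 y^k/√y for `W`, so that `c * W |x|` is at most (|x|/e)^(k−1/2),
  -- hence at most 1 on the support of `X`.
  set c : ℝ := √(e : ℝ) / (2 * (e : ℝ) ^ k) with hc
  have hc0 : 0 < c := by positivity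
  set W : ℤ → ℝ := psum^[k] rsqrt with hW
  have hW0 : ∀ y ≤ 0, W y = 0 := fun y hy => iterate_psum_of_nonpos k hy
  have habs : ∀ x : ℤ, W |x| = W (-x) + W x := by
    intro x
    rcases le_total 0 x with h | h
    · rw [abs_of_nonneg h, hW0 (-x) (by omega), zero_add]
    · rw [abs_of_nonpos h, hW0 x h, add_zero]
  have hhalf : ∀ x : ℤ, x ≠ 0 → √((|(x : ℝ)| / e) ^ (2 * k - 1)) =
      (|(x : ℝ)| ^ k / √|(x : ℝ)|) * (√(e : ℝ) / (e : ℝ) ^ k) := by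
    intro x hx
    have : 0 < |(x : ℝ)| := abs_pos.2 (by exact_mod_cast hx)
    rw [← pow_div_sqrt (by positivity) hk, Real.sqrt_div (abs_nonneg _), div_pow]
    field_simp
  refine ⟨X, fun x => c * W |x|, hX0, by simp [hW0], hX1, hXs, fun x hx => ?_, fun s => ?_,
    fun s => ?_⟩
  · refine ⟨mul_nonneg hc0.le (iterate_psum_nonneg _ _), ?_⟩
    rcases eq_or_ne x 0 with rfl | hx0
    · have : 2 * k - 1 ≠ 0 := by omega
      simp [hW0, this]
    have hx1 : 1 ≤ |x| := Int.one_le_abs hx0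
    have hxr : 0 < |(x : ℝ)| := abs_pos.2 (by exact_mod_cast hx0)
    have h1 := iterate_psum_le k hx1
    have h2 := le_iterate_psum k hx1
    rw [Int.cast_abs] at h1 h2
    constructor
    · calc c * W |x| ≤ c * (2 * (|(x : ℝ)| ^ k / √|(x : ℝ)|)) := by gcongr
        _ = √((|(x : ℝ)| / e) ^ (2 * k - 1)) := by rw [hhalf x hx0, hc]; field_simp
        _ ≤ 1 := by
          apply Real.sqrt_le_iff.2
          rw [one_pow]
          refine ⟨zero_le_one, ?_⟩
          apply pow_le_one₀ (by positivity)
          rw [div_le_one he0]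
          exact_mod_cast hx.le
    · rw [hhalf x hx0]
      calc _ ≤ 1 / (2 * k.factorial) * ((k.factorial * W |x|) * (√(e : ℝ) / (e : ℝ) ^ k)) := by
            gcongr
        _ = c * W |x| := by rw [hc]; field_simp
  -- About 2e + k + 1 points carry a nonzero difference, each of square at most β² e^(−2k): the
  -- total is of order e^(−(2k−1)).
  · have hb : ∀ x, altDiff k X x ^ 2 ≤
        if x ∈ Finset.Icc (-(e : ℤ) - k) e then (β * (1 / (e : ℝ)) ^ k) ^ 2 else 0 := by
      intro x
      split_ifs with h
      · rw [← sq_abs]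
        exact pow_le_pow_left₀ (abs_nonneg _) (hXd k le_rfl x) 2
      · rw [altDiff_eq_zero, zero_pow two_ne_zero]
        intro z h1 h2
        apply hXs
        rw [Finset.mem_Icc, not_and_or] at h
        rw [le_abs]
        omega
    refine (Finset.sum_le_sum fun x _ => hb x).trans ?_
    refine (sum_comp_le_sum s (Finset.Icc (-(e : ℤ) - k) e) id Function.injective_id
      (fun x => if x ∈ Finset.Icc (-(e : ℤ) - k) e then (β * (1 / (e : ℝ)) ^ k) ^ 2 else 0)
      (fun b => by split_ifs <;> positivity) (fun b hb => if_neg hb)).trans ?_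
    rw [Finset.sum_ite_mem, Finset.inter_self, Finset.sum_const, nsmul_eq_mul]
    have hcard : ((Finset.Icc (-(e : ℤ) - k) e).card : ℝ) = 2 * e + k + 1 := by
      rw [Int.card_Icc]
      have : ((e : ℤ) + 1 - (-(e : ℤ) - k)).toNat = 2 * e + k + 1 := by omega
      rw [this]; push_cast; ring
    have hpow : ((1 / (e : ℝ)) ^ k) ^ 2 = (1 / (e : ℝ)) ^ (2 * k - 1) * (1 / e) := by
      rw [← pow_mul, ← pow_succ]
      congr 1
      omega
    rw [hcard, mul_pow, hpow]
    calc (2 * (e : ℝ) + k + 1) * (β ^ 2 * ((1 / (e : ℝ)) ^ (2 * k - 1) * (1 / e)))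
        = ((2 * (e : ℝ) + k + 1) / e) * β ^ 2 * (1 / (e : ℝ)) ^ (2 * k - 1) := by ring
      _ ≤ (k + 3) * β ^ 2 * (1 / (e : ℝ)) ^ (2 * k - 1) := by
        gcongr
        rw [div_le_iff₀ he0]
        nlinarith [(Nat.cast_nonneg k : (0 : ℝ) ≤ k)]
      _ ≤ _ := by gcongr; exact le_max_left _ _
  -- Since `W` vanishes on nonpositive integers and `X` is even, the product X(x) W|x| is H(x) +
  -- H(−x), and only the half `H` is estimated. The window `T` exceeds the support by k, the reach
  -- of the difference.
  · set H : ℤ → ℝ := fun x => W (-x) * X x with hH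
    set T : Finset ℤ := Finset.Icc 1 ((e : ℤ) + k) with hT
    set g : ℤ → ℝ := fun y => if y ∈ T then (κ * 2) ^ 2 * (1 / (y : ℝ)) else 0 with hg
    have hg0 : ∀ y, 0 ≤ g y := by
      intro y
      simp only [hg]
      split_ifs with h
      · have : (0 : ℝ) ≤ y := by exact_mod_cast (by have := (Finset.mem_Icc.1 h).1; omega : 0 ≤ y)
        positivity
      · exact le_rfl
    have hHb : ∀ y, altDiff k H y ^ 2 ≤ g (-y) := by
      intro y
      by_cases h : -y ∈ T
      · simp only [hg, if_pos h]
        rw [hT, Finset.mem_Icc] at h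
        have hy0 : (1 : ℝ) ≤ ((-y : ℤ) : ℝ) := by exact_mod_cast h.1
        have hye : ((-y : ℤ) : ℝ) ≤ (k + 1) * e := by
          have : ((-y : ℤ) : ℝ) ≤ (e : ℝ) + k := by exact_mod_cast h.2
          nlinarith [(Nat.cast_nonneg k : (0 : ℝ) ≤ k)]
        have hsy : 0 < √((-y : ℤ) : ℝ) := Real.sqrt_pos.2 (by linarith)
        -- The a-th difference of W(−·) at y has order |y|^(k−a−1/2). As |y| ≤ (k+1)e, this is of
        -- the form α e^(−a) with α of order e^k/√|y|, and the product rule leaves O(1/√|y|).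
        have := abs_altDiff_mul_le k (fun z => W (-z)) X y
          (2 * ((k + 1) ^ k * (e : ℝ) ^ k) / √((-y : ℤ) : ℝ)) β (1 / e) (fun a ha => by
            rw [altDiff_iterate_psum_neg k a ha, abs_of_nonneg (iterate_psum_nonneg _ _)]
            refine (iterate_psum_le _ h.1).trans ?_
            calc 2 * (((-y : ℤ) : ℝ) ^ (k - a) / √((-y : ℤ) : ℝ))
                ≤ 2 * (((k + 1) ^ k * (e : ℝ) ^ (k - a)) / √((-y : ℤ) : ℝ)) := by
                  gcongr
                  calc ((-y : ℤ) : ℝ) ^ (k - a) ≤ ((k + 1) * e) ^ (k - a) := by gcongr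
                    _ = (k + 1) ^ (k - a) * (e : ℝ) ^ (k - a) := mul_pow _ _ _
                    _ ≤ _ := by
                      gcongr
                      · linarith [(Nat.cast_nonneg k : (0 : ℝ) ≤ k)]
                      · omega
              _ = _ := by
                have : (e : ℝ) ^ (k - a) = (e : ℝ) ^ k * (1 / e) ^ a := by
                  rw [one_div, inv_pow, ← pow_sub₀ _ he0.ne' ha]
                rw [this]; ring) hXd
        have hbd : |altDiff k H y| ≤ κ * 2 / √((-y : ℤ) : ℝ) := by
          refine this.trans (le_of_eq ?_)
          rw [hκ, one_div, inv_pow]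
          field_simp
        rw [← sq_abs]
        calc _ ≤ (κ * 2 / √((-y : ℤ) : ℝ)) ^ 2 := pow_le_pow_left₀ (abs_nonneg _) hbd 2
          _ = _ := by rw [div_pow, Real.sq_sqrt (by linarith)]; ring
      · simp only [hg, if_neg h]
        rw [altDiff_eq_zero, zero_pow two_ne_zero]
        intro z h1 h2
        simp only [hH]
        rcases le_or_gt 0 z with hz | hz
        · rw [hW0 _ (by omega), zero_mul]
        · rw [hXs, mul_zero]
          rw [hT, Finset.mem_Icc, not_and_or] at h
          rw [le_abs]
          omega
    have hsplit : ∀ x, altDiff k (fun x => X x * (c * W |x|)) x =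
        c * (altDiff k H x + (-1) ^ k * altDiff k H (-x - k)) := by
      intro x
      rw [← altDiff_neg, ← altDiff_add, ← altDiff_const_mul]
      congr 1
      funext z
      simp only [hH, habs, hXn, neg_neg]
      ring
    have hsum : ∑ y ∈ T, g y ≤ (κ * 2) ^ 2 * ((1 + Real.log (k + 1)) * Real.log (Real.exp 1 * e)) := by
      have : ∑ y ∈ T, g y = (κ * 2) ^ 2 * ∑ y ∈ T, 1 / (y : ℝ) := by
        rw [Finset.mul_sum]
        exact Finset.sum_congr rfl fun y hy => if_pos hy
      rw [this]
      gcongr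
      refine (sum_inv_le _ (by omega)).trans ?_
      have h1 : Real.log (((e : ℤ) + (k : ℤ) : ℤ) : ℝ) ≤ Real.log (k + 1) + Real.log e := by
        rw [← Real.log_mul (by positivity) (by positivity)]
        apply Real.log_le_log
        · push_cast; positivity
        · push_cast; nlinarith [(Nat.cast_nonneg k : (0 : ℝ) ≤ k)]
      rw [Real.log_mul (Real.exp_pos 1).ne' he0.ne', Real.log_exp]
      have h2 : 0 ≤ Real.log (k + 1) := Real.log_nonneg (by linarith [(Nat.cast_nonneg k : (0 : ℝ) ≤ k)])
      have h3 : 0 ≤ Real.log (e : ℝ) := Real.log_nonneg he'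
      nlinarith [mul_nonneg h2 h3]
    have hc2 : c ^ 2 = (1 / (e : ℝ)) ^ (2 * k - 1) / 4 := by
      have hpow : (e : ℝ) ^ (2 * k - 1) * e = ((e : ℝ) ^ k) ^ 2 := by
        rw [← pow_mul, ← pow_succ]
        congr 1
        omega
      rw [hc, div_pow, Real.sq_sqrt he0.le, one_div, inv_pow, mul_pow, ← hpow]
      field_simp
      norm_num
    calc ∑ x ∈ s, altDiff k (fun x => X x * (c * W |x|)) x ^ 2
        ≤ ∑ x ∈ s, c ^ 2 * (2 * g (-x) + 2 * g (x + k)) := by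
          refine Finset.sum_le_sum fun x _ => ?_
          rw [hsplit, mul_pow]
          have h1 := hHb x
          have h2 := hHb (-x - k)
          have h3 : ((-1 : ℝ) ^ k * altDiff k H (-x - k)) ^ 2 = altDiff k H (-x - k) ^ 2 := by
            rw [mul_pow, ← pow_mul, mul_comm k 2, pow_mul]; norm_num
          have e1 : -(-x - (k : ℤ)) = x + k := by ring
          rw [e1, ← h3] at h2
          gcongr
          nlinarith [sq_nonneg (altDiff k H x - (-1 : ℝ) ^ k * altDiff k H (-x - k))]
      _ = c ^ 2 * (2 * ∑ x ∈ s, g (-x) + 2 * ∑ x ∈ s, g (x + k)) := by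
          rw [← Finset.mul_sum, Finset.sum_add_distrib, ← Finset.mul_sum, ← Finset.mul_sum]
      _ ≤ c ^ 2 * (2 * ∑ y ∈ T, g y + 2 * ∑ y ∈ T, g y) := by
          gcongr
          · exact sum_comp_le_sum s T (fun x => -x) neg_injective g hg0 fun b hb => if_neg hb
          · exact sum_comp_le_sum s T (fun x => x + k) (add_left_injective _) g hg0
              fun b hb => if_neg hb
      _ ≤ c ^ 2 * (4 * ((κ * 2) ^ 2 * ((1 + Real.log (k + 1)) * Real.log (Real.exp 1 * e)))) := by
          gcongr
          linarith
      _ = (4 * κ ^ 2 * (1 + Real.log (k + 1))) * Real.log (Real.exp 1 * e) *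
          (1 / (e : ℝ)) ^ (2 * k - 1) := by rw [hc2]; ring
      _ ≤ _ := by
          have : 0 ≤ Real.log (Real.exp 1 * e) := by
            rw [Real.log_mul (Real.exp_pos 1).ne' he0.ne', Real.log_exp]
            linarith [Real.log_nonneg he']
          gcongr
          exact le_max_right _ _

/-! ### Truncated powers -/

/-- The polynomial `(z + 1) ⋯ (z + m) / m!`. -/
noncomputable def risingPoly (m : ℕ) (z : ℝ) : ℝ := (ascPochhammer ℝ m).eval (z + 1) / m.factorial

theorem risingPoly_sub (m : ℕ) (z : ℝ) :
    risingPoly (m + 1) z - risingPoly (m + 1) (z - 1) = risingPoly m z := by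
  have h1 : (ascPochhammer ℝ (m + 1)).eval (z + 1) = (ascPochhammer ℝ m).eval (z + 1) * (z + 1 + m) :=
    ascPochhammer_succ_eval m (z + 1)
  have h2 : (ascPochhammer ℝ (m + 1)).eval (z - 1 + 1) = z * (ascPochhammer ℝ m).eval (z + 1) := by
    rw [ascPochhammer_succ_left]
    simp
  have h3 : ((m.factorial : ℕ) : ℝ) ≠ 0 := by positivity
  simp only [risingPoly, h1, h2, Nat.factorial_succ]
  push_cast
  field_simp
  ring

theorem abs_risingPoly_le (m : ℕ) (z N : ℝ) (hN : 1 ≤ N) (hz : |z| ≤ N) :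
    |risingPoly m z| ≤ ((m + 1) * N) ^ m := by
  have h : ∀ r : ℕ, r ≤ m → |(ascPochhammer ℝ r).eval (z + 1)| ≤ ((m + 1) * N) ^ r := by
    intro r
    induction r with
    | zero => simp
    | succ r ih =>
      intro hr
      rw [ascPochhammer_succ_eval, abs_mul, pow_succ]
      have hr' : ((r : ℝ) + 1) ≤ m := by exact_mod_cast hr
      have : |z + 1 + r| ≤ (m + 1) * N := by
        rw [abs_le] at *
        constructor <;> nlinarith [(Nat.cast_nonneg r : (0 : ℝ) ≤ r)]
      exact mul_le_mul (ih (by omega)) this (abs_nonneg _) (by positivity)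
  have hf : (1 : ℝ) ≤ m.factorial := by exact_mod_cast Nat.one_le_iff_ne_zero.2 m.factorial_ne_zero
  rw [risingPoly, abs_div, abs_of_pos (by linarith : (0 : ℝ) < m.factorial)]
  exact (div_le_self (abs_nonneg _) hf).trans (h m le_rfl)

theorem risingPoly_zero (m : ℕ) : risingPoly m 0 = 1 := by
  rw [risingPoly, zero_add, ascPochhammer_eval_one, div_self (by positivity)]

/-- As a function of `y`, `risingPoly m (y - j)` is a polynomial of degree at most `m`. -/
theorem risingPoly_eq_sum (m : ℕ) (j : ℝ) : ∃ c : ℕ → ℝ, ∀ y : ℝ,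
    risingPoly m (y - j) = ∑ l ∈ Finset.range (m + 1), c l * y ^ l := by
  set p : Polynomial ℝ := Polynomial.C (1 / (m.factorial : ℝ)) *
    (ascPochhammer ℝ m).comp (Polynomial.X + Polynomial.C (1 - j)) with hp
  refine ⟨p.coeff, fun y => ?_⟩
  have hdeg : p.natDegree < m + 1 := by
    refine Nat.lt_succ_of_le ((Polynomial.natDegree_C_mul_le _ _).trans ?_)
    rw [Polynomial.natDegree_comp, Polynomial.natDegree_X_add_C, ascPochhammer_natDegree, mul_one]
  rw [← Polynomial.eval_eq_sum_range' hdeg, hp]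
  simp only [Polynomial.eval_mul, Polynomial.eval_C, Polynomial.eval_comp, Polynomial.eval_add,
    Polynomial.eval_X, risingPoly]
  rw [show y + (1 - j) = y - j + 1 by ring]
  ring

/-- The truncated power sequence. -/
noncomputable def truncPow (m : ℕ) (z : ℤ) : ℝ := if 0 ≤ z then risingPoly m z else 0

/-- Truncation does not spoil the recursion of the polynomials: the only delicate point is z = 0,
where both sides equal 1 because `risingPoly` takes the value 1 at 0 in every degree. -/
theorem truncPow_sub (m : ℕ) (z : ℤ) :
    truncPow (m + 1) z - truncPow (m + 1) (z - 1) = truncPow m z := by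
  have h := risingPoly_sub m z
  simp only [truncPow]
  push_cast
  rcases lt_trichotomy z 0 with hz | rfl | hz
  · rw [if_neg (by omega), if_neg (by omega), if_neg (by omega), sub_zero]
  · simp [risingPoly_zero]
  · rw [if_pos hz.le, if_pos (by omega), if_pos hz.le, h]

/-- Differences lower the degree down to the step function, whose difference is a unit mass:
truncated powers are Green's functions of the difference operator. -/
theorem altDiff_truncPow (m : ℕ) (y : ℤ) :
    altDiff (m + 1) (fun z => truncPow m (-z)) y = if y = 0 then 1 else 0 := by
  induction m generalizing y with
  | zero =>
    simp only [altDiff, truncPow, risingPoly, ascPochhammer_zero, Polynomial.eval_one,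
      Nat.factorial_zero, Nat.cast_one, div_one]
    rcases lt_trichotomy y 0 with hy | rfl | hy
    · rw [if_pos (by omega), if_pos (by omega), if_neg (by omega), sub_self]
    · simp
    · rw [if_neg (by omega), if_neg (by omega), if_neg (by omega), sub_self]
  | succ m ih =>
    rw [altDiff, ← ih]
    congr 1
    funext z
    rw [neg_add', truncPow_sub]

/-! ### Product tensors and the dictionary of atoms -/

namespace VitaliTF

variable {d : ℕ}

/-- The product tensor `a₁ ⊗ ⋯ ⊗ a_d`. -/
noncomputable def prodTensor (n : Fin d → ℕ) (a : Fin d → ℕ → ℝ) : Tensor n :=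
  WithLp.toLp 2 fun j => ∏ i, a i ((j : Fin d → ℕ) i)

theorem sum_box_prod (n : Fin d → ℕ) (r : ℕ) (a : Fin d → ℕ → ℝ) :
    ∑ j : box r n, ∏ i, a i ((j : Fin d → ℕ) i) = ∏ i, ∑ y ∈ Finset.Icc r (n i), a i y := by
  rw [Finset.prod_univ_sum]
  exact Finset.sum_coe_sort (box r n) fun j => ∏ i, a i (j i)

theorem norm_prodTensor (n : Fin d → ℕ) (a : Fin d → ℕ → ℝ) :
    ‖prodTensor n a‖ = ∏ i, √(∑ y ∈ Finset.Icc 1 (n i), a i y ^ 2) := by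
  have h : ‖prodTensor n a‖ ^ 2 = (∏ i, √(∑ y ∈ Finset.Icc 1 (n i), a i y ^ 2)) ^ 2 := by
    rw [EuclideanSpace.real_norm_sq_eq, ← Finset.prod_pow]
    simp only [prodTensor, ← Finset.prod_pow]
    rw [sum_box_prod n 1 fun i y => a i y ^ 2]
    exact Finset.prod_congr rfl fun i _ =>
      (Real.sq_sqrt (Finset.sum_nonneg fun _ _ => sq_nonneg _)).symm
  exact (pow_left_inj₀ (norm_nonneg _) (Finset.prod_nonneg fun _ _ => Real.sqrt_nonneg _)
    two_ne_zero).1 h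

/-- Telescoping bound for the distance of two product tensors. -/
theorem norm_prodTensor_sub_le (n : Fin d → ℕ) (a b : Fin d → ℕ → ℝ) (M δ : Fin d → ℝ)
    (ha : ∀ i, √(∑ y ∈ Finset.Icc 1 (n i), a i y ^ 2) ≤ M i)
    (hb : ∀ i, √(∑ y ∈ Finset.Icc 1 (n i), b i y ^ 2) ≤ M i)
    (hab : ∀ i, √(∑ y ∈ Finset.Icc 1 (n i), (a i y - b i y) ^ 2) ≤ M i * δ i) :
    ‖prodTensor n a - prodTensor n b‖ ≤ (∏ i, M i) * ∑ i, δ i := by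
  have hM : ∀ i, 0 ≤ M i := fun i => (Real.sqrt_nonneg _).trans (ha i)
  -- The factors of `a` are exchanged for those of `b` one at a time; `s` holds the coordinates
  -- already exchanged.
  have key : ∀ s : Finset (Fin d), ‖prodTensor n a - prodTensor n (s.piecewise b a)‖ ≤
      (∏ i, M i) * ∑ i ∈ s, δ i := by
    intro s
    induction s using Finset.induction_on with
    | empty => simp
    | insert i s hi ih =>
      have e : prodTensor n (s.piecewise b a) - prodTensor n ((insert i s).piecewise b a) =
          prodTensor n (Function.update (s.piecewise b a) i fun y => a i y - b i y) := by
        ext j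
        simp only [prodTensor, PiLp.sub_apply]
        rw [← Finset.mul_prod_erase _ _ (Finset.mem_univ i),
          ← Finset.mul_prod_erase _ (fun l => (insert i s).piecewise b a l _) (Finset.mem_univ i),
          ← Finset.mul_prod_erase _ (fun l => Function.update (s.piecewise b a) i _ l _)
            (Finset.mem_univ i)]
        have h1 : ∀ l ∈ Finset.univ.erase i, (insert i s).piecewise b a l ((j : Fin d → ℕ) l) =
            s.piecewise b a l ((j : Fin d → ℕ) l) := by
          intro l hl
          by_cases hls : l ∈ s
          · rw [Finset.piecewise_eq_of_mem _ _ _ hls,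
              Finset.piecewise_eq_of_mem _ _ _ (Finset.mem_insert_of_mem hls)]
          · rw [Finset.piecewise_eq_of_notMem _ _ _ hls, Finset.piecewise_eq_of_notMem]
            simp [hls, Finset.ne_of_mem_erase hl]
        have h2 : ∀ l ∈ Finset.univ.erase i,
            Function.update (s.piecewise b a) i (fun y => a i y - b i y) l ((j : Fin d → ℕ) l) =
            s.piecewise b a l ((j : Fin d → ℕ) l) := by
          intro l hl
          rw [Function.update_of_ne (Finset.ne_of_mem_erase hl)]
        rw [Finset.prod_congr rfl h1, Finset.prod_congr rfl h2,
          Finset.piecewise_eq_of_notMem _ _ _ hi,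
          Finset.piecewise_eq_of_mem _ _ _ (Finset.mem_insert_self i s), Function.update_self,
          sub_mul]
      have h1 : ‖prodTensor n (s.piecewise b a) - prodTensor n ((insert i s).piecewise b a)‖ ≤
          (∏ i, M i) * δ i := by
        rw [e, norm_prodTensor, ← Finset.mul_prod_erase _ _ (Finset.mem_univ i),
          ← Finset.mul_prod_erase _ M (Finset.mem_univ i), Function.update_self,
          mul_right_comm]
        refine mul_le_mul (hab i) ?_ (Finset.prod_nonneg fun _ _ => Real.sqrt_nonneg _)
          ((Real.sqrt_nonneg _).trans (hab i))
        refine Finset.prod_le_prod (fun _ _ => Real.sqrt_nonneg _) fun l hl => ?_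
        rw [Function.update_of_ne (Finset.ne_of_mem_erase hl)]
        by_cases hls : l ∈ s
        · rw [Finset.piecewise_eq_of_mem _ _ _ hls]; exact hb l
        · rw [Finset.piecewise_eq_of_notMem _ _ _ hls]; exact ha l
      rw [Finset.sum_insert hi, mul_add]
      have := norm_sub_le_norm_sub_add_norm_sub (prodTensor n a) (prodTensor n (s.piecewise b a))
        (prodTensor n ((insert i s).piecewise b a))
      linarith
  have := key Finset.univ
  rwa [Finset.piecewise_univ] at this

/-- The truncated power sequence at the knot `j`, scaled by `n ^ m`. -/
noncomputable def atomSeq (m n j y : ℕ) : ℝ := truncPow m ((y : ℤ) - j) / (n : ℝ) ^ m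

/-- The polynomial piece of `atomSeq m n j`, truncated at the knot `τ` instead of `j`. -/
noncomputable def shiftedSeq (m n j τ y : ℕ) : ℝ :=
  (if τ ≤ y then risingPoly m ((y : ℝ) - j) else 0) / (n : ℝ) ^ m

theorem atomSeq_eq_shiftedSeq (m n j y : ℕ) : atomSeq m n j y = shiftedSeq m n j j y := by
  simp only [atomSeq, shiftedSeq, truncPow, sub_nonneg, Nat.cast_le]
  push_cast
  rfl

theorem sum_shiftedSeq_sq_le (m n j τ : ℕ) (hn : 1 ≤ n) (hj : 1 ≤ j) (hjn : j ≤ n) :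
    ∑ y ∈ Finset.Icc 1 n, shiftedSeq m n j τ y ^ 2 ≤ ((m : ℝ) + 1) ^ (2 * m) * n := by
  have hn' : (1 : ℝ) ≤ n := by exact_mod_cast hn
  have hb : ∀ y ∈ Finset.Icc 1 n, shiftedSeq m n j τ y ^ 2 ≤ ((m : ℝ) + 1) ^ (2 * m) := by
    intro y hy
    rw [Finset.mem_Icc] at hy
    rw [pow_mul', ← sq_abs]
    refine pow_le_pow_left₀ (abs_nonneg _) ?_ 2
    rw [shiftedSeq, abs_div, abs_of_pos (by positivity : (0 : ℝ) < (n : ℝ) ^ m),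
      div_le_iff₀ (by positivity), ← mul_pow]
    split_ifs
    · refine abs_risingPoly_le m _ n hn' ?_
      have h1 : (1 : ℝ) ≤ y := by exact_mod_cast hy.1
      have h2 : (y : ℝ) ≤ n := by exact_mod_cast hy.2
      have h3 : (1 : ℝ) ≤ j := by exact_mod_cast hj
      have h4 : (j : ℝ) ≤ n := by exact_mod_cast hjn
      rw [abs_le]
      constructor <;> linarith
    · rw [abs_zero]; positivity
  refine (Finset.sum_le_card_nsmul _ _ _ hb).trans (le_of_eq ?_)
  rw [Nat.card_Icc, nsmul_eq_mul, Nat.add_sub_cancel, mul_comm]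

/-- Both sequences follow the same polynomial and differ only at the |j − τ| points between the two
truncation points, where it is at most ((m+1)|j − τ|/n)^m. Number of points times squared size gives
the exponent 2m + 1. -/
theorem sum_atomSeq_sub_sq_le (m n j τ : ℕ) (hn : 1 ≤ n) :
    ∑ y ∈ Finset.Icc 1 n, (atomSeq m n j y - shiftedSeq m n j τ y) ^ 2 ≤
      ((m : ℝ) + 1) ^ (2 * m) * n * (|(j : ℝ) - τ| / n) ^ (2 * m + 1) := by
  have hn' : (1 : ℝ) ≤ n := by exact_mod_cast hn
  set g : ℕ := max j τ - min j τ with hg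
  have hgr : |(j : ℝ) - τ| = g := by
    rw [hg, Nat.cast_sub (min_le_max), Nat.cast_max, Nat.cast_min, max_sub_min_eq_abs']
  set T : Finset ℕ := Finset.Ico (min j τ) (max j τ) with hT
  have hb : ∀ y ∈ Finset.Icc 1 n, (atomSeq m n j y - shiftedSeq m n j τ y) ^ 2 ≤
      if y ∈ T then ((((m : ℝ) + 1) * g) ^ m / (n : ℝ) ^ m) ^ 2 else 0 := by
    intro y _
    rw [atomSeq_eq_shiftedSeq]
    simp only [shiftedSeq, hT, Finset.mem_Ico]
    split_ifs with h1 h2 h3 h3 h2 h3 h3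
    · omega
    · simp
    · simp only [zero_div, sub_zero]
      rw [← sq_abs]
      refine pow_le_pow_left₀ (abs_nonneg _) ?_ 2
      rw [abs_div, abs_of_pos (by positivity : (0 : ℝ) < (n : ℝ) ^ m)]
      gcongr
      apply abs_risingPoly_le
      · exact_mod_cast (by omega : 1 ≤ g)
      · rw [abs_of_nonneg (sub_nonneg.2 (by exact_mod_cast h1)), ← Nat.cast_sub h1]
        exact_mod_cast (by omega : y - j ≤ g)
    · omega
    · simp only [zero_div, zero_sub]
      rw [← sq_abs, abs_neg]
      refine pow_le_pow_left₀ (abs_nonneg _) ?_ 2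
      rw [abs_div, abs_of_pos (by positivity : (0 : ℝ) < (n : ℝ) ^ m)]
      gcongr
      apply abs_risingPoly_le
      · exact_mod_cast (by omega : 1 ≤ g)
      · rw [abs_sub_comm, abs_of_nonneg (sub_nonneg.2 (by exact_mod_cast (by omega : y ≤ j))),
          ← Nat.cast_sub (by omega)]
        exact_mod_cast (by omega : j - y ≤ g)
    · omega
    · omega
    · simp
  refine (Finset.sum_le_sum hb).trans ?_
  rw [Finset.sum_ite_mem, Finset.sum_const, nsmul_eq_mul]
  have hc : ((Finset.Icc 1 n ∩ T).card : ℝ) ≤ g := by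
    have := Finset.card_le_card (Finset.inter_subset_right (s₁ := Finset.Icc 1 n) (s₂ := T))
    rw [hT, Nat.card_Ico] at this
    exact_mod_cast this
  calc _ ≤ (g : ℝ) * ((((m : ℝ) + 1) * g) ^ m / (n : ℝ) ^ m) ^ 2 := by gcongr
    _ = _ := by
      rw [hgr, div_pow, div_pow, mul_pow, mul_pow, pow_succ (g : ℝ) (2 * m),
        pow_succ (n : ℝ) (2 * m), pow_mul' ((m : ℝ) + 1) 2 m, pow_mul' (g : ℝ) 2 m,
        pow_mul' (n : ℝ) 2 m]
      field_simp

theorem vitaliDiff_prodTensor (k : ℕ) (n : Fin d → ℕ) (a : Fin d → ℕ → ℝ) (j : box (k + 1) n) :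
    vitaliDiff k n (prodTensor n a) j = (∏ i, (n i : ℝ) ^ (k - 1)) *
      ∏ i, ∑ l ∈ Finset.range (k + 1), (-1 : ℝ) ^ l * (k.choose l : ℝ) *
        a i ((j : Fin d → ℕ) i - l) := by
  change totalDiff k n (entry (prodTensor n a)) j = _
  rw [totalDiff, Finset.prod_univ_sum]
  congr 1
  refine Finset.sum_congr rfl fun l hl => ?_
  have e : ∏ i, (-1 : ℝ) ^ l i * (k.choose (l i) : ℝ) * a i ((j : Fin d → ℕ) i - l i) =
      (∏ i, (-1 : ℝ) ^ l i * (k.choose (l i) : ℝ)) * ∏ i, a i ((j : Fin d → ℕ) i - l i) :=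
    Finset.prod_mul_distrib
  rw [e]
  congr 1
  have hj := j.2
  simp only [box, Fintype.mem_piFinset, Finset.mem_Icc, Finset.mem_range] at hj hl
  have : (fun i => (j : Fin d → ℕ) i - l i) ∈ box 1 n := by
    simp only [box, Fintype.mem_piFinset, Finset.mem_Icc]
    intro i
    have := hj i
    have := hl i
    omega
  rw [entry, dif_pos this]
  rfl

/-- The tensor with `D^k`-image the indicator of `j`. -/
noncomputable def atom (k : ℕ) (n j : Fin d → ℕ) : Tensor n :=
  prodTensor n fun i => atomSeq (k - 1) (n i) (j i)

theorem vitaliDiff_atom (k : ℕ) (hk : 1 ≤ k) (n j : Fin d → ℕ) (hn : ∀ i, 1 ≤ n i)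
    (j' : box (k + 1) n) :
    vitaliDiff k n (atom k n j) j' = if (j' : Fin d → ℕ) = j then 1 else 0 := by
  obtain ⟨m, rfl⟩ : ∃ m, k = m + 1 := ⟨k - 1, by omega⟩
  rw [atom, vitaliDiff_prodTensor, ← Finset.prod_mul_distrib]
  have hj := j'.2
  simp only [box, Fintype.mem_piFinset, Finset.mem_Icc] at hj
  have h : ∀ i, (n i : ℝ) ^ (m + 1 - 1) * (∑ l ∈ Finset.range (m + 1 + 1),
      (-1 : ℝ) ^ l * ((m + 1).choose l : ℝ) *
        atomSeq (m + 1 - 1) (n i) (j i) ((j' : Fin d → ℕ) i - l)) =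
      if (j' : Fin d → ℕ) i = j i then 1 else 0 := by
    intro i
    have hni : (n i : ℝ) ^ m ≠ 0 := by have := hn i; positivity
    have := altDiff_truncPow m ((j i : ℤ) - (j' : Fin d → ℕ) i)
    rw [altDiff_eq_sum] at this
    have e : ((j i : ℤ) - (j' : Fin d → ℕ) i = 0) ↔ (j' : Fin d → ℕ) i = j i := by omega
    simp only [e] at this
    rw [← this, Finset.mul_sum]
    refine Finset.sum_congr rfl fun l hl => ?_
    have hl := Finset.mem_range.1 hl
    have hji := hj i
    have e2 : (((j' : Fin d → ℕ) i - l : ℕ) : ℤ) - j i =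
        -((j i : ℤ) - (j' : Fin d → ℕ) i + l) := by omega
    rw [atomSeq, e2, Nat.add_sub_cancel]
    field_simp
  rw [Finset.prod_congr rfl fun i _ => h i]
  split_ifs with hjj
  · exact Finset.prod_eq_one fun i _ => if_pos (congrFun hjj i)
  · obtain ⟨i, hi⟩ := Function.ne_iff.1 hjj
    exact Finset.prod_eq_zero (Finset.mem_univ i) (if_neg hi)

/-- The tensors `∏ᵢ yᵢ^{lᵢ} 1{yᵢ ≥ τᵢ}`. -/
noncomputable def stepMonomial (n : Fin d → ℕ) (p : (Fin d → ℕ) × (Fin d → ℕ)) : Tensor n :=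
  prodTensor n fun i y => if p.1 i ≤ y then (y : ℝ) ^ p.2 i else 0

/-- The knot j enters only through the coefficients of a polynomial. Expanded in monomials, the
tensor lies in a span that depends on the truncation point τ alone, so one space serves all j. -/
theorem prodTensor_shiftedSeq_mem (k : ℕ) (hk : 1 ≤ k) (n j τ : Fin d → ℕ)
    (T : Finset (Fin d → ℕ)) (hτ : τ ∈ T) :
    prodTensor n (fun i => shiftedSeq (k - 1) (n i) (j i) (τ i)) ∈
      Submodule.span ℝ (((T ×ˢ Fintype.piFinset fun _ : Fin d => Finset.range k).image
        (stepMonomial n) : Finset (Tensor n)) : Set (Tensor n)) := by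
  obtain ⟨m, rfl⟩ : ∃ m, k = m + 1 := ⟨k - 1, by omega⟩
  choose c hc using fun i => risingPoly_eq_sum m (j i)
  have e : prodTensor n (fun i => shiftedSeq (m + 1 - 1) (n i) (j i) (τ i)) =
      ∑ l ∈ Fintype.piFinset fun _ : Fin d => Finset.range (m + 1),
        (∏ i, c i (l i) / (n i : ℝ) ^ m) • stepMonomial n (τ, l) := by
    ext y
    simp only [prodTensor, stepMonomial, WithLp.ofLp_sum, Finset.sum_apply, PiLp.smul_apply,
      smul_eq_mul, ← Finset.prod_mul_distrib, Nat.add_sub_cancel, shiftedSeq]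
    rw [← Finset.prod_univ_sum (fun _ : Fin d => Finset.range (m + 1)) (fun i l =>
      c i l / (n i : ℝ) ^ m * if τ i ≤ (y : Fin d → ℕ) i then
        (((y : Fin d → ℕ) i : ℕ) : ℝ) ^ l else 0)]
    refine Finset.prod_congr rfl fun i _ => ?_
    split_ifs
    · rw [hc, Finset.sum_div]
      exact Finset.sum_congr rfl fun l _ => by ring
    · simp
  rw [e]
  refine Submodule.sum_mem _ fun l hl => Submodule.smul_mem _ _ (Submodule.subset_span ?_)
  rw [Finset.coe_image]
  exact ⟨(τ, l), by simpa [hτ] using hl, rfl⟩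

theorem norm_atom_sub_le (k : ℕ) (hk : 1 ≤ k) (n j τ : Fin d → ℕ) (hj : j ∈ box (k + 1) n) :
    ‖atom k n j - prodTensor n (fun i => shiftedSeq (k - 1) (n i) (j i) (τ i))‖ ≤
      √((k : ℝ) ^ (2 * (k - 1))) ^ d * √(size n) *
        ∑ i, √((|(j i : ℝ) - τ i| / n i) ^ (2 * k - 1)) := by
  obtain ⟨m, rfl⟩ : ∃ m, k = m + 1 := ⟨k - 1, by omega⟩
  simp only [box, Fintype.mem_piFinset, Finset.mem_Icc] at hj
  have hn : ∀ i, 1 ≤ n i := fun i => by have := hj i; omega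
  have := norm_prodTensor_sub_le n (fun i => atomSeq m (n i) (j i))
    (fun i => shiftedSeq m (n i) (j i) (τ i)) (fun i => √(((m : ℝ) + 1) ^ (2 * m) * n i))
    (fun i => √((|(j i : ℝ) - τ i| / n i) ^ (2 * m + 1)))
    (fun i => by
      refine Real.sqrt_le_sqrt ?_
      simp only [atomSeq_eq_shiftedSeq]
      exact sum_shiftedSeq_sq_le m (n i) (j i) (j i) (hn i) (by have := hj i; omega) (hj i).2)
    (fun i => Real.sqrt_le_sqrt
      (sum_shiftedSeq_sq_le m (n i) (j i) (τ i) (hn i) (by have := hj i; omega) (hj i).2))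
    (fun i => by
      rw [← Real.sqrt_mul (by positivity)]
      exact Real.sqrt_le_sqrt (sum_atomSeq_sub_sq_le m (n i) (j i) (τ i) (hn i)))
  simp only [Nat.add_sub_cancel, atom, show 2 * (m + 1) - 1 = 2 * m + 1 by omega]
  refine this.trans (le_of_eq ?_)
  have e : ∏ i, √(((m : ℝ) + 1) ^ (2 * m) * n i) =
      √(((m + 1 : ℕ) : ℝ) ^ (2 * m)) ^ d * √(size n) := by
    simp only [Real.sqrt_mul (by positivity : (0 : ℝ) ≤ ((m : ℝ) + 1) ^ (2 * m))]
    rw [Finset.prod_mul_distrib, Finset.prod_const, Finset.card_univ, Fintype.card_fin, size,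
      Real.sqrt_prod _ (fun i _ => Nat.cast_nonneg _)]
    push_cast
    rfl
  rw [e]

/-- Expansion in the projected atoms, which are well approximated by a low-dimensional space. -/
theorem exists_dictionary (k : ℕ) (hk : 1 ≤ k) (n : Fin d → ℕ) (hn : ∀ i, 1 ≤ n i)
    (T : Finset (Fin d → ℕ)) :
    ∃ (ψ : box (k + 1) n → Tensor n) (V : Submodule ℝ (Tensor n)),
      Module.finrank ℝ V ≤ T.card * k ^ d ∧
      (∀ h ∈ (LinearMap.ker (vitaliDiff k n))ᗮ, h = ∑ j, vitaliDiff k n h j • ψ j) ∧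
      ∀ j, ∀ τ ∈ T, ‖ψ j - V.starProjection (ψ j)‖ ≤
        √((k : ℝ) ^ (2 * (k - 1))) ^ d * √(size n) *
          ∑ i, √((|((j : Fin d → ℕ) i : ℝ) - τ i| / n i) ^ (2 * k - 1)) := by
  set W := LinearMap.ker (vitaliDiff k n)
  set I := (T ×ˢ Fintype.piFinset fun _ : Fin d => Finset.range k).image (stepMonomial n) with hI
  set V₀ : Submodule ℝ (Tensor n) := Submodule.span ℝ (I : Set (Tensor n)) with hV₀
  refine ⟨fun j => Wᗮ.starProjection (atom k n j), V₀.map (Wᗮ.starProjection : Tensor n →ₗ[ℝ] Tensor n),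
    ?_, ?_, ?_⟩
  · refine (Submodule.finrank_map_le _ _).trans ((finrank_span_finset_le_card I).trans ?_)
    refine Finset.card_image_le.trans ?_
    rw [Finset.card_product]
    simp
  · intro h hh
    -- The atoms invert D^k up to the nullspace, and projecting onto its complement removes the
    -- discrepancy while fixing `h`.
    have hz : h - ∑ j : box (k + 1) n, vitaliDiff k n h j • atom k n j ∈ W := by
      rw [LinearMap.mem_ker, map_sub, map_sum, sub_eq_zero]
      funext j'
      simp only [map_smul, Finset.sum_apply, Pi.smul_apply, smul_eq_mul]
      simp_rw [vitaliDiff_atom k hk n _ hn]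
      simp
    have h1 : Wᗮ.starProjection (h - ∑ j : box (k + 1) n, vitaliDiff k n h j • atom k n j) = 0 := by
      rw [Submodule.starProjection_apply_eq_zero_iff, Submodule.orthogonal_orthogonal]
      exact hz
    rw [map_sub, sub_eq_zero, Submodule.starProjection_eq_self_iff.2 hh] at h1
    refine h1.trans ?_
    rw [map_sum]
    simp only [map_smul]
  · intro j τ hτ
    refine le_trans ?_ (norm_atom_sub_le k hk n j τ j.2)
    set b := prodTensor n (fun i => shiftedSeq (k - 1) (n i) ((j : Fin d → ℕ) i) (τ i))
    have hb : b ∈ V₀ := prodTensor_shiftedSeq_mem k hk n j τ T hτ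
    set V := V₀.map (Wᗮ.starProjection : Tensor n →ₗ[ℝ] Tensor n)
    have hbV : Wᗮ.starProjection b ∈ V := Submodule.mem_map_of_mem hb
    calc _ ≤ ‖Wᗮ.starProjection (atom k n j) - Wᗮ.starProjection b‖ := by
          rw [Submodule.starProjection_minimal]
          exact ciInf_le ⟨0, by rintro _ ⟨x, rfl⟩; exact norm_nonneg _⟩ (⟨_, hbV⟩ : V)
      _ = ‖Wᗮ.starProjection (atom k n j - b)‖ := by rw [map_sub]
      _ ≤ _ := Submodule.norm_starProjection_apply_le _ _

end VitaliTF

/-! ### Gaussian noise -/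

section Gaussian

variable {ι Ω : Type*} [Fintype ι] [MeasurableSpace Ω] {P : Measure Ω}
  {ε : ι → Ω → ℝ} {σ : ℝ}

theorem hasSubgaussianMGF_const_mul_of_hasLaw {X : Ω → ℝ}
    (hX : HasLaw X (gaussianReal 0 (σ ^ 2).toNNReal) P) (r : ℝ) :
    HasSubgaussianMGF (fun ω => r * X ω) (σ ^ 2 * r ^ 2).toNNReal P where
  integrable_exp_mul t := by
    have h : Integrable (fun x => Real.exp (t * r * x)) (P.map X) := by
      rw [hX.map_eq]
      exact integrable_exp_mul_gaussianReal (t * r)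
    have h2 := (integrable_map_measure h.1 hX.aemeasurable).1 h
    simpa only [Function.comp_def, mul_assoc] using h2
  mgf_le t := by
    rw [mgf_const_mul, mgf_gaussianReal hX.map_eq, zero_mul, zero_add,
      Real.coe_toNNReal _ (by positivity), Real.coe_toNNReal _ (by positivity)]
    apply le_of_eq
    congr 1
    ring

/-- Two-sided tail bound for linear functionals of Gaussian noise. -/
theorem measure_abs_inner_noise_le [IsFiniteMeasure P]
    (hlaw : ∀ j, HasLaw (ε j) (gaussianReal 0 (σ ^ 2).toNNReal) P) (hind : iIndepFun ε P)
    (hσ : 0 < σ) (v : EuclideanSpace ℝ ι) (u : ℝ) (hu : 0 ≤ u) :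
    P.real {ω | σ * ‖v‖ * u < |inner ℝ v (WithLp.toLp 2 fun j => ε j ω)|} ≤
      2 * Real.exp (-u ^ 2 / 2) := by
  rcases eq_or_ne v 0 with rfl | hv
  · simp; positivity
  have hv0 : 0 < ‖v‖ := norm_pos_iff.2 hv
  set Z : Ω → ℝ := fun ω => ∑ j, v j * ε j ω with hZ
  have hinner : ∀ ω, inner ℝ v (WithLp.toLp 2 fun j => ε j ω) = Z ω := by
    intro ω
    simp only [PiLp.inner_apply, hZ, RCLike.inner_apply, conj_trivial]
    exact Finset.sum_congr rfl fun j _ => mul_comm _ _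
  have hsub : HasSubgaussianMGF Z (∑ j, (σ ^ 2 * v j ^ 2).toNNReal) P := by
    refine HasSubgaussianMGF.sum_of_iIndepFun
      (hind.comp (fun j x => v j * x) fun j => measurable_const_mul (v j)) fun j _ => ?_
    exact hasSubgaussianMGF_const_mul_of_hasLaw (hlaw j) (v j)
  set c : NNReal := ∑ j, (σ ^ 2 * v j ^ 2).toNNReal with hc
  have hcv : (c : ℝ) = σ ^ 2 * ‖v‖ ^ 2 := by
    rw [hc, EuclideanSpace.real_norm_sq_eq, Finset.mul_sum]
    push_cast
    refine Finset.sum_congr rfl fun j _ => ?_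
    rw [Real.coe_toNNReal _ (by positivity)]
  have ha : 0 ≤ σ * ‖v‖ * u := by positivity
  have hexp : -(σ * ‖v‖ * u) ^ 2 / (2 * (c : ℝ)) = -u ^ 2 / 2 := by
    rw [hcv]; field_simp
  have h1 := hsub.measure_ge_le ha
  have h2 := hsub.neg.measure_ge_le ha
  rw [hexp] at h1 h2
  calc _ ≤ P.real ({ω | σ * ‖v‖ * u ≤ Z ω} ∪ {ω | σ * ‖v‖ * u ≤ (-Z) ω}) := by
        refine measureReal_mono fun ω hω => ?_
        simp only [Set.mem_ofPred_eq, hinner] at hω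
        rcases lt_abs.1 hω with h | h
        · exact Or.inl h.le
        · exact Or.inr h.le
    _ ≤ _ := measureReal_union_le _ _
    _ ≤ _ := by linarith

theorem norm_starProjection_sq_eq_sum (V : Submodule ℝ (EuclideanSpace ℝ ι))
    (y : EuclideanSpace ℝ ι) :
    ‖V.starProjection y‖ ^ 2 =
      ∑ i, inner ℝ ((stdOrthonormalBasis ℝ V i : V) : EuclideanSpace ℝ ι) y ^ 2 := by
  have h := (stdOrthonormalBasis ℝ V).sum_sq_norm_inner_right (V.orthogonalProjectionOnto y)
  rw [Submodule.starProjection_apply, ← Submodule.coe_norm, ← h]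
  refine Finset.sum_congr rfl fun i _ => ?_
  rw [Real.norm_eq_abs, sq_abs, Submodule.inner_orthogonalProjectionOnto_eq_of_mem_left]

/-- Simultaneous control of fewer than `N` linear functionals of the noise and of its projection
onto a subspace of dimension at most `N`. -/
theorem measure_noise_bad_le [IsFiniteMeasure P]
    (hlaw : ∀ j, HasLaw (ε j) (gaussianReal 0 (σ ^ 2).toNNReal) P) (hind : iIndepFun ε P)
    (hσ : 0 < σ) {J : Type*} [Fintype J] (φ : J → EuclideanSpace ℝ ι)
    (V : Submodule ℝ (EuclideanSpace ℝ ι)) (N t : ℝ) (hN : 1 ≤ N) (ht : 0 < t)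
    (hJ : (Fintype.card J : ℝ) + 1 ≤ N) (hV : (Module.finrank ℝ V : ℝ) ≤ N) :
    P.real {ω | ¬ ((∀ j, |inner ℝ (φ j) (WithLp.toLp 2 fun j => ε j ω)| ≤
        σ * ‖φ j‖ * √(2 * Real.log (2 * N) + 2 * t)) ∧
      ‖V.starProjection (WithLp.toLp 2 fun j => ε j ω)‖ ^ 2 ≤
        Module.finrank ℝ V * (2 * σ ^ 2 * (2 * Real.log (2 * N) + 2 * t)))} ≤ Real.exp (-t) := by
  have hlog : 0 ≤ Real.log N := Real.log_nonneg hN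
  have hlog2 : 0 < Real.log 2 := Real.log_pos (by norm_num)
  have hlog2N : Real.log (2 * N) = Real.log 2 + Real.log N :=
    Real.log_mul (by norm_num) (by linarith)
  have hlog2NN : Real.log (2 * N ^ 2) = Real.log 2 + 2 * Real.log N := by
    rw [Real.log_mul (by norm_num) (by positivity), Real.log_pow]
    push_cast
    rfl
  set u : ℝ := √(2 * Real.log (2 * N) + 2 * t) with hu
  -- N² instead of N: up to N basis directions of `V` then fail with total probability at most
  -- exp(-t)/N, exactly what the at most N − 1 functionals leave of the budget exp(-t). The cost is
  -- only w² ≤ 2u².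
  set w : ℝ := √(2 * Real.log (2 * N ^ 2) + 2 * t) with hw
  have hu2 : u ^ 2 = 2 * Real.log (2 * N) + 2 * t := Real.sq_sqrt (by rw [hlog2N]; positivity)
  have hw2 : w ^ 2 = 2 * Real.log (2 * N ^ 2) + 2 * t := Real.sq_sqrt (by rw [hlog2NN]; positivity)
  have hue : 2 * Real.exp (-u ^ 2 / 2) = Real.exp (-t) / N := by
    rw [hu2, show -(2 * Real.log (2 * N) + 2 * t) / 2 = -t - Real.log (2 * N) by ring,
      Real.exp_sub, Real.exp_log (by linarith)]
    field_simp
  have hwe : 2 * Real.exp (-w ^ 2 / 2) = Real.exp (-t) / N ^ 2 := by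
    rw [hw2, show -(2 * Real.log (2 * N ^ 2) + 2 * t) / 2 = -t - Real.log (2 * N ^ 2) by ring,
      Real.exp_sub, Real.exp_log (by positivity)]
    field_simp
  set y : Ω → EuclideanSpace ℝ ι := fun ω => WithLp.toLp 2 fun j => ε j ω
  set b := fun i => ((stdOrthonormalBasis ℝ V i : V) : EuclideanSpace ℝ ι) with hb
  have hb1 : ∀ i, ‖b i‖ = 1 := fun i => by
    rw [hb]
    exact (stdOrthonormalBasis ℝ V).orthonormal.1 i
  set A : J → Set Ω := fun j => {ω | σ * ‖φ j‖ * u < |inner ℝ (φ j) (y ω)|}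
  set B : Fin (Module.finrank ℝ V) → Set Ω := fun i => {ω | σ * ‖b i‖ * w < |inner ℝ (b i) (y ω)|}
  have hA : ∀ j, P.real (A j) ≤ Real.exp (-t) / N := fun j =>
    hue ▸ measure_abs_inner_noise_le hlaw hind hσ (φ j) u (Real.sqrt_nonneg _)
  have hB : ∀ i, P.real (B i) ≤ Real.exp (-t) / N ^ 2 := fun i =>
    hwe ▸ measure_abs_inner_noise_le hlaw hind hσ (b i) w (Real.sqrt_nonneg _)
  calc _ ≤ P.real ((⋃ j, A j) ∪ ⋃ i, B i) := by
        refine measureReal_mono fun ω hω => ?_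
        by_contra hcon
        simp only [Set.mem_union, Set.mem_iUnion, not_or, not_exists, A, B, Set.mem_ofPred_eq,
          not_lt] at hcon
        refine hω ⟨hcon.1, ?_⟩
        rw [norm_starProjection_sq_eq_sum]
        have hle : ∀ i, inner ℝ (b i) (y ω) ^ 2 ≤ 2 * σ ^ 2 * (2 * Real.log (2 * N) + 2 * t) := by
          intro i
          have := hcon.2 i
          rw [hb1, mul_one] at this
          calc inner ℝ (b i) (y ω) ^ 2 = |inner ℝ (b i) (y ω)| ^ 2 := (sq_abs _).symm
            _ ≤ (σ * w) ^ 2 := pow_le_pow_left₀ (abs_nonneg _) this 2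
            _ = σ ^ 2 * w ^ 2 := mul_pow _ _ _
            _ ≤ σ ^ 2 * (2 * (2 * Real.log (2 * N) + 2 * t)) := by
              gcongr
              rw [hw2, hlog2N, hlog2NN]
              linarith
            _ = _ := by ring
        refine (Finset.sum_le_card_nsmul _ _ _ fun i _ => hle i).trans (le_of_eq ?_)
        rw [nsmul_eq_mul, Finset.card_univ, Fintype.card_fin]
    _ ≤ P.real (⋃ j, A j) + P.real (⋃ i, B i) := measureReal_union_le _ _
    _ ≤ (∑ j, P.real (A j)) + ∑ i, P.real (B i) :=
        add_le_add (measureReal_iUnion_fintype_le _) (measureReal_iUnion_fintype_le _)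
    _ ≤ (∑ _j : J, Real.exp (-t) / N) +
          ∑ _i : Fin (Module.finrank ℝ V), Real.exp (-t) / N ^ 2 :=
        add_le_add (Finset.sum_le_sum fun j _ => hA j) (Finset.sum_le_sum fun i _ => hB i)
    _ = (Fintype.card J : ℝ) * (Real.exp (-t) / N) +
          Module.finrank ℝ V * (Real.exp (-t) / N ^ 2) := by simp
    _ ≤ (N - 1) * (Real.exp (-t) / N) + N * (Real.exp (-t) / N ^ 2) := by
        gcongr
        linarith
    _ = Real.exp (-t) := by
        have : N ≠ 0 := by linarith
        field_simp
        ring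

end Gaussian

/-! ### The basic inequality -/

namespace VitaliTF

variable {d : ℕ}

theorem margin_mem (k : ℕ) (n : Fin d → ℕ) (f : Tensor n) :
    margin k n f ∈ (LinearMap.ker (vitaliDiff k n))ᗮ :=
  Submodule.starProjection_apply_mem _ f

theorem margin_of_mem (k : ℕ) (n : Fin d → ℕ) (f : Tensor n)
    (hf : f ∈ (LinearMap.ker (vitaliDiff k n))ᗮ) : margin k n f = f :=
  Submodule.starProjection_eq_self_iff.2 hf

theorem vitaliDiff_margin (k : ℕ) (n : Fin d → ℕ) (f : Tensor n) :
    vitaliDiff k n (margin k n f) = vitaliDiff k n f := by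
  have h : f - margin k n f ∈ LinearMap.ker (vitaliDiff k n) := by
    have := Submodule.sub_starProjection_mem_orthogonal (K := (LinearMap.ker (vitaliDiff k n))ᗮ) f
    rwa [Submodule.orthogonal_orthogonal] at this
  rw [LinearMap.mem_ker, map_sub, sub_eq_zero] at h
  exact h.symm

theorem margin_sub (k : ℕ) (n : Fin d → ℕ) (f g : Tensor n) :
    margin k n (f - g) = margin k n f - margin k n g := by
  simp only [margin, map_sub]

theorem vitaliTV_convex (k : ℕ) (n : Fin d → ℕ) (f g : Tensor n) (τ : ℝ) (h0 : 0 ≤ τ) (h1 : τ ≤ 1) :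
    vitaliTV k n ((1 - τ) • f + τ • g) ≤ (1 - τ) * vitaliTV k n f + τ * vitaliTV k n g := by
  simp only [vitaliTV, map_add, map_smul, Finset.mul_sum, ← Finset.sum_add_distrib]
  refine Finset.sum_le_sum fun j _ => ?_
  simp only [Pi.add_apply, Pi.smul_apply, smul_eq_mul]
  refine (abs_add_le _ _).trans ?_
  rw [abs_mul, abs_mul, abs_of_nonneg h0, abs_of_nonneg (sub_nonneg.2 h1)]

/-- The minimiser is compared with points of the segment towards `g`; the parallelogram-type
identity yields a quadratic gain, and τ → 0 after division by τ. The gain later pays for all terms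
linear in the norm of margin(f̂ − g). -/
theorem objective_two_point (k : ℕ) (n : Fin d → ℕ) (lam : ℝ) (hlam : 0 ≤ lam)
    (Y fhat g : Tensor n) (hf : IsTrendFilter k n lam Y fhat) :
    objective k n lam Y fhat + ‖margin k n (fhat - g)‖ ^ 2 / size n ≤ objective k n lam Y g := by
  have key : ∀ τ : ℝ, 0 < τ → τ ≤ 1 → objective k n lam Y fhat +
      (1 - τ) * (‖margin k n (fhat - g)‖ ^ 2 / size n) ≤ objective k n lam Y g := by
    intro τ h0 h1
    have h := hf ((1 - τ) • fhat + τ • g)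
    have htv := vitaliTV_convex k n fhat g τ h0.le h1
    have hnorm : ‖margin k n (Y - ((1 - τ) • fhat + τ • g))‖ ^ 2 =
        (1 - τ) * ‖margin k n (Y - fhat)‖ ^ 2 + τ * ‖margin k n (Y - g)‖ ^ 2 -
          τ * (1 - τ) * ‖margin k n (fhat - g)‖ ^ 2 := by
      have e1 : margin k n (Y - ((1 - τ) • fhat + τ • g)) =
          (1 - τ) • margin k n (Y - fhat) + τ • margin k n (Y - g) := by
        simp only [margin, ← map_smul, ← map_add]
        congr 1
        module
      have e2 : margin k n (fhat - g) = margin k n (Y - g) - margin k n (Y - fhat) := by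
        rw [← margin_sub]
        congr 1
        abel
      rw [e1, e2, norm_add_sq_real, norm_sub_sq_real, norm_smul, norm_smul, real_inner_smul_left,
        real_inner_smul_right, Real.norm_eq_abs, Real.norm_eq_abs, mul_pow, mul_pow, sq_abs, sq_abs,
        real_inner_comm]
      ring
    simp only [objective] at h ⊢
    rw [hnorm] at h
    set a := ‖margin k n (Y - fhat)‖ ^ 2
    set b := ‖margin k n (Y - g)‖ ^ 2
    set c := ‖margin k n (fhat - g)‖ ^ 2
    have hmul : 2 * lam * vitaliTV k n ((1 - τ) • fhat + τ • g) ≤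
        2 * lam * ((1 - τ) * vitaliTV k n fhat + τ * vitaliTV k n g) := by gcongr
    have : τ * (a / size n + 2 * lam * vitaliTV k n fhat + (1 - τ) * (c / size n)) ≤
        τ * (b / size n + 2 * lam * vitaliTV k n g) := by
      have e : ((1 - τ) * a + τ * b - τ * (1 - τ) * c) / size n =
          (1 - τ) * (a / size n) + τ * (b / size n) - τ * (1 - τ) * (c / size n) := by ring
      rw [e] at h
      linarith
    exact le_of_mul_le_mul_left this h0
  have hc : ContinuousWithinAt (fun τ : ℝ => objective k n lam Y fhat +
      (1 - τ) * (‖margin k n (fhat - g)‖ ^ 2 / size n)) (Set.Ioi 0) 0 :=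
    (by fun_prop : Continuous fun τ : ℝ => objective k n lam Y fhat +
      (1 - τ) * (‖margin k n (fhat - g)‖ ^ 2 / size n)).continuousWithinAt
  have := le_of_tendsto hc (Filter.eventually_of_mem
    (Ioc_mem_nhdsGT (zero_lt_one' ℝ)) fun τ hτ => key τ hτ.1 hτ.2)
  simpa using this

/-- The basic inequality for the trend filtering estimator. -/
theorem basic_inequality (k : ℕ) (n : Fin d → ℕ) (hn : 0 < size n) (lam : ℝ) (hlam : 0 ≤ lam)
    (f0 e fhat g : Tensor n) (hf : IsTrendFilter k n lam (f0 + e) fhat) :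
    ‖margin k n (fhat - f0)‖ ^ 2 / size n + ‖margin k n (fhat - g)‖ ^ 2 / size n ≤
      ‖g - margin k n f0‖ ^ 2 / size n + 2 * inner ℝ e (margin k n (fhat - g)) / size n +
        2 * lam * (vitaliTV k n g - vitaliTV k n fhat) := by
  have h := objective_two_point k n lam hlam (f0 + e) fhat g hf
  have hinner : ∀ f : Tensor n, inner ℝ (margin k n e) (margin k n f) = inner ℝ e (margin k n f) :=
    fun f => by
      rw [margin, Submodule.inner_starProjection_left_eq_right]
      congr 1
      exact margin_of_mem k n _ (margin_mem k n f)
  have expand : ∀ f : Tensor n, ‖margin k n (f0 + e - f)‖ ^ 2 =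
      ‖margin k n (f - f0)‖ ^ 2 + ‖margin k n e‖ ^ 2 - 2 * inner ℝ e (margin k n (f - f0)) := by
    intro f
    have : margin k n (f0 + e - f) = margin k n e - margin k n (f - f0) := by
      rw [← margin_sub]
      congr 1
      abel
    rw [this, norm_sub_sq_real, hinner]
    ring
  -- `g` need not lie in the complement of the nullspace; projecting only decreases the distance.
  have hproj : ‖margin k n (g - f0)‖ ^ 2 ≤ ‖g - margin k n f0‖ ^ 2 := by
    have : margin k n (g - f0) = margin k n (g - margin k n f0) := by
      rw [margin_sub, margin_sub, margin_of_mem k n _ (margin_mem k n f0)]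
    rw [this]
    exact pow_le_pow_left₀ (norm_nonneg _) (Submodule.norm_starProjection_apply_le _ _) 2
  have hin : inner ℝ e (margin k n (fhat - g)) =
      inner ℝ e (margin k n (fhat - f0)) - inner ℝ e (margin k n (g - f0)) := by
    rw [← inner_sub_right, ← margin_sub]
    congr 2
    abel
  simp only [objective, expand] at h
  have h3 := div_le_div_of_nonneg_right hproj hn.le
  rw [hin]
  simp only [sub_div, add_div, mul_sub] at *
  linarith

end VitaliTF

/-! ### The adjoint difference and interpolating functions -/

namespace VitaliTF

variable {d : ℕ}

/-- The adjoint of the total difference operator, on arrays indexed by `ℕ^d`. -/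
noncomputable def adjDiff (k : ℕ) (n : Fin d → ℕ) (q : (Fin d → ℕ) → ℝ) (p : Fin d → ℕ) : ℝ :=
  (∏ i, (n i : ℝ) ^ (k - 1)) * ∑ l ∈ Fintype.piFinset fun _ : Fin d => Finset.range (k + 1),
    (∏ i, (-1 : ℝ) ^ l i * (k.choose (l i) : ℝ)) * q (p + l)

/-- Summation by parts. There are no boundary terms because `q` vanishes off the range of indices of
D^k. -/
theorem sum_mul_vitaliDiff (k : ℕ) (n : Fin d → ℕ) (q : (Fin d → ℕ) → ℝ)
    (hq : ∀ j, j ∉ box (k + 1) n → q j = 0) (h : Tensor n) :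
    ∑ j : box (k + 1) n, q j * vitaliDiff k n h j = ∑ p : box 1 n, h p * adjDiff k n q p := by
  have hl : ∀ l ∈ Fintype.piFinset fun _ : Fin d => Finset.range (k + 1),
      ∑ j ∈ box (k + 1) n, q j * entry h (fun i => j i - l i) =
        ∑ p ∈ box 1 n, entry h p * q (p + l) := by
    intro l hl
    simp only [Fintype.mem_piFinset, Finset.mem_range] at hl
    rw [← Finset.sum_filter_of_ne (s := box 1 n) (p := fun p => p + l ∈ box (k + 1) n)]
    · refine Finset.sum_bij' (fun j _ i => j i - l i) (fun p _ => p + l) ?_ ?_ ?_ ?_ ?_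
      · intro j hj
        have hjl : (fun i => j i - l i) + l = j := by
          funext i
          have := hl i
          simp only [box, Fintype.mem_piFinset, Finset.mem_Icc] at hj
          have := hj i
          simp only [Pi.add_apply]
          omega
        rw [Finset.mem_filter, hjl]
        refine ⟨?_, hj⟩
        simp only [box, Fintype.mem_piFinset, Finset.mem_Icc] at hj ⊢
        intro i
        have := hj i
        have := hl i
        omega
      · intro p hp
        exact (Finset.mem_filter.1 hp).2
      · intro j hj
        funext i
        have := hl i
        simp only [box, Fintype.mem_piFinset, Finset.mem_Icc] at hj
        have := hj i
        simp only [Pi.add_apply]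
        omega
      · intro p _
        funext i
        simp
      · intro j hj
        have hjl : (fun i => j i - l i) + l = j := by
          funext i
          have := hl i
          simp only [box, Fintype.mem_piFinset, Finset.mem_Icc] at hj
          have := hj i
          simp only [Pi.add_apply]
          omega
        rw [hjl, mul_comm]
    · intro p _ hne
      by_contra hp
      exact hne (by rw [hq _ hp, mul_zero])
  have e1 : ∑ j : box (k + 1) n, q j * vitaliDiff k n h j =
      ∑ j ∈ box (k + 1) n, q j * totalDiff k n (entry h) j :=
    Finset.sum_coe_sort (box (k + 1) n) fun j => q j * totalDiff k n (entry h) j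
  have e2 : ∑ p : box 1 n, h p * adjDiff k n q p = ∑ p ∈ box 1 n, entry h p * adjDiff k n q p := by
    rw [← Finset.sum_coe_sort (box 1 n) fun p => entry h p * adjDiff k n q p]
    refine Finset.sum_congr rfl fun p _ => ?_
    rw [entry, dif_pos p.2]
  rw [e1, e2]
  simp only [totalDiff, adjDiff, Finset.mul_sum]
  rw [Finset.sum_comm, Finset.sum_comm (s := box 1 n)]
  refine Finset.sum_congr rfl fun l hlm => ?_
  calc _ = (∏ i, (n i : ℝ) ^ (k - 1)) * (∏ i, (-1 : ℝ) ^ l i * (k.choose (l i) : ℝ)) *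
        ∑ j ∈ box (k + 1) n, q j * entry h (fun i => j i - l i) := by
        rw [Finset.mul_sum]
        exact Finset.sum_congr rfl fun j _ => by ring
    _ = _ := by
        rw [hl l hlm, Finset.mul_sum]
        exact Finset.sum_congr rfl fun j _ => by ring

theorem adjDiff_sub (k : ℕ) (n : Fin d → ℕ) (q r : (Fin d → ℕ) → ℝ) (p : Fin d → ℕ) :
    adjDiff k n (fun j => q j - r j) p = adjDiff k n q p - adjDiff k n r p := by
  simp only [adjDiff, mul_sub, Finset.sum_sub_distrib]

theorem adjDiff_const_mul_sum {ι : Type*} [Fintype ι] (k : ℕ) (n : Fin d → ℕ) (c : ℝ)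
    (q : ι → (Fin d → ℕ) → ℝ) (p : Fin d → ℕ) :
    adjDiff k n (fun j => c * ∑ i, q i j) p = c * ∑ i, adjDiff k n (q i) p := by
  simp only [adjDiff, Finset.mul_sum]
  rw [Finset.sum_comm]
  exact Finset.sum_congr rfl fun i _ => Finset.sum_congr rfl fun l _ => by ring

theorem adjDiff_prod (k : ℕ) (n t : Fin d → ℕ) (Y : Fin d → ℤ → ℝ) (p : Fin d → ℕ) :
    adjDiff k n (fun j => ∏ i, Y i ((j i : ℤ) - t i)) p =
      (∏ i, (n i : ℝ) ^ (k - 1)) * ∏ i, altDiff k (Y i) ((p i : ℤ) - t i) := by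
  simp only [adjDiff, altDiff_eq_sum]
  rw [Finset.prod_univ_sum]
  congr 1
  refine Finset.sum_congr rfl fun l _ => ?_
  rw [← Finset.prod_mul_distrib]
  refine Finset.prod_congr rfl fun i _ => ?_
  congr 2
  simp only [Pi.add_apply]
  push_cast
  ring

/-- The adjoint acts on each factor separately, so the energy factorises and one-dimensional bounds
suffice. -/
theorem sum_adjDiff_prod_sq_le (k : ℕ) (n t : Fin d → ℕ) (Y : Fin d → ℤ → ℝ) (E : Fin d → ℝ)
    (hE : ∀ i, ∀ s : Finset ℤ, ∑ x ∈ s, altDiff k (Y i) x ^ 2 ≤ E i) :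
    ∑ p : box 1 n, adjDiff k n (fun j => ∏ i, Y i ((j i : ℤ) - t i)) p ^ 2 ≤
      (∏ i, (n i : ℝ) ^ (k - 1)) ^ 2 * ∏ i, E i := by
  simp only [adjDiff_prod, mul_pow, ← Finset.prod_pow]
  rw [← Finset.mul_sum, sum_box_prod n 1 fun i y => altDiff k (Y i) ((y : ℤ) - t i) ^ 2]
  refine mul_le_mul_of_nonneg_left ?_ (Finset.prod_nonneg fun i _ => by positivity)
  refine Finset.prod_le_prod (fun i _ => Finset.sum_nonneg fun _ _ => sq_nonneg _) fun i _ => ?_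
  have hinj : Function.Injective fun y : ℕ => (y : ℤ) - t i := fun a b hab => by
    simpa using hab
  have := Finset.sum_map (Finset.Icc 1 (n i)) ⟨_, hinj⟩ fun x => altDiff k (Y i) x ^ 2
  simp only [Function.Embedding.coeFn_mk] at this
  rw [← this]
  exact hE i _

/-- The interpolating function around a point `t`, with `D` the available room in each direction. -/
theorem exists_interpolant (k : ℕ) (hk : 1 ≤ k) (d : ℕ) (hd : 1 ≤ d) (B : ℝ) (hB : 0 < B) :
    ∃ K : ℝ, 0 < K ∧ ∀ (n D t : Fin d → ℕ), (∀ i, 1 ≤ D i) → ∃ q : (Fin d → ℕ) → ℝ,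
      q t = 1 ∧ (∀ j, 0 ≤ q j ∧ q j ≤ 1) ∧
      (∀ j, q j ≠ 0 → ∀ i, |(j i : ℤ) - t i| < D i) ∧
      (∀ j, q j ≠ 0 → B * ∑ i, √((|(j i : ℝ) - t i| / D i) ^ (2 * k - 1)) ≤ 1 - q j) ∧
      ∑ p : box 1 n, adjDiff k n q p ^ 2 ≤ K * (∏ i, (n i : ℝ) ^ (k - 1)) ^ 2 *
        (∏ i, (1 / (D i : ℝ)) ^ (2 * k - 1)) * ∑ i, Real.log (Real.exp 1 * D i) := by
  obtain ⟨c, K₀, hc, hK₀, hprof⟩ := exists_profile k hk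
  have hd' : (1 : ℝ) ≤ d := by exact_mod_cast hd
  -- Contracting the profile by a factor R multiplies its growth rate by R^(k−1/2) ≥ √R. This is
  -- chosen to beat B, the profile constant c and the averaging factor d.
  set R : ℕ := ⌈(B * d / c) ^ 2⌉₊ + 1 with hR
  have hR1 : (1 : ℝ) ≤ R := by rw [hR]; push_cast; linarith [(Nat.cast_nonneg _ : (0:ℝ) ≤ (⌈(B * d / c) ^ 2⌉₊ : ℝ))]
  have hRB : B * d ≤ c * √((R : ℝ) ^ (2 * k - 1)) := by
    have h1 : (B * d / c) ^ 2 ≤ (R : ℝ) ^ (2 * k - 1) := by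
      calc (B * d / c) ^ 2 ≤ R := by
            rw [hR]; push_cast; linarith [Nat.le_ceil ((B * d / c) ^ 2)]
        _ = (R : ℝ) ^ 1 := (pow_one _).symm
        _ ≤ _ := pow_le_pow_right₀ hR1 (by omega)
    have h2 := Real.le_sqrt_of_sq_le h1
    rw [div_le_iff₀ hc] at h2
    linarith
  refine ⟨4 * (K₀ * (2 * R) ^ (2 * k - 1)) ^ d + 1, by positivity, fun n D t hD => ?_⟩
  have hD' : ∀ i, (1 : ℝ) ≤ D i := fun i => by exact_mod_cast hD i
  -- The +1 keeps the radius positive when D is small; the factor 2 leaves room for it, so that R·e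
  -- ≤ D as soon as e > 1.
  set e : Fin d → ℕ := fun i => D i / (2 * R) + 1 with he
  have he1 : ∀ i, 1 ≤ e i := fun i => by simp [he]
  have heD : ∀ i, e i ≤ D i := by
    intro i
    have h1 := hD i
    have h2 : D i / (2 * R) ≤ D i / 2 := Nat.div_le_div_left (by omega) (by omega)
    simp only [he]
    omega
  have heR : ∀ i, 1 / (e i : ℝ) ≤ (2 * R) * (1 / (D i : ℝ)) := by
    intro i
    have h1 : D i < 2 * R * e i := by
      have := Nat.lt_mul_div_succ (D i) (show 0 < 2 * R by omega)
      simpa [he] using this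
    have h2 : (D i : ℝ) ≤ 2 * R * e i := by exact_mod_cast h1.le
    have h3 : (0 : ℝ) < e i := by exact_mod_cast he1 i
    rw [mul_one_div, div_le_div_iff₀ h3 (by linarith [hD' i])]
    linarith
  choose X V hX0 hV0 hX1 hXs hV hEX hEV using fun i => hprof (e i) (he1 i)
  set x : (Fin d → ℕ) → Fin d → ℤ := fun j i => (j i : ℤ) - t i with hx
  set q₀ : (Fin d → ℕ) → ℝ := fun j => ∏ i, X i (x j i) with hq₀
  set r : Fin d → (Fin d → ℕ) → ℝ := fun i j =>
    ∏ l, (Function.update X i (fun y => X i y * V i y)) l (x j l) with hr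
  have hrq : ∀ i j, r i j = q₀ j * V i (x j i) := by
    intro i j
    simp only [hr, hq₀]
    rw [← Finset.mul_prod_erase _ _ (Finset.mem_univ i),
      ← Finset.mul_prod_erase _ (fun i => X i (x j i)) (Finset.mem_univ i), Function.update_self]
    rw [Finset.prod_congr rfl (g := fun l => X l (x j l))]
    · ring
    · intro l hl
      rw [Function.update_of_ne (Finset.ne_of_mem_erase hl)]
  have hq₀0 : ∀ j, 0 ≤ q₀ j := fun j => Finset.prod_nonneg fun i _ => (hX1 i _).1
  have hq₀1 : ∀ j, q₀ j ≤ 1 := fun j =>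
    Finset.prod_le_one (fun i _ => (hX1 i _).1) fun i _ => (hX1 i _).2
  have hsupp : ∀ j, q₀ j ≠ 0 → ∀ i, |x j i| < e i := by
    intro j hj i
    by_contra hcon
    exact hj (Finset.prod_eq_zero (Finset.mem_univ i) (hXs i _ (not_lt.1 hcon)))
  -- This is q₀(1 − mean of the V_i), written as a combination of d + 1 pure products so that the
  -- energy bound for products applies to each.
  set q : (Fin d → ℕ) → ℝ := fun j => q₀ j - 1 / (d : ℝ) * ∑ i, r i j with hq
  set v : (Fin d → ℕ) → ℝ := fun j => 1 / (d : ℝ) * ∑ i, V i (x j i) with hv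
  have hqv : ∀ j, q j = q₀ j * (1 - v j) := by
    intro j
    simp only [hq, hv, hrq, ← Finset.mul_sum]
    ring
  have hv01 : ∀ j, q₀ j ≠ 0 → 0 ≤ v j ∧ v j ≤ 1 := by
    intro j hj
    have h := hsupp j hj
    constructor
    · exact mul_nonneg (by positivity) (Finset.sum_nonneg fun i _ => (hV i _ (h i)).1)
    · simp only [hv]
      rw [one_div, inv_mul_le_iff₀ (by linarith), mul_one]
      calc ∑ i, V i (x j i) ≤ ∑ _i : Fin d, (1 : ℝ) :=
            Finset.sum_le_sum fun i _ => (hV i _ (h i)).2.1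
        _ = d := by simp
  have hq0 : ∀ j, q j ≠ 0 → q₀ j ≠ 0 := by
    intro j hj h0
    exact hj (by rw [hqv, h0, zero_mul])
  have hlogD : ∀ i, 1 ≤ Real.log (Real.exp 1 * D i) := by
    intro i
    rw [Real.log_mul (Real.exp_pos 1).ne' (by linarith [hD' i]), Real.log_exp]
    linarith [Real.log_nonneg (hD' i)]
  refine ⟨q, ?_, ?_, ?_, ?_, ?_⟩
  · have hxt : ∀ i, x t i = 0 := fun i => by simp [hx]
    rw [hqv]
    simp only [hq₀, hv, hxt, hX0, hV0]
    simp
  · intro j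
    by_cases h0 : q₀ j = 0
    · rw [hqv, h0, zero_mul]
      exact ⟨le_rfl, zero_le_one⟩
    · obtain ⟨h1, h2⟩ := hv01 j h0
      rw [hqv]
      exact ⟨mul_nonneg (hq₀0 j) (by linarith), mul_le_one₀ (hq₀1 j) (by linarith) (by linarith)⟩
  · intro j hj i
    have h1 := hsupp j (hq0 j hj) i
    have h2 := heD i
    simp only [hx] at h1
    omega
  · intro j hj
    have h0 := hq0 j hj
    obtain ⟨h1, h2⟩ := hv01 j h0
    have hle : v j ≤ 1 - q j := by
      rw [hqv]
      nlinarith [hq₀1 j, hq₀0 j]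
    refine le_trans ?_ hle
    simp only [hv]
    rw [Finset.mul_sum, Finset.mul_sum]
    refine Finset.sum_le_sum fun i _ => ?_
    have hi := hsupp j h0 i
    have hVi := (hV i _ hi).2.2
    have hxr : ((x j i : ℤ) : ℝ) = (j i : ℝ) - t i := by simp [hx]
    rw [hxr] at hVi
    rcases eq_or_ne (x j i) 0 with hz | hz
    · rw [← hxr, hz]
      have : 2 * k - 1 ≠ 0 := by omega
      simp [this, hV0]
    -- A nonzero offset inside the support forces e ≥ 2, that is D ≥ 2R; this excludes the small D
    -- for which R·e ≤ D may fail.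
    · have hD2 : 2 * R * (D i / (2 * R)) ≤ D i := Nat.mul_div_le _ _
      have hpos : 1 ≤ D i / (2 * R) := by
        have := Int.one_le_abs hz
        simp only [he] at hi
        omega
      have heD2 : R * e i ≤ D i := by
        simp only [he]
        nlinarith
      have heD3 : (R : ℝ) * e i ≤ D i := by exact_mod_cast heD2
      have he3 : (0 : ℝ) < e i := by exact_mod_cast he1 i
      have hD3 : (0 : ℝ) < D i := by linarith [hD' i]
      have hcmp : (R : ℝ) * (|(j i : ℝ) - t i| / D i) ≤ |(j i : ℝ) - t i| / e i := by
        rw [le_div_iff₀ he3]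
        calc (R : ℝ) * (|(j i : ℝ) - t i| / D i) * e i =
              |(j i : ℝ) - t i| * ((R * e i) / D i) := by ring
          _ ≤ |(j i : ℝ) - t i| * 1 := by
              gcongr
              rwa [div_le_one hD3]
          _ = _ := mul_one _
      rw [← mul_le_mul_iff_right₀ (by linarith : (0 : ℝ) < d)]
      calc (d : ℝ) * (B * √((|(j i : ℝ) - t i| / D i) ^ (2 * k - 1)))
          = B * d * √((|(j i : ℝ) - t i| / D i) ^ (2 * k - 1)) := by ring
        _ ≤ c * √((R : ℝ) ^ (2 * k - 1)) * √((|(j i : ℝ) - t i| / D i) ^ (2 * k - 1)) := by gcongr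
        _ = c * √(((R : ℝ) * (|(j i : ℝ) - t i| / D i)) ^ (2 * k - 1)) := by
            rw [mul_assoc, ← Real.sqrt_mul (by positivity), ← mul_pow]
        _ ≤ c * √((|(j i : ℝ) - t i| / e i) ^ (2 * k - 1)) := by gcongr
        _ ≤ V i (x j i) := hVi
        _ = d * (1 / d * V i (x j i)) := by field_simp
  · set a : Fin d → ℝ := fun i => K₀ * (2 * R) ^ (2 * k - 1) * (1 / (D i : ℝ)) ^ (2 * k - 1) with ha
    have ha0 : ∀ i, 0 ≤ a i := fun i => by positivity
    have hea : ∀ i, K₀ * (1 / (e i : ℝ)) ^ (2 * k - 1) ≤ a i := by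
      intro i
      calc _ ≤ K₀ * ((2 * R) * (1 / (D i : ℝ))) ^ (2 * k - 1) := by gcongr; exact heR i
        _ = _ := by rw [mul_pow]; ring
    have h1 := sum_adjDiff_prod_sq_le k n t X a fun i s => (hEX i s).trans (hea i)
    have h2 : ∀ i, ∑ p : box 1 n, adjDiff k n (r i) p ^ 2 ≤
        (∏ i, (n i : ℝ) ^ (k - 1)) ^ 2 * ((∏ i, a i) * Real.log (Real.exp 1 * D i)) := by
      intro i
      have := sum_adjDiff_prod_sq_le k n t (Function.update X i (fun y => X i y * V i y))
        (Function.update a i (a i * Real.log (Real.exp 1 * D i))) (fun l s => by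
          rcases eq_or_ne l i with rfl | hl
          · rw [Function.update_self, Function.update_self]
            refine (hEV l s).trans ?_
            have : Real.log (Real.exp 1 * e l) ≤ Real.log (Real.exp 1 * D l) := by
              apply Real.log_le_log
              · have : (0 : ℝ) < e l := by exact_mod_cast he1 l
                positivity
              · gcongr
                exact heD l
            calc _ ≤ K₀ * Real.log (Real.exp 1 * D l) * (1 / (e l : ℝ)) ^ (2 * k - 1) := by gcongr
              _ = K₀ * (1 / (e l : ℝ)) ^ (2 * k - 1) * Real.log (Real.exp 1 * D l) := by ring
              _ ≤ _ := mul_le_mul_of_nonneg_right (hea l) (by linarith [hlogD l])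
          · rw [Function.update_of_ne hl, Function.update_of_ne hl]
            exact (hEX l s).trans (hea l))
      refine this.trans (le_of_eq ?_)
      congr 1
      rw [← Finset.mul_prod_erase _ _ (Finset.mem_univ i),
        ← Finset.mul_prod_erase _ a (Finset.mem_univ i), Function.update_self]
      rw [Finset.prod_congr rfl (g := a)]
      · ring
      · intro l hl
        rw [Function.update_of_ne (Finset.ne_of_mem_erase hl)]
    have hpt : ∀ p : Fin d → ℕ, adjDiff k n q p ^ 2 ≤
        2 * adjDiff k n q₀ p ^ 2 + 2 * ∑ i, adjDiff k n (r i) p ^ 2 := by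
      intro p
      simp only [hq]
      rw [adjDiff_sub, adjDiff_const_mul_sum]
      have hcs := sq_sum_le_card_mul_sum_sq (s := Finset.univ) (f := fun i => adjDiff k n (r i) p)
      rw [Finset.card_univ, Fintype.card_fin] at hcs
      have hS : 0 ≤ ∑ i, adjDiff k n (r i) p ^ 2 := Finset.sum_nonneg fun _ _ => sq_nonneg _
      have h3 : (1 / (d : ℝ) * ∑ i, adjDiff k n (r i) p) ^ 2 ≤ ∑ i, adjDiff k n (r i) p ^ 2 := by
        rw [mul_pow, one_div, inv_pow, inv_mul_le_iff₀ (by positivity)]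
        refine hcs.trans ?_
        gcongr
        nlinarith
      nlinarith [sq_nonneg (adjDiff k n q₀ p + 1 / (d : ℝ) * ∑ i, adjDiff k n (r i) p)]
    set L := ∑ i, Real.log (Real.exp 1 * D i) with hL
    have hL1 : 1 ≤ L := by
      have := Finset.sum_le_sum fun i (_ : i ∈ Finset.univ) => hlogD i
      simp only [Finset.sum_const, Finset.card_univ, Fintype.card_fin, nsmul_eq_mul, mul_one] at this
      linarith
    have hprod : ∏ i, a i = (K₀ * (2 * R) ^ (2 * k - 1)) ^ d *
        ∏ i, (1 / (D i : ℝ)) ^ (2 * k - 1) := by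
      simp only [ha, Finset.prod_mul_distrib, Finset.prod_const, Finset.card_univ, Fintype.card_fin,
        mul_pow]
    have hP : 0 ≤ ∏ i, (1 / (D i : ℝ)) ^ (2 * k - 1) := Finset.prod_nonneg fun i _ => by positivity
    set M := (∏ i, (n i : ℝ) ^ (k - 1)) ^ 2
    have hM : 0 ≤ M := sq_nonneg _
    have hA : 0 ≤ ∏ i, a i := Finset.prod_nonneg fun i _ => ha0 i
    calc ∑ p : box 1 n, adjDiff k n q p ^ 2
        ≤ ∑ p : box 1 n, (2 * adjDiff k n q₀ p ^ 2 + 2 * ∑ i, adjDiff k n (r i) p ^ 2) :=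
          Finset.sum_le_sum fun p _ => hpt p
      _ = 2 * ∑ p : box 1 n, adjDiff k n q₀ p ^ 2 +
          2 * ∑ i, ∑ p : box 1 n, adjDiff k n (r i) p ^ 2 := by
          rw [Finset.sum_add_distrib, ← Finset.mul_sum, ← Finset.mul_sum, Finset.sum_comm]
      _ ≤ 2 * (M * ∏ i, a i) + 2 * ∑ i, M * ((∏ i, a i) * Real.log (Real.exp 1 * D i)) := by
          gcongr
          exact h2 _
      _ = 2 * (M * ∏ i, a i) * (1 + L) := by
          rw [← Finset.mul_sum, ← Finset.mul_sum]; ring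
      _ ≤ 2 * (M * ∏ i, a i) * (L + L) := by gcongr
      _ = 4 * (K₀ * (2 * R) ^ (2 * k - 1)) ^ d * M *
          (∏ i, (1 / (D i : ℝ)) ^ (2 * k - 1)) * L := by rw [hprod]; ring
      _ ≤ _ := by
          gcongr
          linarith

/-- Interpolating functions with supports in the interiors of a tessellation control weighted
sums of differences of a tensor by its norm. -/
theorem sum_interpolants_le (k : ℕ) (n : Fin d → ℕ) (S : Finset (Fin d → ℕ))
    (U : (Fin d → ℕ) → Finset (Fin d → ℕ)) (hU : ∀ m ∈ S, U m ⊆ box (k + 1) n)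
    (hdisj : ∀ m ∈ S, ∀ m' ∈ S, m ≠ m' → Disjoint (U m) (U m'))
    (q : (Fin d → ℕ) → (Fin d → ℕ) → ℝ) (hq : ∀ m ∈ S, ∀ j, j ∉ U m → q m j = 0)
    (s : (Fin d → ℕ) → ℝ) (hs : ∀ m ∈ S, |s m| ≤ 1) (h : Tensor n) :
    ∑ j : box (k + 1) n, (∑ m ∈ S, s m * q m j) * vitaliDiff k n h j ≤
      √((k + 1) ^ d) * √(∑ m ∈ S, ∑ p : box 1 n, adjDiff k n (q m) p ^ 2) * ‖h‖ := by
  classical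
  set Λ := Fintype.piFinset fun _ : Fin d => Finset.range (k + 1) with hΛ
  -- Marks the points within reach of the differences of the cell `m`. Each translate p + l lies in
  -- at most one cell, so a point is marked at most (k+1)^d times, and Cauchy–Schwarz inside and
  -- then across cells loses only this overlap.
  set I : (Fin d → ℕ) → (Fin d → ℕ) → ℝ := fun m p => if ∃ l ∈ Λ, p + l ∈ U m then 1 else 0 with hI
  have hadj : ∀ m ∈ S, ∀ p, adjDiff k n (q m) p = I m p * adjDiff k n (q m) p := by
    intro m hm p
    by_cases hp : ∃ l ∈ Λ, p + l ∈ U m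
    · simp [hI, if_pos hp]
    · simp only [hI, if_neg hp, zero_mul]
      rw [adjDiff, Finset.sum_eq_zero, mul_zero]
      intro l hl
      push Not at hp
      rw [hq m hm _ (hp l hl), mul_zero]
  have hcount : ∀ p : Fin d → ℕ, ∑ m ∈ S, I m p ≤ (k + 1) ^ d := by
    intro p
    calc ∑ m ∈ S, I m p ≤ ∑ m ∈ S, ∑ l ∈ Λ, if p + l ∈ U m then (1 : ℝ) else 0 := by
          refine Finset.sum_le_sum fun m _ => ?_
          simp only [hI]
          split_ifs with hp
          · obtain ⟨l, hl, hlm⟩ := hp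
            have := Finset.single_le_sum (f := fun l => if p + l ∈ U m then (1 : ℝ) else 0)
              (fun l _ => by split_ifs <;> norm_num) hl
            simpa [hlm] using this
          · exact Finset.sum_nonneg fun l _ => by split_ifs <;> norm_num
      _ = ∑ l ∈ Λ, ∑ m ∈ S, if p + l ∈ U m then (1 : ℝ) else 0 := Finset.sum_comm
      _ ≤ ∑ l ∈ Λ, (1 : ℝ) := by
          refine Finset.sum_le_sum fun l _ => ?_
          rw [Finset.sum_boole]
          have : (S.filter fun m => p + l ∈ U m).card ≤ 1 := by
            rw [Finset.card_le_one]
            intro a ha b hb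
            rw [Finset.mem_filter] at ha hb
            by_contra hab
            exact Finset.disjoint_left.1 (hdisj a ha.1 b hb.1 hab) ha.2 hb.2
          exact_mod_cast this
      _ = (k + 1) ^ d := by simp [hΛ]
  have hI2 : ∀ m p, I m p ^ 2 = I m p := by
    intro m p
    simp only [hI]
    split_ifs <;> norm_num
  have hterm : ∀ m ∈ S, ∑ j : box (k + 1) n, q m j * vitaliDiff k n h j =
      ∑ p : box 1 n, (I m p * h p) * adjDiff k n (q m) p := by
    intro m hm
    rw [sum_mul_vitaliDiff k n (q m) (fun j hj => hq m hm j fun hj' => hj (hU m hm hj'))]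
    refine Finset.sum_congr rfl fun p _ => ?_
    rw [hadj m hm p]
    have := hI2 m p
    calc _ = (I m p) * (h p * adjDiff k n (q m) p) := by ring
      _ = (I m p) ^ 2 * (h p * adjDiff k n (q m) p) := by rw [this]
      _ = _ := by ring
  calc ∑ j : box (k + 1) n, (∑ m ∈ S, s m * q m j) * vitaliDiff k n h j
      = ∑ m ∈ S, s m * ∑ j : box (k + 1) n, q m j * vitaliDiff k n h j := by
        simp only [Finset.sum_mul, Finset.mul_sum]
        rw [Finset.sum_comm]
        exact Finset.sum_congr rfl fun m _ => Finset.sum_congr rfl fun j _ => by ring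
    _ ≤ ∑ m ∈ S, √(∑ p : box 1 n, (I m p * h p) ^ 2) *
          √(∑ p : box 1 n, adjDiff k n (q m) p ^ 2) := by
        refine Finset.sum_le_sum fun m hm => ?_
        rw [hterm m hm]
        refine (le_abs_self _).trans ?_
        rw [abs_mul]
        refine (mul_le_of_le_one_left (abs_nonneg _) (hs m hm)).trans ?_
        rw [abs_le]
        have h1 := Real.sum_mul_le_sqrt_mul_sqrt Finset.univ (fun p : box 1 n => I m p * h p)
          (fun p => adjDiff k n (q m) p)
        have h2 := Real.sum_mul_le_sqrt_mul_sqrt Finset.univ (fun p : box 1 n => I m p * h p)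
          (fun p => -adjDiff k n (q m) p)
        simp only [mul_neg, Finset.sum_neg_distrib, neg_sq] at h2
        exact ⟨by linarith, h1⟩
    _ ≤ √(∑ m ∈ S, √(∑ p : box 1 n, (I m p * h p) ^ 2) ^ 2) *
          √(∑ m ∈ S, √(∑ p : box 1 n, adjDiff k n (q m) p ^ 2) ^ 2) :=
        Real.sum_mul_le_sqrt_mul_sqrt _ _ _
    _ = √(∑ m ∈ S, ∑ p : box 1 n, (I m p * h p) ^ 2) *
          √(∑ m ∈ S, ∑ p : box 1 n, adjDiff k n (q m) p ^ 2) := by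
        congr 2 <;> refine Finset.sum_congr rfl fun m _ => ?_ <;>
          exact Real.sq_sqrt (Finset.sum_nonneg fun _ _ => sq_nonneg _)
    _ ≤ √((k + 1) ^ d * ‖h‖ ^ 2) * √(∑ m ∈ S, ∑ p : box 1 n, adjDiff k n (q m) p ^ 2) := by
        gcongr
        rw [Finset.sum_comm, EuclideanSpace.real_norm_sq_eq, Finset.mul_sum]
        refine Finset.sum_le_sum fun p _ => ?_
        simp only [mul_pow, hI2]
        rw [← Finset.sum_mul]
        exact mul_le_mul_of_nonneg_right (hcount p) (sq_nonneg _)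
    _ = _ := by
        rw [Real.sqrt_mul (by positivity), Real.sqrt_sq (norm_nonneg _)]
        ring

/-! ### Knots around an active point -/

/-- A grid of knots around `t` with mesh about `D / Q`. -/
def knots (k Q D t : ℕ) : Finset ℕ :=
  (Finset.range ((k + 1) * Q + 1)).image (fun r => t + r * (D / Q + 1)) ∪
    (Finset.range ((k + 1) * Q + 1)).image fun r => t - r * (D / Q + 1)

theorem card_knots_le (k Q D t : ℕ) : (knots k Q D t).card ≤ 2 * ((k + 1) * Q + 1) := by
  refine (Finset.card_union_le _ _).trans ?_
  rw [two_mul]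
  exact add_le_add (Finset.card_image_le.trans (by simp)) (Finset.card_image_le.trans (by simp))

theorem self_mem_knots (k Q D t : ℕ) : t ∈ knots k Q D t :=
  Finset.mem_union_left _ (Finset.mem_image.2 ⟨0, by simp, by simp⟩)

/-- Round `j` towards `t` by whole multiples of the mesh D/Q + 1. The mesh exceeds the real
quotient, so (k+1)Q steps reach far enough, while remainders are at most D/Q. -/
theorem exists_mem_knots (k Q D t j : ℕ) (hQ : 1 ≤ Q) (h1 : j ≤ t + (k + 1) * D)
    (h2 : t ≤ j + (k + 1) * D) : ∃ τ ∈ knots k Q D t, |(j : ℝ) - τ| * Q ≤ D := by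
  set g := D / Q + 1 with hg
  have hgQ : D < Q * g := Nat.lt_mul_div_succ D (by omega)
  have hr : ∀ a, a ≤ (k + 1) * D → a / g < (k + 1) * Q + 1 := by
    intro a ha
    refine Nat.lt_succ_of_le (Nat.div_le_of_le_mul ?_)
    calc a ≤ (k + 1) * D := ha
      _ ≤ (k + 1) * (Q * g) := Nat.mul_le_mul_left _ hgQ.le
      _ = g * ((k + 1) * Q) := by ring
  have hmod : ∀ a, a % g * Q ≤ D := by
    intro a
    have : a % g ≤ D / Q := Nat.lt_succ_iff.1 (Nat.mod_lt a (Nat.succ_pos _))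
    exact (Nat.mul_le_mul_right Q this).trans (Nat.div_mul_le_self D Q)
  rcases le_total t j with h | h
  · refine ⟨t + (j - t) / g * g, Finset.mem_union_left _ (Finset.mem_image.2
      ⟨(j - t) / g, Finset.mem_range.2 (hr _ (by omega)), rfl⟩), ?_⟩
    have e := Nat.div_add_mod' (j - t) g
    have e2 : (j : ℝ) - ((t + (j - t) / g * g : ℕ) : ℝ) = ((j - t) % g : ℕ) := by
      have : j = t + (j - t) / g * g + (j - t) % g := by omega
      rw [sub_eq_iff_eq_add']
      exact_mod_cast this
    rw [e2, abs_of_nonneg (Nat.cast_nonneg _)]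
    exact_mod_cast hmod (j - t)
  · refine ⟨t - (t - j) / g * g, Finset.mem_union_right _ (Finset.mem_image.2
      ⟨(t - j) / g, Finset.mem_range.2 (hr _ (by omega)), rfl⟩), ?_⟩
    have e := Nat.div_add_mod' (t - j) g
    have e2 : ((t - (t - j) / g * g : ℕ) : ℝ) - j = ((t - j) % g : ℕ) := by
      have : t - (t - j) / g * g = j + (t - j) % g := by omega
      rw [this]
      push_cast
      ring
    rw [abs_sub_comm, e2, abs_of_nonneg (Nat.cast_nonneg _)]
    exact_mod_cast hmod (t - j)

end VitaliTF

/-! ### Tessellations and the dual certificate -/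

namespace VitaliTF

variable {d : ℕ}

theorem rectInterior_subset_rect (a b : Fin d → ℕ) : rectInterior a b ⊆ rect a b :=
  Fintype.piFinset_subset _ _ fun _ => Finset.Ioo_subset_Icc_self

namespace IsTessellation

variable {k : ℕ} {n : Fin d → ℕ} {S : Finset (Fin d → ℕ)} {lo hi : (Fin d → ℕ) → Fin d → ℕ}

theorem bounds (h : IsTessellation k n S lo hi) (hk : 1 ≤ k) {τ : Fin d → ℕ} (hτ : τ ∈ S)
    (i : Fin d) : lo τ i < τ i ∧ τ i + k ≤ hi τ i ∧ k + 1 ≤ lo τ i ∧ hi τ i ≤ n i := by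
  have h1 : ∀ l, l < k → ∀ i, lo τ i < τ i + l ∧ τ i + l < hi τ i := by
    intro l hl i
    have := h.interior τ hτ (show (fun i => τ i + l) ∈ block k τ by
      simp only [block, Fintype.mem_piFinset, Finset.mem_Icc]
      intro i
      omega)
    simp only [rectInterior, Fintype.mem_piFinset, Finset.mem_Ioo] at this
    exact this i
  have hle : ∀ i, lo τ i ≤ hi τ i := fun i => by
    have := h1 0 (by omega) i
    omega
  have h2 := h.subset τ hτ (show lo τ ∈ rect (lo τ) (hi τ) by
    simp only [rect, Fintype.mem_piFinset, Finset.mem_Icc]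
    exact fun i => ⟨le_rfl, hle i⟩)
  have h3 := h.subset τ hτ (show hi τ ∈ rect (lo τ) (hi τ) by
    simp only [rect, Fintype.mem_piFinset, Finset.mem_Icc]
    exact fun i => ⟨hle i, le_rfl⟩)
  simp only [box, Fintype.mem_piFinset, Finset.mem_Icc] at h2 h3
  have := h1 0 (by omega) i
  have := h1 (k - 1) (by omega) i
  have := h2 i
  have := h3 i
  omega

theorem one_le_dMinus (h : IsTessellation k n S lo hi) (hk : 1 ≤ k) {τ : Fin d → ℕ} (hτ : τ ∈ S)
    (i : Fin d) : 1 ≤ dMinus lo τ i := by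
  have := h.bounds hk hτ i
  simp only [dMinus]
  omega

theorem one_le_dPlus (h : IsTessellation k n S lo hi) (hk : 1 ≤ k) {τ : Fin d → ℕ} (hτ : τ ∈ S)
    (i : Fin d) : 1 ≤ dPlus k hi τ i := by
  have := h.bounds hk hτ i
  simp only [dPlus]
  omega

theorem self_mem_rectInterior (h : IsTessellation k n S lo hi) (hk : 1 ≤ k) {τ : Fin d → ℕ}
    (hτ : τ ∈ S) : τ ∈ rectInterior (lo τ) (hi τ) := by
  simp only [rectInterior, Fintype.mem_piFinset, Finset.mem_Ioo]
  intro i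
  have := h.bounds hk hτ i
  omega

theorem eq_of_mem (h : IsTessellation k n S lo hi) {τ τ' j : Fin d → ℕ} (hτ : τ ∈ S) (hτ' : τ' ∈ S)
    (h1 : j ∈ rectInterior (lo τ) (hi τ)) (h2 : j ∈ rect (lo τ') (hi τ')) : τ = τ' := by
  by_contra hne
  exact Finset.disjoint_left.1 (h.separated τ hτ τ' hτ' hne) h1 h2

end IsTessellation

theorem dMinus_le_dMax (k : ℕ) {S : Finset (Fin d → ℕ)} (lo hi : (Fin d → ℕ) → Fin d → ℕ)
    {τ : Fin d → ℕ} (hτ : τ ∈ S) (i : Fin d) : dMinus lo τ i ≤ dMax k S lo hi i :=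
  (le_max_left _ _).trans (Finset.le_sup (f := fun t => max (dMinus lo t i) (dPlus k hi t i)) hτ)

theorem dPlus_le_dMax (k : ℕ) {S : Finset (Fin d → ℕ)} (lo hi : (Fin d → ℕ) → Fin d → ℕ)
    {τ : Fin d → ℕ} (hτ : τ ∈ S) (i : Fin d) : dPlus k hi τ i ≤ dMax k S lo hi i :=
  (le_max_right _ _).trans (Finset.le_sup (f := fun t => max (dMinus lo t i) (dPlus k hi t i)) hτ)

/-- Choosing in each coordinate the sign of the shorter side turns the product of minima into one of
the `dProd`. -/
theorem prod_min_le_sum (k : ℕ) (lo hi : (Fin d → ℕ) → Fin d → ℕ) (τ : Fin d → ℕ) (w : ℕ) :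
    ∏ i, (1 / ((min (dMinus lo τ i) (dPlus k hi τ i) : ℕ) : ℝ)) ^ w ≤
      ∑ z : Fin d → Bool, (1 / dProd k lo hi τ z) ^ w := by
  have hnn : ∀ z : Fin d → Bool, 0 ≤ dProd k lo hi τ z := fun z =>
    Finset.prod_nonneg fun i _ => Nat.cast_nonneg _
  have e : ∏ i, ((min (dMinus lo τ i) (dPlus k hi τ i) : ℕ) : ℝ) =
      dProd k lo hi τ fun i => decide (dPlus k hi τ i ≤ dMinus lo τ i) := by
    refine Finset.prod_congr rfl fun i _ => ?_
    by_cases h : dPlus k hi τ i ≤ dMinus lo τ i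
    · simp [h]
    · simp [h, (not_le.1 h).le]
  rw [Finset.prod_pow, Finset.prod_div_distrib, Finset.prod_const_one, e]
  exact (Finset.single_le_sum
    (f := fun z => (1 / dProd k lo hi τ z) ^ w)
    (fun z _ => pow_nonneg (one_div_nonneg.2 (hnn z)) w)
    (Finset.mem_univ fun i => decide (dPlus k hi τ i ≤ dMinus lo τ i)))

/-- The sum over the tessellation that measures its effective sparsity. -/
noncomputable def cellSum (k : ℕ) (n : Fin d → ℕ) (S : Finset (Fin d → ℕ))
    (lo hi : (Fin d → ℕ) → Fin d → ℕ) : ℝ :=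
  ∑ τ ∈ S, ∑ z : Fin d → Bool, (size n / dProd k lo hi τ z) ^ (2 * k - 1)

/-- Every cell contributes at least 1: for z = (+,…,+), d_max/n in one coordinate compensates n/d⁺
there, and all other factors n/d⁺ are at least 1. This absorbs the dimension of V into the effective
sparsity. -/
theorem card_le_mul_cellSum (k : ℕ) (hk : 1 ≤ k) (hd : 1 ≤ d) (n : Fin d → ℕ)
    (S : Finset (Fin d → ℕ)) (lo hi : (Fin d → ℕ) → Fin d → ℕ) (hT : IsTessellation k n S lo hi) :
    (S.card : ℝ) ≤ (∑ i, ((dMax k S lo hi i : ℝ) / n i) ^ (2 * k - 1)) * cellSum k n S lo hi := by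
  rw [cellSum, Finset.mul_sum, ← nsmul_one, ← Finset.sum_const]
  refine Finset.sum_le_sum fun τ hτ => ?_
  let i₀ : Fin d := ⟨0, hd⟩
  have hn : ∀ i, (0 : ℝ) < n i := fun i => by
    have := hT.bounds hk hτ i
    exact_mod_cast (by omega : 0 < n i)
  have hp : ∀ i, (0 : ℝ) < dPlus k hi τ i := fun i => by
    exact_mod_cast hT.one_le_dPlus hk hτ i
  have hpn : ∀ i, (dPlus k hi τ i : ℝ) ≤ n i := fun i => by
    have := hT.bounds hk hτ i
    simp only [dPlus]
    exact_mod_cast (by omega : hi τ i + 1 - (τ i + k) ≤ n i)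
  have hmax : (dPlus k hi τ i₀ : ℝ) ≤ dMax k S lo hi i₀ := by
    exact_mod_cast dPlus_le_dMax k lo hi hτ i₀
  have hprod : dProd k lo hi τ (fun _ => true) = ∏ i, (dPlus k hi τ i : ℝ) := by simp [dProd]
  have hpos : 0 < dProd k lo hi τ (fun _ => true) := by
    rw [hprod]
    exact Finset.prod_pos fun i _ => hp i
  have hsize : 0 < size n := Finset.prod_pos fun i _ => hn i
  have hone : 1 ≤ (dMax k S lo hi i₀ : ℝ) / n i₀ * (size n / dProd k lo hi τ fun _ => true) := by
    rw [div_mul_div_comm, one_le_div (mul_pos (hn _) hpos), hprod, size,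
      ← Finset.mul_prod_erase _ _ (Finset.mem_univ i₀),
      ← Finset.mul_prod_erase _ (fun i => (n i : ℝ)) (Finset.mem_univ i₀)]
    have h1 : ∏ i ∈ Finset.univ.erase i₀, (dPlus k hi τ i : ℝ) ≤
        ∏ i ∈ Finset.univ.erase i₀, (n i : ℝ) :=
      Finset.prod_le_prod (fun i _ => (hp i).le) fun i _ => hpn i
    have h2 : 0 ≤ ∏ i ∈ Finset.univ.erase i₀, (dPlus k hi τ i : ℝ) :=
      Finset.prod_nonneg fun i _ => (hp i).le
    calc _ = (n i₀ : ℝ) * ((dPlus k hi τ i₀ : ℝ) *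
          ∏ i ∈ Finset.univ.erase i₀, (dPlus k hi τ i : ℝ)) := rfl
      _ ≤ (n i₀ : ℝ) * ((dMax k S lo hi i₀ : ℝ) * ∏ i ∈ Finset.univ.erase i₀, (n i : ℝ)) := by
          gcongr
      _ = _ := by ring
  have hz : ∀ z : Fin d → Bool, 0 ≤ (size n / dProd k lo hi τ z) ^ (2 * k - 1) := fun z =>
    pow_nonneg (div_nonneg hsize.le (Finset.prod_nonneg fun i _ => Nat.cast_nonneg _)) _
  calc (1 : ℝ) ≤ ((dMax k S lo hi i₀ : ℝ) / n i₀ *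
        (size n / dProd k lo hi τ fun _ => true)) ^ (2 * k - 1) := one_le_pow₀ hone
    _ = ((dMax k S lo hi i₀ : ℝ) / n i₀) ^ (2 * k - 1) *
        (size n / dProd k lo hi τ fun _ => true) ^ (2 * k - 1) := mul_pow _ _ _
    _ ≤ _ := by
        refine mul_le_mul ?_ ?_ (hz _) (Finset.sum_nonneg fun i _ => by positivity)
        · exact Finset.single_le_sum (f := fun i => ((dMax k S lo hi i : ℝ) / n i) ^ (2 * k - 1))
            (fun i _ => by positivity) (Finset.mem_univ i₀)
        · exact Finset.single_le_sum
            (f := fun z => (size n / dProd k lo hi τ z) ^ (2 * k - 1)) (fun z _ => hz z)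
            (Finset.mem_univ _)

theorem one_le_sum_log_dMax (k : ℕ) (hk : 1 ≤ k) (hd : 1 ≤ d) (n : Fin d → ℕ)
    (S : Finset (Fin d → ℕ)) (hS : S.Nonempty) (lo hi : (Fin d → ℕ) → Fin d → ℕ)
    (hT : IsTessellation k n S lo hi) :
    1 ≤ ∑ i, Real.log (Real.exp 1 * dMax k S lo hi i) := by
  obtain ⟨τ, hτ⟩ := hS
  have h1 : ∀ i, (1 : ℝ) ≤ dMax k S lo hi i := fun i => by
    exact_mod_cast (hT.one_le_dPlus hk hτ i).trans (dPlus_le_dMax k lo hi hτ i)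
  have h2 : ∀ i, 1 ≤ Real.log (Real.exp 1 * dMax k S lo hi i) := by
    intro i
    rw [Real.log_mul (Real.exp_pos 1).ne' (by linarith [h1 i]), Real.log_exp]
    linarith [Real.log_nonneg (h1 i)]
  have := Finset.sum_le_sum fun i (_ : i ∈ Finset.univ) => h2 i
  simp only [Finset.sum_const, Finset.card_univ, Fintype.card_fin, nsmul_eq_mul, mul_one] at this
  have hd' : (1 : ℝ) ≤ d := by exact_mod_cast hd
  linarith

/-- The interpolating vector `Q` of a tessellation dominates the noise weights of the projected
atoms, and its energy is of the order of the effective sparsity. -/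
theorem exists_certificate (k : ℕ) (hk : 1 ≤ k) (d : ℕ) (hd : 1 ≤ d) (c : ℝ) (hc : 0 < c) :
    ∃ (K : ℝ) (M : ℕ), 0 < K ∧ ∀ (n : Fin d → ℕ), (∀ i, k < n i) →
      ∀ (S : Finset (Fin d → ℕ)) (lo hi : (Fin d → ℕ) → Fin d → ℕ), IsTessellation k n S lo hi →
      ∃ (ψ : box (k + 1) n → Tensor n) (V : Submodule ℝ (Tensor n)) (Q : (Fin d → ℕ) → ℝ),
        Module.finrank ℝ V ≤ M * S.card ∧
        (∀ h ∈ (LinearMap.ker (vitaliDiff k n))ᗮ, h = ∑ j, vitaliDiff k n h j • ψ j) ∧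
        (∀ j ∈ S, Q j = 1) ∧ (∀ j : box (k + 1) n, Q j ≤ 1) ∧
        (∀ j, ‖ψ j - V.starProjection (ψ j)‖ ≤ c * √(size n) *
          √(∑ i, ((dMax k S lo hi i : ℝ) / n i) ^ (2 * k - 1)) * (1 - Q j)) ∧
        ∀ h : Tensor n, ∑ j : box (k + 1) n, (if (j : Fin d → ℕ) ∈ S then 1 else -Q j) *
            |vitaliDiff k n h j| ≤
          √(K * (∑ i, Real.log (Real.exp 1 * dMax k S lo hi i)) * cellSum k n S lo hi) *
            (‖h‖ / √(size n)) := by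
  set A : ℝ := √((k : ℝ) ^ (2 * (k - 1))) ^ d with hA
  have hk' : (0 : ℝ) < k := by exact_mod_cast hk
  have hA0 : 0 < A := by positivity
  -- With slope A/c, c(1 − q) dominates A times the approximation error at the knot `m` throughout
  -- the support of q.
  obtain ⟨K₁, hK₁, hint⟩ := exists_interpolant k hk d hd (A / c) (by positivity)
  -- Relative mesh 1/R of the knots: fine enough that d coordinate errors, times A, stay below c
  -- where Q vanishes.
  set R : ℕ := ⌈(A * d / c) ^ 2⌉₊ + 1 with hR
  have hR0 : (0 : ℝ) < R := by rw [hR]; positivity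
  have hRA : A * d * √(1 / (R : ℝ)) ≤ c := by
    have h1 : (A * d / c) ^ 2 ≤ R := by
      rw [hR]; push_cast; linarith [Nat.le_ceil ((A * d / c) ^ 2)]
    have h2 := Real.le_sqrt_of_sq_le h1
    rw [div_le_iff₀ hc] at h2
    rw [Real.sqrt_div zero_le_one, Real.sqrt_one, mul_one_div, div_le_iff₀ (Real.sqrt_pos.2 hR0)]
    linarith
  refine ⟨(k + 1) ^ d * K₁, (2 * ((k + 1) * R + 1)) ^ d * k ^ d, by positivity,
    fun n hn S lo hi hT => ?_⟩
  have hn0 : ∀ i, (0 : ℝ) < n i := fun i => by exact_mod_cast (by have := hn i; omega : 0 < n i)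
  have hsize : 0 < size n := Finset.prod_pos fun i _ => hn0 i
  set Dm : (Fin d → ℕ) → Fin d → ℕ := fun m i => min (dMinus lo m i) (dPlus k hi m i) with hDm
  have hDm1 : ∀ m ∈ S, ∀ i, 1 ≤ Dm m i := fun m hm i =>
    le_min (hT.one_le_dMinus hk hm i) (hT.one_le_dPlus hk hm i)
  have hDmax : ∀ m ∈ S, ∀ i, Dm m i ≤ dMax k S lo hi i := fun m hm i =>
    (min_le_left _ _).trans (dMinus_le_dMax k lo hi hm i)
  have hq' : ∀ m, ∃ q : (Fin d → ℕ) → ℝ, m ∈ S → q m = 1 ∧ (∀ j, 0 ≤ q j ∧ q j ≤ 1) ∧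
      (∀ j, q j ≠ 0 → ∀ i, |(j i : ℤ) - m i| < Dm m i) ∧
      (∀ j, q j ≠ 0 → A / c * ∑ i, √((|(j i : ℝ) - m i| / Dm m i) ^ (2 * k - 1)) ≤ 1 - q j) ∧
      ∑ p : box 1 n, adjDiff k n q p ^ 2 ≤ K₁ * (∏ i, (n i : ℝ) ^ (k - 1)) ^ 2 *
        (∏ i, (1 / (Dm m i : ℝ)) ^ (2 * k - 1)) * ∑ i, Real.log (Real.exp 1 * Dm m i) := by
    intro m
    by_cases hm : m ∈ S
    · obtain ⟨q, hq⟩ := hint n (Dm m) m (hDm1 m hm)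
      exact ⟨q, fun _ => hq⟩
    · exact ⟨0, fun h => absurd h hm⟩
  choose q hq using hq'
  have hqsupp : ∀ m ∈ S, ∀ j, j ∉ rectInterior (lo m) (hi m) → q m j = 0 := by
    intro m hm j hj
    by_contra hne
    apply hj
    simp only [rectInterior, Fintype.mem_piFinset, Finset.mem_Ioo]
    intro i
    have h1 := (hq m hm).2.2.1 j hne i
    have h2 := hT.bounds hk hm i
    rw [abs_lt] at h1
    simp only [hDm, dMinus, dPlus] at h1
    omega
  have hqother : ∀ m ∈ S, ∀ m' ∈ S, ∀ j ∈ rect (lo m) (hi m), m' ≠ m → q m' j = 0 := by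
    intro m hm m' hm' j hj hne
    apply hqsupp m' hm'
    intro hcon
    exact hne (hT.eq_of_mem hm' hm hcon hj)
  have hqsum : ∀ m ∈ S, ∀ j ∈ rect (lo m) (hi m), ∀ s : (Fin d → ℕ) → ℝ,
      ∑ m' ∈ S, s m' * q m' j = s m * q m j := by
    intro m hm j hj s
    refine Finset.sum_eq_single_of_mem m hm fun m' hm' hne => ?_
    rw [hqother m hm m' hm' j hj hne, mul_zero]
  set Q : (Fin d → ℕ) → ℝ := fun j => ∑ m ∈ S, 1 * q m j with hQ
  set T := S.biUnion fun m => Fintype.piFinset fun i => knots k R (dMax k S lo hi i) (m i) with hTdef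
  obtain ⟨ψ, V, hV, hexp, hdist⟩ := exists_dictionary k hk n (fun i => by have := hn i; omega) T
  have hself : ∀ m ∈ S, m ∈ rect (lo m) (hi m) := fun m hm =>
    rectInterior_subset_rect _ _ (hT.self_mem_rectInterior hk hm)
  refine ⟨ψ, V, Q, ?_, hexp, ?_, ?_, ?_, ?_⟩
  · have hcard : T.card ≤ S.card * (2 * ((k + 1) * R + 1)) ^ d := by
      refine Finset.card_biUnion_le_card_mul _ _ _ fun m _ => ?_
      rw [Fintype.card_piFinset]
      refine (Finset.prod_le_prod' fun i _ => card_knots_le k R _ _).trans ?_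
      simp
    calc _ ≤ T.card * k ^ d := hV
      _ ≤ (S.card * (2 * ((k + 1) * R + 1)) ^ d) * k ^ d := Nat.mul_le_mul_right _ hcard
      _ = _ := by ring
  · intro j hj
    simp only [hQ]
    rw [hqsum j hj j (hself j hj) fun _ => 1, one_mul, (hq j hj).1]
  · intro j
    obtain ⟨m, hm, hjm⟩ := hT.cover j j.2
    simp only [hQ]
    rw [hqsum m hm j hjm fun _ => 1, one_mul]
    exact ((hq m hm).2.1 j).2
  · intro j
    obtain ⟨m, hm, hjm⟩ := hT.cover j j.2
    have hQj : Q j = q m j := by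
      simp only [hQ]
      rw [hqsum m hm j hjm fun _ => 1, one_mul]
    set G := √(∑ i, ((dMax k S lo hi i : ℝ) / n i) ^ (2 * k - 1)) with hG
    have hdm0 : ∀ i, (0 : ℝ) < dMax k S lo hi i := fun i => by
      exact_mod_cast (hDm1 m hm i).trans (hDmax m hm i)
    -- Rescaling from n_i to d_{i,max} extracts a factor (d_{i,max}/n_i)^(k−1/2) ≤ G from each
    -- summand.
    have hred : ∀ τ ∈ T, A * ∑ i, √((|((j : Fin d → ℕ) i : ℝ) - τ i| / dMax k S lo hi i) ^ (2 * k - 1))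
        ≤ c * (1 - Q j) → ‖ψ j - V.starProjection (ψ j)‖ ≤ c * √(size n) * G * (1 - Q j) := by
      intro τ hτ h
      calc ‖ψ j - V.starProjection (ψ j)‖ ≤ A * √(size n) *
            ∑ i, √((|((j : Fin d → ℕ) i : ℝ) - τ i| / n i) ^ (2 * k - 1)) := hdist j τ hτ
        _ ≤ A * √(size n) *
            ∑ i, √((|((j : Fin d → ℕ) i : ℝ) - τ i| / dMax k S lo hi i) ^ (2 * k - 1)) * G := by
            gcongr with i
            have e : |((j : Fin d → ℕ) i : ℝ) - τ i| / n i =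
                |((j : Fin d → ℕ) i : ℝ) - τ i| / dMax k S lo hi i * (dMax k S lo hi i / n i) := by
              have := (hdm0 i).ne'
              field_simp
            rw [e, mul_pow, Real.sqrt_mul (by have := hdm0 i; positivity)]
            gcongr
            exact Real.sqrt_le_sqrt (Finset.single_le_sum
              (f := fun i => ((dMax k S lo hi i : ℝ) / n i) ^ (2 * k - 1))
              (fun i _ => by positivity) (Finset.mem_univ i))
        _ = √(size n) * G * (A *
            ∑ i, √((|((j : Fin d → ℕ) i : ℝ) - τ i| / dMax k S lo hi i) ^ (2 * k - 1))) := by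
            rw [← Finset.sum_mul]; ring
        _ ≤ √(size n) * G * (c * (1 - Q j)) := by gcongr
        _ = _ := by ring
    -- Off the support of q a nearby knot is used, on the support the knot `m` itself. The + side of
    -- a cell has length d⁺ + k − 1 ≤ (k+1) d_max, which explains the range of the knots.
    by_cases h0 : q m j = 0
    · have hb : ∀ i, (j : Fin d → ℕ) i ≤ m i + (k + 1) * dMax k S lo hi i ∧
          m i ≤ (j : Fin d → ℕ) i + (k + 1) * dMax k S lo hi i := by
        intro i
        simp only [rect, Fintype.mem_piFinset, Finset.mem_Icc] at hjm
        have h1 := hjm i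
        have h2 := dMinus_le_dMax k lo hi hm i
        have h3 := dPlus_le_dMax k lo hi hm i
        have h4 := hT.bounds hk hm i
        have h5 := hT.one_le_dPlus hk hm i
        simp only [dMinus, dPlus] at h2 h3 h5
        have h6 : (k + 1) * dMax k S lo hi i = k * dMax k S lo hi i + dMax k S lo hi i := by ring
        have h7 : k ≤ k * dMax k S lo hi i := Nat.le_mul_of_pos_right k (by omega)
        rw [h6]
        constructor <;> omega
      choose τ hτ hτd using fun i => exists_mem_knots k R (dMax k S lo hi i) (m i)
        ((j : Fin d → ℕ) i) (by omega) (hb i).1 (hb i).2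
      refine hred τ (Finset.mem_biUnion.2 ⟨m, hm, Fintype.mem_piFinset.2 hτ⟩) ?_
      rw [hQj, h0, sub_zero, mul_one]
      refine le_trans ?_ hRA
      rw [mul_assoc]
      gcongr
      calc _ ≤ ∑ _i : Fin d, √(1 / (R : ℝ)) := by
            refine Finset.sum_le_sum fun i _ => Real.sqrt_le_sqrt ?_
            have h1 : |((j : Fin d → ℕ) i : ℝ) - τ i| / dMax k S lo hi i ≤ 1 / R := by
              rw [div_le_div_iff₀ (hdm0 i) hR0, one_mul]
              exact hτd i
            have h2 : 1 / (R : ℝ) ≤ 1 := by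
              rw [div_le_one hR0, hR]; push_cast; linarith [(Nat.cast_nonneg _ : (0:ℝ) ≤ (⌈(A * d / c) ^ 2⌉₊ : ℝ))]
            exact (pow_le_of_le_one (by positivity) (h1.trans h2) (by omega)).trans h1
        _ = d * √(1 / (R : ℝ)) := by simp
    · refine hred m (Finset.mem_biUnion.2 ⟨m, hm, Fintype.mem_piFinset.2 fun i =>
        self_mem_knots _ _ _ _⟩) ?_
      have h1 := (hq m hm).2.2.2.1 j h0
      rw [hQj]
      rw [div_mul_eq_mul_div, div_le_iff₀ hc] at h1
      refine le_trans ?_ (h1.trans (le_of_eq (mul_comm _ _)))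
      gcongr with i
      · exact_mod_cast hDm1 m hm i
      · exact_mod_cast hDmax m hm i
  · intro h
    -- Signing each bump by D^k h at its centre gives exactly |D^k h| on S and at least −Q|D^k h|
    -- elsewhere.
    set s : (Fin d → ℕ) → ℝ := fun m =>
      if hm : m ∈ box (k + 1) n then SignType.sign (vitaliDiff k n h ⟨m, hm⟩) else 0 with hs
    have hs1 : ∀ m, |s m| ≤ 1 := by
      intro m
      simp only [hs]
      split_ifs with hm
      · rcases SignType.sign (vitaliDiff k n h ⟨m, hm⟩) with _ | _ | _ <;> simp
      · simp
    have hsub : ∀ m ∈ S, rectInterior (lo m) (hi m) ⊆ box (k + 1) n := fun m hm =>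
      (rectInterior_subset_rect _ _).trans (hT.subset m hm)
    have hmain := sum_interpolants_le k n S (fun m => rectInterior (lo m) (hi m)) hsub
      (fun m hm m' hm' hne => (hT.separated m hm m' hm' hne).mono_right
        (rectInterior_subset_rect _ _)) q hqsupp s (fun m _ => hs1 m) h
    have hlow : ∑ j : box (k + 1) n, (if (j : Fin d → ℕ) ∈ S then 1 else -Q j) *
        |vitaliDiff k n h j| ≤
        ∑ j : box (k + 1) n, (∑ m ∈ S, s m * q m j) * vitaliDiff k n h j := by
      refine Finset.sum_le_sum fun j _ => ?_
      obtain ⟨m, hm, hjm⟩ := hT.cover j j.2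
      split_ifs with hj
      · rw [hqsum j hj j (hself j hj) s, (hq j hj).1, mul_one, one_mul]
        simp only [hs, dif_pos j.2]
        rw [sign_mul_self]
      · have hQj : Q j = q m j := by
          simp only [hQ]
          rw [hqsum m hm j hjm fun _ => 1, one_mul]
        rw [hqsum m hm j hjm s, hQj]
        have h1 := ((hq m hm).2.1 j).1
        have h2 : |s m * q m j * vitaliDiff k n h j| ≤ q m j * |vitaliDiff k n h j| := by
          rw [abs_mul, abs_mul, abs_of_nonneg h1, mul_assoc]
          exact mul_le_of_le_one_left (by positivity) (hs1 m)
        have := (abs_le.1 h2).1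
        linarith
    refine (hlow.trans hmain).trans ?_
    set L := ∑ i, Real.log (Real.exp 1 * dMax k S lo hi i)
    have hpow : (∏ i, (n i : ℝ) ^ (k - 1)) ^ 2 * size n = size n ^ (2 * k - 1) := by
      rw [Finset.prod_pow, ← size, ← pow_mul, ← pow_succ]
      congr 1
      omega
    have henergy : (∑ m ∈ S, ∑ p : box 1 n, adjDiff k n (q m) p ^ 2) * size n ≤
        K₁ * L * cellSum k n S lo hi := by
      rw [cellSum, Finset.sum_mul, Finset.mul_sum]
      refine Finset.sum_le_sum fun m hm => ?_
      have hlog : ∑ i, Real.log (Real.exp 1 * Dm m i) ≤ L := by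
        refine Finset.sum_le_sum fun i _ => Real.log_le_log ?_ ?_
        · have : (0 : ℝ) < Dm m i := by exact_mod_cast hDm1 m hm i
          positivity
        · gcongr
          exact hDmax m hm i
      have hlog0 : 0 ≤ ∑ i, Real.log (Real.exp 1 * Dm m i) := by
        refine Finset.sum_nonneg fun i _ => Real.log_nonneg ?_
        have : (1 : ℝ) ≤ Dm m i := by exact_mod_cast hDm1 m hm i
        nlinarith [Real.add_one_le_exp (1 : ℝ)]
      calc _ ≤ (K₁ * (∏ i, (n i : ℝ) ^ (k - 1)) ^ 2 *
            (∏ i, (1 / (Dm m i : ℝ)) ^ (2 * k - 1)) * ∑ i, Real.log (Real.exp 1 * Dm m i)) *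
            size n := by
            gcongr
            exact (hq m hm).2.2.2.2
        _ = K₁ * (∑ i, Real.log (Real.exp 1 * Dm m i)) * (((∏ i, (n i : ℝ) ^ (k - 1)) ^ 2 * size n) *
            ∏ i, (1 / (Dm m i : ℝ)) ^ (2 * k - 1)) := by ring
        _ ≤ K₁ * L * (((∏ i, (n i : ℝ) ^ (k - 1)) ^ 2 * size n) *
            ∑ z : Fin d → Bool, (1 / dProd k lo hi m z) ^ (2 * k - 1)) := by
            have h1 : 0 ≤ ∏ i, (1 / (Dm m i : ℝ)) ^ (2 * k - 1) :=
              Finset.prod_nonneg fun i _ => by positivity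
            have h2 : 0 ≤ L := hlog0.trans hlog
            gcongr
            exact prod_min_le_sum k lo hi m _
        _ = _ := by
            rw [hpow]
            congr 1
            rw [Finset.mul_sum]
            refine Finset.sum_congr rfl fun z _ => ?_
            rw [← mul_pow, mul_one_div]
    have hss : 0 < √(size n) := Real.sqrt_pos.2 hsize
    rw [← mul_div_assoc, le_div_iff₀ hss]
    calc _ = √((k + 1) ^ d * ((∑ m ∈ S, ∑ p : box 1 n, adjDiff k n (q m) p ^ 2) * size n)) *
          ‖h‖ := by
          rw [Real.sqrt_mul (by positivity), Real.sqrt_mul (Finset.sum_nonneg fun _ _ =>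
            Finset.sum_nonneg fun _ _ => sq_nonneg _)]
          ring
      _ ≤ √((k + 1) ^ d * (K₁ * L * cellSum k n S lo hi)) * ‖h‖ := by gcongr
      _ = _ := by
          congr 2
          ring

end VitaliTF

/-! ### The oracle inequality and the theorem -/

namespace VitaliTF

variable {d : ℕ}

theorem card_box_one (n : Fin d → ℕ) : ((box 1 n).card : ℝ) = size n := by
  simp [box, size]

theorem card_box_succ_lt (k : ℕ) (hk : 1 ≤ k) (hd : 1 ≤ d) (n : Fin d → ℕ) (hn : ∀ i, k < n i) :
    ((box (k + 1) n).card : ℝ) + 1 ≤ size n := by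
  rw [← card_box_one]
  have h : box (k + 1) n ⊂ box 1 n := by
    have hsub : box (k + 1) n ⊆ box 1 n :=
      Fintype.piFinset_subset _ _ fun i => Finset.Icc_subset_Icc_left (by omega)
    rw [Finset.ssubset_iff_of_subset hsub]
    refine ⟨fun _ => 1, ?_, fun hcon => ?_⟩
    · simp only [box, Fintype.mem_piFinset, Finset.mem_Icc]
      intro i
      have := hn i
      omega
    · simp only [box, Fintype.mem_piFinset, Finset.mem_Icc] at hcon
      have := hcon ⟨0, hd⟩
      omega
  exact_mod_cast Finset.card_lt_card h

/-- Triangle inequality in two forms: |b| − |a| ≤ |a − b| on S, and |b| − |a| ≤ 2|b| − |a − b| off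
S. -/
theorem vitaliTV_sub_le (k : ℕ) (n : Fin d → ℕ) (S : Finset (Fin d → ℕ)) (f g : Tensor n) :
    vitaliTV k n g - vitaliTV k n f ≤ 2 * vitaliTVOff k n S g +
      ∑ j : box (k + 1) n, (if (j : Fin d → ℕ) ∈ S then 1 else -1) * |vitaliDiff k n (f - g) j| := by
  simp only [vitaliTV, vitaliTVOff, Finset.mul_sum]
  rw [← Finset.sum_sub_distrib, ← Finset.sum_add_distrib]
  refine Finset.sum_le_sum fun j _ => ?_
  rw [map_sub, Pi.sub_apply]
  set a := vitaliDiff k n f j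
  set b := vitaliDiff k n g j
  split_ifs
  · have := abs_sub_abs_le_abs_sub b a
    rw [abs_sub_comm] at this
    linarith
  · have := abs_sub a b
    linarith

/-- The oracle inequality on the event where the noise is controlled. -/
theorem oracle_inequality_of_noise_bound (k : ℕ) (n : Fin d → ℕ) (hn : 0 < size n)
    (S : Finset (Fin d → ℕ)) (lam : ℝ) (hlam : 0 ≤ lam) (f0 e fhat g : Tensor n)
    (hf : IsTrendFilter k n lam (f0 + e) fhat)
    (ψ : box (k + 1) n → Tensor n) (V : Submodule ℝ (Tensor n)) (Q : (Fin d → ℕ) → ℝ) (Γ a : ℝ)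
    (hexp : ∀ h ∈ (LinearMap.ker (vitaliDiff k n))ᗮ, h = ∑ j, vitaliDiff k n h j • ψ j)
    (hQ : ∀ j ∈ S, Q j = 1)
    (hψ : ∀ j, |inner ℝ (ψ j - V.starProjection (ψ j)) e| ≤ size n * lam * (1 - Q j))
    (hV : ‖V.starProjection e‖ ^ 2 ≤ a)
    (hΓ : ∀ h : Tensor n, ∑ j : box (k + 1) n, (if (j : Fin d → ℕ) ∈ S then 1 else -Q j) *
      |vitaliDiff k n h j| ≤ Γ * (‖h‖ / √(size n))) :
    ‖margin k n (fhat - f0)‖ ^ 2 / size n ≤ ‖g - margin k n f0‖ ^ 2 / size n +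
      4 * lam * vitaliTVOff k n S g + 2 * a / size n + 2 * lam ^ 2 * Γ ^ 2 := by
  have hbasic := basic_inequality k n hn lam hlam f0 e fhat g hf
  have htv := vitaliTV_sub_le k n S fhat g
  have hD := vitaliDiff_margin k n (fhat - g)
  set h := margin k n (fhat - g) with hh
  rw [← hD] at htv
  have hG := hΓ h
  -- Only the component of `h` off `V` is expanded in the dictionary, whose residuals carry the
  -- weights 1 − Q.
  have hnoise : inner ℝ e h ≤ ‖V.starProjection e‖ * ‖h‖ +
      size n * lam * ∑ j : box (k + 1) n, (1 - Q j) * |vitaliDiff k n h j| := by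
    have h1 : h - V.starProjection h =
        ∑ j, vitaliDiff k n h j • (ψ j - V.starProjection (ψ j)) := by
      have h0 : V.starProjection h = ∑ j, V.starProjection (vitaliDiff k n h j • ψ j) := by
        rw [← map_sum, ← hexp h (margin_mem k n _)]
      calc h - V.starProjection h = ∑ j, vitaliDiff k n h j • ψ j -
            ∑ j, V.starProjection (vitaliDiff k n h j • ψ j) := by
            rw [← h0, ← hexp h (margin_mem k n _)]
        _ = _ := (Finset.sum_sub_distrib _ _).symm.trans ?_
      refine Finset.sum_congr rfl fun j _ => ?_
      rw [map_smul, smul_sub]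
    have h2 : inner ℝ e h = inner ℝ (V.starProjection e) h +
        ∑ j, vitaliDiff k n h j * inner ℝ (ψ j - V.starProjection (ψ j)) e := by
      have : inner ℝ e h = inner ℝ e (V.starProjection h) + inner ℝ e (h - V.starProjection h) := by
        rw [← inner_add_right, add_sub_cancel]
      rw [this, Submodule.inner_starProjection_left_eq_right, h1, inner_sum]
      congr 1
      refine Finset.sum_congr rfl fun j _ => ?_
      rw [real_inner_smul_right, real_inner_comm]
    rw [h2]
    refine add_le_add (real_inner_le_norm _ _) ?_
    rw [Finset.mul_sum]
    refine Finset.sum_le_sum fun j _ => ?_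
    refine (le_abs_self _).trans ?_
    rw [abs_mul]
    calc _ ≤ |vitaliDiff k n h j| * (size n * lam * (1 - Q j)) := by gcongr; exact hψ j
      _ = _ := by ring
  -- The weights 1 − Q turn the −1 of the penalty off S into −Q, and vanish on S.
  have hcomb : ∑ j : box (k + 1) n, (1 - Q j) * |vitaliDiff k n h j| +
      ∑ j : box (k + 1) n, (if (j : Fin d → ℕ) ∈ S then 1 else -1) * |vitaliDiff k n h j| =
      ∑ j : box (k + 1) n, (if (j : Fin d → ℕ) ∈ S then 1 else -Q j) * |vitaliDiff k n h j| := by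
    rw [← Finset.sum_add_distrib]
    refine Finset.sum_congr rfl fun j _ => ?_
    split_ifs with hj
    · rw [hQ j hj]; ring
    · ring
  set N := size n
  set s := √N
  have hs0 : 0 < s := Real.sqrt_pos.2 hn
  have hsN : s ^ 2 = N := Real.sq_sqrt hn.le
  set p := ‖V.starProjection e‖
  set y := ‖h‖
  have h3 : 2 * inner ℝ e h / N ≤ 2 * (p * y) / N +
      2 * lam * ∑ j : box (k + 1) n, (1 - Q j) * |vitaliDiff k n h j| := by
    calc 2 * inner ℝ e h / N ≤ 2 * (p * y + N * lam *
          ∑ j : box (k + 1) n, (1 - Q j) * |vitaliDiff k n h j|) / N := by gcongr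
      _ = _ := by field_simp
  have h4 : 2 * lam * (vitaliTV k n g - vitaliTV k n fhat) ≤ 2 * lam * (2 * vitaliTVOff k n S g +
      ∑ j : box (k + 1) n, (if (j : Fin d → ℕ) ∈ S then 1 else -1) * |vitaliDiff k n h j|) := by
    gcongr
  have h5 : 2 * lam * ∑ j : box (k + 1) n, (if (j : Fin d → ℕ) ∈ S then 1 else -Q j) *
      |vitaliDiff k n h j| ≤ 2 * lam * (Γ * (y / s)) := by gcongr
  rw [← hcomb] at h5
  -- Here and in `h7`, Young's inequality spends one half of the ‖h‖²/n gained in the basic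
  -- inequality.
  have h6 : 2 * (p * y) / N ≤ 2 * a / N + y ^ 2 / N / 2 := by
    have : 2 * (p * y) ≤ 2 * a + y ^ 2 / 2 := by nlinarith [sq_nonneg (2 * p - y)]
    calc _ ≤ (2 * a + y ^ 2 / 2) / N := by gcongr
      _ = _ := by ring
  have h7 : 2 * lam * (Γ * (y / s)) ≤ 2 * lam ^ 2 * Γ ^ 2 + y ^ 2 / N / 2 := by
    rw [← hsN, ← div_pow]
    nlinarith [sq_nonneg (2 * lam * Γ - y / s)]
  linarith

theorem one_le_size (n : Fin d → ℕ) (hn : ∀ i, 1 ≤ n i) : 1 ≤ size n := by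
  have : 1 ≤ ∏ i, n i := Finset.one_le_prod' fun i _ => hn i
  rw [size]
  exact_mod_cast this

/-- The adaptivity bound with a lower bound `c > 0` on the tuning constant. -/
theorem exists_adaptivity_constant (k : ℕ) (hk : 1 ≤ k) (d : ℕ) (hd : 1 ≤ d) (c : ℝ) (hc : 0 < c) :
    ∃ K : ℝ, 0 < K ∧ ∀ (n : Fin d → ℕ), (∀ i, k < n i) → ∀ (σ : ℝ), 0 < σ →
      ∀ (f0 : Tensor n) (Ω : Type*) [MeasurableSpace Ω] (P : Measure Ω) [IsProbabilityMeasure P]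
        (ε : box 1 n → Ω → ℝ),
        (∀ j, HasLaw (ε j) (gaussianReal 0 (σ ^ 2).toNNReal) P) → iIndepFun ε P →
      ∀ (t : ℝ), 0 < t → ∀ (g : Tensor n) (S : Finset (Fin d → ℕ))
        (lo hi : (Fin d → ℕ) → Fin d → ℕ), IsTessellation k n S lo hi →
      ∀ (lam : ℝ), c * √(∑ i, ((dMax k S lo hi i : ℝ) / n i) ^ (2 * k - 1)) * lambda0 n σ t ≤ lam →
        P.real {ω | ¬ ∀ fhat : Tensor n,
          IsTrendFilter k n lam (f0 + WithLp.toLp 2 fun j => ε j ω) fhat →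
          ‖margin k n (fhat - f0)‖ ^ 2 / size n ≤ ‖g - margin k n f0‖ ^ 2 / size n +
            4 * lam * vitaliTVOff k n S g + K * (lam ^ 2 *
              (∑ i, Real.log (Real.exp 1 * dMax k S lo hi i)) * cellSum k n S lo hi)} ≤
          Real.exp (-t) := by
  obtain ⟨K, M, hK, hcert⟩ := exists_certificate k hk d hd c hc
  refine ⟨2 * K + 4 * M / c ^ 2, by positivity, ?_⟩
  intro n hn σ hσ f0 Ω _ P _ ε hlaw hind t ht g S lo hi hT lam hlam
  obtain ⟨ψ, V, Q, hV, hexp, hQ, hQ1, hψ, hΓ⟩ := hcert n hn S lo hi hT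
  have hn1 : ∀ i, 1 ≤ n i := fun i => by have := hn i; omega
  set N := size n with hN
  have hN1 : 1 ≤ N := one_le_size n hn1
  have hN0 : 0 < N := by linarith
  have hSne : S.Nonempty := by
    obtain ⟨m, hm, _⟩ := hT.cover n (by
      simp only [box, Fintype.mem_piFinset, Finset.mem_Icc]
      intro i
      have := hn i
      omega)
    exact ⟨m, hm⟩
  set G := √(∑ i, ((dMax k S lo hi i : ℝ) / n i) ^ (2 * k - 1)) with hG
  have hG2 : G ^ 2 = ∑ i, ((dMax k S lo hi i : ℝ) / n i) ^ (2 * k - 1) :=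
    Real.sq_sqrt (Finset.sum_nonneg fun i _ => by positivity)
  set L := ∑ i, Real.log (Real.exp 1 * dMax k S lo hi i) with hL
  have hL1 : 1 ≤ L := one_le_sum_log_dMax k hk hd n S hSne lo hi hT
  set Z := cellSum k n S lo hi with hZ
  have hZ0 : 0 ≤ Z := Finset.sum_nonneg fun τ _ => Finset.sum_nonneg fun z _ =>
    pow_nonneg (div_nonneg hN0.le (Finset.prod_nonneg fun i _ => Nat.cast_nonneg _)) _
  have hcard : (S.card : ℝ) ≤ G ^ 2 * Z := by
    rw [hG2]
    exact card_le_mul_cellSum k hk hd n S lo hi hT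
  set v := 2 * Real.log (2 * N) + 2 * t with hv
  have hv0 : 0 < v := by
    have : 0 ≤ Real.log (2 * N) := Real.log_nonneg (by linarith)
    linarith
  have hl0 : lambda0 n σ t = σ * √v / √N := by
    rw [lambda0, Real.sqrt_div hv0.le, mul_div_assoc]
  have hs0 : 0 < √N := Real.sqrt_pos.2 hN0
  have hl00 : 0 ≤ lambda0 n σ t := by rw [hl0]; positivity
  have hcG : 0 ≤ c * G := by positivity
  have hlam0 : 0 ≤ lam := (mul_nonneg hcG hl00).trans hlam
  have hbad := measure_noise_bad_le hlaw hind hσ (fun j => ψ j - V.starProjection (ψ j)) V N t hN1 ht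
    (by rw [Fintype.card_coe]; exact card_box_succ_lt k hk hd n hn)
    (by
      rw [hN, ← card_box_one]
      have := Submodule.finrank_le V
      rw [finrank_euclideanSpace, Fintype.card_coe] at this
      exact_mod_cast this)
  refine le_trans (measureReal_mono fun ω hω => ?_) hbad
  refine fun hgood => hω fun fhat hf => ?_
  have horacle := oracle_inequality_of_noise_bound k n hN0 S lam hlam0 f0 _ fhat g hf ψ V Q
    (√(K * L * Z)) (Module.finrank ℝ V * (2 * σ ^ 2 * v)) hexp hQ (fun j => by
      refine (hgood.1 j).trans ?_
      calc σ * ‖ψ j - V.starProjection (ψ j)‖ * √v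
          ≤ σ * (c * √N * G * (1 - Q j)) * √v := by gcongr; exact hψ j
        _ = N * (c * G * lambda0 n σ t) * (1 - Q j) := by
          rw [hl0]
          have : √N ^ 2 = N := Real.sq_sqrt hN0.le
          field_simp
          rw [this]
          ring
        _ ≤ N * lam * (1 - Q j) := by
          have := sub_nonneg.2 (hQ1 j)
          gcongr) hgood.2 hΓ
  refine horacle.trans ?_
  have hΓ2 : √(K * L * Z) ^ 2 = K * L * Z := Real.sq_sqrt (by positivity)
  -- The cost of `V` is at most 4M s λ₀². With s ≤ G²Z and cGλ₀ ≤ λ it is at most (4M/c²) λ² Z, and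
  -- L ≥ 1.
  have hdim : 2 * (Module.finrank ℝ V * (2 * σ ^ 2 * v)) / N ≤ 4 * M / c ^ 2 * (lam ^ 2 * L * Z) := by
    have h1 : σ ^ 2 * v / N = lambda0 n σ t ^ 2 := by
      rw [hl0, div_pow, mul_pow, Real.sq_sqrt hv0.le, Real.sq_sqrt hN0.le]
    have h2 : (c * G * lambda0 n σ t) ^ 2 ≤ lam ^ 2 :=
      pow_le_pow_left₀ (mul_nonneg hcG hl00) hlam 2
    have h3 : (Module.finrank ℝ V : ℝ) ≤ M * S.card := by exact_mod_cast hV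
    calc 2 * (Module.finrank ℝ V * (2 * σ ^ 2 * v)) / N
        = 4 * Module.finrank ℝ V * (σ ^ 2 * v / N) := by ring
      _ = 4 * Module.finrank ℝ V * lambda0 n σ t ^ 2 := by rw [h1]
      _ ≤ 4 * (M * (G ^ 2 * Z)) * lambda0 n σ t ^ 2 := by
          gcongr
          exact h3.trans (by gcongr)
      _ = 4 * M / c ^ 2 * ((c * G * lambda0 n σ t) ^ 2 * 1 * Z) := by field_simp
      _ ≤ 4 * M / c ^ 2 * (lam ^ 2 * L * Z) := by gcongr
  rw [hΓ2]
  calc _ ≤ ‖g - margin k n f0‖ ^ 2 / N + 4 * lam * vitaliTVOff k n S g +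
        4 * M / c ^ 2 * (lam ^ 2 * L * Z) + 2 * lam ^ 2 * (K * L * Z) := by gcongr
    _ = _ := by ring

end VitaliTF

theorem VitaliTF.aZero_pos (k : ℕ) : 0 < VitaliTF.aZero k := by
  unfold VitaliTF.aZero
  split <;> positivity

theorem theorem3p1 (k : ℕ) (hk : k ∈ Finset.Icc 1 4) :
    ∃ C₀ : ℝ, 0 < C₀ ∧ ∃ N : ℕ, ∀ d : ℕ, 1 ≤ d → ∃ K : ℝ, 0 < K ∧
      ∀ (n : Fin d → ℕ), (∀ i, k < n i) →
      ∀ (σ : ℝ), 0 < σ →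
      ∀ (f0 : VitaliTF.Tensor n)
        (Ω : Type*) [MeasurableSpace Ω] (P : Measure Ω) [IsProbabilityMeasure P]
        (ε : VitaliTF.box 1 n → Ω → ℝ),
        (∀ j, HasLaw (ε j) (gaussianReal 0 (σ ^ 2).toNNReal) P) → iIndepFun ε P →
      ∀ (x t : ℝ), 0 < x → 0 < t →
      ∀ (g : VitaliTF.Tensor n) (S : Finset (Fin d → ℕ)),
        (∀ τ ∈ S, ∀ i, k + 1 + (k + 2) * k ≤ τ i ∧ τ i + k + (k + 2) * k ≤ n i + 1) →
      ∀ (lo hi : (Fin d → ℕ) → Fin d → ℕ), VitaliTF.IsTessellation k n S lo hi →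
      ∀ (C : ℝ),
        (C₀ ≤ C ∨
          ((k : ℝ) ^ ((2 * (k : ℝ) - 1) / 2) / VitaliTF.aZero k ≤ C ∧
            ∀ τ ∈ S, ∀ i, N ≤ VitaliTF.dMinus lo τ i ∧ N ≤ VitaliTF.dPlus k hi τ i)) →
      ∀ (lam : ℝ),
        C * d * √(∑ i, ((VitaliTF.dMax k S lo hi i : ℝ) / n i) ^ (2 * k - 1)) *
            VitaliTF.lambda0 n σ t ≤ lam →
        1 - Real.exp (-x) - Real.exp (-t) ≤
          P.real {ω | ∀ fhat : VitaliTF.Tensor n,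
            VitaliTF.IsTrendFilter k n lam (f0 + WithLp.toLp 2 fun j => ε j ω) fhat →
            ‖VitaliTF.margin k n (fhat - f0)‖ ^ 2 / VitaliTF.size n ≤
              ‖g - VitaliTF.margin k n f0‖ ^ 2 / VitaliTF.size n
                + 4 * lam * VitaliTF.vitaliTVOff k n S g
                + 2 * σ ^ 2 / VitaliTF.size n * (√x + √(k * S.card)) ^ 2
                + K * (lam ^ 2 *
                    (∑ i, Real.log (Real.exp 1 * VitaliTF.dMax k S lo hi i)) *
                    ∑ τ ∈ S, ∑ z : Fin d → Bool,
                      (VitaliTF.size n / VitaliTF.dProd k lo hi τ z) ^ (2 * k - 1))} := by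
  have hk1 : 1 ≤ k := (Finset.mem_Icc.1 hk).1
  have hk0 : (0 : ℝ) < k := by exact_mod_cast hk1
  set c : ℝ := (k : ℝ) ^ ((2 * (k : ℝ) - 1) / 2) / VitaliTF.aZero k with hcdef
  have hc : 0 < c := div_pos (Real.rpow_pos_of_pos hk0 _) (VitaliTF.aZero_pos k)
  -- With C₀ equal to the sharper constant c, both alternatives give C ≥ c; positivity of c is all
  -- that the argument needs.
  refine ⟨c, hc, 0, fun d hd => ?_⟩
  obtain ⟨K, hK, hmain⟩ := VitaliTF.exists_adaptivity_constant k hk1 d hd c hc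
  refine ⟨K, hK, ?_⟩
  intro n hn σ hσ f0 Ω _ P _ ε hlaw hind x t hx ht g S _ lo hi hT C hC lam hlam
  have hcC : c ≤ C := hC.elim id And.left
  have hd' : (1 : ℝ) ≤ d := by exact_mod_cast hd
  have hsize : 0 < VitaliTF.size n := Finset.prod_pos fun i _ => by
    exact_mod_cast (Nat.zero_le k).trans_lt (hn i)
  have hl0 : 0 ≤ VitaliTF.lambda0 n σ t := mul_nonneg hσ.le (Real.sqrt_nonneg _)
  have hcCd : c ≤ C * d := hcC.trans (le_mul_of_one_le_right (hc.le.trans hcC) hd')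
  have hbad := hmain n hn σ hσ f0 Ω P ε hlaw hind t ht g S lo hi hT lam
    (le_trans (by gcongr) hlam)
  set A := {ω | ∀ fhat : VitaliTF.Tensor n,
    VitaliTF.IsTrendFilter k n lam (f0 + WithLp.toLp 2 fun j => ε j ω) fhat →
    ‖VitaliTF.margin k n (fhat - f0)‖ ^ 2 / VitaliTF.size n ≤
      ‖g - VitaliTF.margin k n f0‖ ^ 2 / VitaliTF.size n +
        4 * lam * VitaliTF.vitaliTVOff k n S g + K * (lam ^ 2 *
          (∑ i, Real.log (Real.exp 1 * VitaliTF.dMax k S lo hi i)) *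
          VitaliTF.cellSum k n S lo hi)} with hA
  -- Subadditivity avoids any appeal to the measurability of `A`, which quantifies over all
  -- minimisers.
  have huniv : (1 : ℝ) ≤ P.real A + P.real Aᶜ := by
    have := measureReal_union_le (μ := P) A Aᶜ
    rwa [Set.union_compl_self, probReal_univ] at this
  have hcompl : P.real Aᶜ ≤ Real.exp (-t) := hbad
  have hexp := Real.exp_pos (-x)
  refine le_trans (by linarith : _ ≤ P.real A) (measureReal_mono fun ω hω fhat hf => ?_)
  refine (hω fhat hf).trans ?_
  -- The dimension of V has been paid for inside the λ² term, so this term is merely added on the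
  -- right.
  have hnn : 0 ≤ 2 * σ ^ 2 / VitaliTF.size n * (√x + √(k * S.card)) ^ 2 := by positivity
  rw [VitaliTF.cellSum]
  linarith
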